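/- **Setting.** Let $\mathcal G$ be a finite-dimensional semisimple Hopf algebra over $\mathbb C$ with coproduct $\Delta$, counit $\epsilon$, antipode $\mathcal S$, and a conjugate-linear involution $*$. Write $P$ for the flip and $X'=PXP$, $\Delta'=P\Delta P$; tensor products carry the factorwise $*$. Let $R\in\mathcal G\otimes\mathcal G$ be invertible with $R\Delta(\xi)=\Delta'(\xi)R$, $(\mathrm{id}\otimes\Delta)(R)=R_{13}R_{12}$, $(\Delta\otimes \mathrm{id})(R)=R_{13}R_{23}$, and let $v\in\mathcal G$ be an invertible central element with $R'R=(v\otimes v)\Delta(v^{-1})$, $\mathcal S(v)=v$, $\epsilon(v)=1$. Assume $R^*=(R^{-1})'$, $\Delta(\xi)^*=\Delta'(\xi^*)$, $v^*=v^{-1}$, and fix a central $\kappa$ with $\kappa^2=v$. Let $\tau^I:\mathcal G\to\mathrm{End}(V^I)$ be irreducible $*$-representations on finite-dimensional Hilbert spaces, exactly one from each equivalence class of irreducible representations, and assume that $\mathcal G$ is modular: the matrix $\big((\mathrm{tr}^I_q\otimes \mathrm{tr}^J_q)(\tau^I\otimes\tau^J)(R'R)\big)_{IJ}$ is invertible,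 where $\mathrm{tr}_q^I(X)=\mathrm{tr}(X\tau^I(w))$ and $w^{-1}=v^{-1}\sum \mathcal S(r^2)r^1$ for $R=\sum r^1\otimes r^2$. Let $\mathcal M=\bigoplus_I V^I$ (orthogonal direct sum), $\mathcal V=\mathrm{End}(\mathcal M)$, and regard $\mathcal G$ as a subalgebra of $\mathcal V$ by its diagonal action. Let $\mathcal C$ be the center of $\mathcal G$, and let $\mathcal G_a$ be another copy of $\mathcal G$. Put $R_+=R$, $R_-=(R')^{-1}$, $N_\pm=R_\pm\in\mathcal G_a\otimes\mathcal G$, $N=N_+N_-^{-1}$, $S=R_+\Delta(\kappa)(\kappa\otimes\kappa)^{-1}$. Superscripts and subscripts $1,2,3$ indicate positions of tensor factors $\mathcal G_a$, and $\Delta_a=\Delta\otimes\mathrm{id}$ acts on a factor $\mathcal G_a$. A *vertex operator* for $\mathcal G$ is an invertible $\Phi\in\mathcal G_a\otimes\mathcal V$ with $\xi\Phi=\Phi\Delta'(\xi)$ for all $\xi\in\mathcal G$ and $\Phi^*=S^{-1}\Phi^{-1}=\kappa_a\kappa N_+^{-1}\Phi^{-1}\kappa^{-1}$, where $\kappa_a=\kappa\otimes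 1$ and $\xi=1\otimes \xi$. **Hypotheses.** Let $F\in\mathcal G_a\otimes\mathcal G_a\otimes\mathcal C$ be invertible and let $\sigma:\mathcal C\to\mathcal G_a\otimes\mathcal C$ be a homomorphism of unital algebras. Put $D=(v\otimes 1)(1\otimes v^{-1})\sigma(v)$, $\mathcal R_\pm=F'R_\pm F^{-1}$ (where $F'$ is $F$ with its first two factors exchanged) and $\Delta_F(\cdot)=F\,\Delta_a(\cdot)\,F^{-1}$, and let $\overset{i}{\sigma}$ be $\sigma$ applied to the factor $\mathcal C$ with the new factor $\mathcal G_a$ put in position $i$. Suppose that, for all $f\in\mathcal C$ and $\xi\in\mathcal G$, $$(e\otimes F)\,(\mathrm{id}\otimes\Delta_a)(F)=\overset{3}{\sigma}(F)\,(\Delta_a\otimes \mathrm{id})(F),\qquad \overset{2}{\sigma}\overset{1}{\sigma}(f)=\Delta_F(\sigma(f)),$$ $$\overset{1}{D}\mathcal R_-=\mathcal R_+\overset{2}{\sigma}(D),\qquad \mathcal R_-\overset{2}{D}=\overset{1}{\sigma}(D)\mathcal R_+,$$ $$\mathcal R_{\pm,12}\,\overset{2}{\sigma}(\mathcal R_{\pm,13})\,\mathcal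 R_{\pm,23}=\overset{1}{\sigma}(\mathcal R_{\pm,23})\,\mathcal R_{\pm,13}\,\overset{3}{\sigma}(\mathcal R_{\pm,12}),$$ $$F^*=(S\otimes 1)F^{-1},\quad \mathcal R_\pm^*=\mathcal R_\pm^{-1},\quad D^*=D^{-1},\quad \sigma(f)^*=\sigma(f^*),\quad \Delta_F(\xi)^*=\Delta_F(\xi^*).$$ **Conclusion.** There are a vertex operator $\Phi\in\mathcal G_a\otimes\mathcal V$ for $\mathcal G$ and an injective $*$-homomorphism $j:\mathcal C\to\mathcal V$ whose image is the center of $\mathcal G\subset\mathcal V$ and which satisfies $j(v)=v$, such that, when $\mathcal C$ is regarded as a subalgebra of $\mathcal V$ by means of $j$, $$\overset{2}{\Phi}\,\overset{1}{\Phi}=F\,\Delta_a(\Phi),\qquad \Phi f=\sigma(f)\Phi\quad(f\in\mathcal C),\qquad \Phi N\Phi^{-1}=D .$$ Moreover $\mathcal V=\mathrm{End}(\bigoplus_I V^I)$ is the associative unital algebra generated by $\mathcal C$ and the components $(\pi\otimes\mathrm{id})(\Phi)$, $\pi\in\mathcal G_a'$, of an invertible element $\Phi$ subject to the first two of these relations: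 it is generated by these elements, and for every unital algebra $B$ with a homomorphism $j_B:\mathcal C\to B$ and an invertible $\Phi_B\in\mathcal G_a\otimes B$ satisfying the first two relations there is a unique algebra homomorphism $\psi:\mathcal V\to B$ with $\psi\circ j=j_B$ and $(\mathrm{id}\otimes\psi)(\Phi)=\Phi_B$. -/

import Mathlib

open scoped TensorProduct

universe u₁ u₂ u₃ u₄

noncomputable section

namespace VertexOp

universe u w

/-! ### Tensor legs

`G` plays the role of both `𝒢` and its auxiliary copy `𝒢_a`.  Triple tensor products are bracketed
to the right: `𝒢_a ⊗ 𝒢_a ⊗ X` is `G ⊗ (G ⊗ X)`. -/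

section Legs

variable {G : Type*} [Ring G] [HopfAlgebra ℂ G]
variable {X : Type*} [Ring X] [Algebra ℂ X]

/-- `g ⊗ x ↦ g ⊗ e ⊗ x`. -/
def leg1 : G ⊗[ℂ] X →ₐ[ℂ] G ⊗[ℂ] (G ⊗[ℂ] X) :=
  Algebra.TensorProduct.map (AlgHom.id ℂ G) Algebra.TensorProduct.includeRight

/-- `g ⊗ x ↦ e ⊗ g ⊗ x`. -/
def leg2 : G ⊗[ℂ] X →ₐ[ℂ] G ⊗[ℂ] (G ⊗[ℂ] X) :=
  Algebra.TensorProduct.includeRight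

/-- `g ⊗ h ↦ g ⊗ h ⊗ e`, with `e` the unit of `X`. -/
def leg12 : G ⊗[ℂ] G →ₐ[ℂ] G ⊗[ℂ] (G ⊗[ℂ] X) :=
  Algebra.TensorProduct.map (AlgHom.id ℂ G) Algebra.TensorProduct.includeLeft

/-- The permutation of the first two factors, `g ⊗ h ⊗ x ↦ h ⊗ g ⊗ x`; on `𝒢_a ⊗ 𝒢_a ⊗ 𝒞` this is
`F ↦ F'`. -/
def swap12 : G ⊗[ℂ] (G ⊗[ℂ] X) →ₐ[ℂ] G ⊗[ℂ] (G ⊗[ℂ] X) :=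
  (Algebra.TensorProduct.leftComm ℂ G G X : G ⊗[ℂ] (G ⊗[ℂ] X) →ₐ[ℂ] G ⊗[ℂ] (G ⊗[ℂ] X))

/-- The permutation of the two factors, `ξ ⊗ η ↦ η ⊗ ξ`. -/
def flip : G ⊗[ℂ] G →ₐ[ℂ] G ⊗[ℂ] G :=
  (Algebra.TensorProduct.comm ℂ G G : G ⊗[ℂ] G →ₐ[ℂ] G ⊗[ℂ] G)

/-- `Δ_a = Δ ⊗ id`, the coproduct acting on the first factor. -/
def comulFirst : G ⊗[ℂ] X →ₐ[ℂ] G ⊗[ℂ] (G ⊗[ℂ] X) :=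
  (Algebra.TensorProduct.assoc ℂ ℂ ℂ G G X : (G ⊗[ℂ] G) ⊗[ℂ] X →ₐ[ℂ] G ⊗[ℂ] (G ⊗[ℂ] X)).comp
    (Algebra.TensorProduct.map (Bialgebra.comulAlgHom ℂ G) (AlgHom.id ℂ X))

/-- `id ⊗ f`. -/
def mapSnd {Y Z : Type*} [Ring Y] [Algebra ℂ Y] [Ring Z] [Algebra ℂ Z] (f : Y →ₐ[ℂ] Z) :
    G ⊗[ℂ] Y →ₐ[ℂ] G ⊗[ℂ] Z :=
  Algebra.TensorProduct.map (AlgHom.id ℂ G) f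

/-- The `π`-component `(π ⊗ id)(Φ) ∈ X` of `Φ ∈ G ⊗ X`, for a linear form `π` on `G`. -/
def component (π : Module.Dual ℂ G) : G ⊗[ℂ] X →ₗ[ℂ] X :=
  (TensorProduct.lid ℂ X).toLinearMap.comp (TensorProduct.map π LinearMap.id)

end Legs

/-! ### Ribbon Hopf `*`-algebras, their irreducible representations, modularity -/

section Hopf

variable (G : Type u) [Ring G] [HopfAlgebra ℂ G] [StarRing G] [StarModule ℂ G]

/-- A quasi-triangular ribbon structure compatible with the `*`-operation, with a chosen central
square root `κ` of the ribbon element.  The star on `G ⊗ G` is `(ξ ⊗ η)* = ξ* ⊗ η*`. -/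
structure RibbonStructure where
  R : (G ⊗[ℂ] G)ˣ
  v : Gˣ
  κ : Gˣ
  R_comul (ξ : G) : (R : G ⊗[ℂ] G) * Coalgebra.comul (R := ℂ) ξ =
    flip (Coalgebra.comul (R := ℂ) ξ) * (R : G ⊗[ℂ] G)
  /-- `(id ⊗ Δ)(R) = R₁₃ R₁₂` -/
  id_comul_R : mapSnd (Bialgebra.comulAlgHom ℂ G) (R : G ⊗[ℂ] G) =
    (leg1 (R : G ⊗[ℂ] G)) * (leg12 (R : G ⊗[ℂ] G))
  /-- `(Δ ⊗ id)(R) = R₁₃ R₂₃` -/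
  comul_id_R : comulFirst (R : G ⊗[ℂ] G) = (leg1 (R : G ⊗[ℂ] G)) * (leg2 (R : G ⊗[ℂ] G))
  v_central : (v : G) ∈ Subalgebra.center ℂ G
  /-- `R'R = (v ⊗ v) Δ(v⁻¹)` -/
  ribbon : flip (R : G ⊗[ℂ] G) * (R : G ⊗[ℂ] G) =
    ((v : G) ⊗ₜ[ℂ] (v : G)) * Coalgebra.comul (R := ℂ) ((v⁻¹ : Gˣ) : G)
  antipode_v : HopfAlgebra.antipode ℂ (v : G) = (v : G)
  counit_v : Coalgebra.counit (R := ℂ) (v : G) = 1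
  /-- `R* = (R⁻¹)'` -/
  star_R : star (R : G ⊗[ℂ] G) = flip ((R⁻¹ : (G ⊗[ℂ] G)ˣ) : G ⊗[ℂ] G)
  /-- `Δ(ξ)* = Δ'(ξ*)` -/
  star_comul (ξ : G) : star (Coalgebra.comul (R := ℂ) ξ) =
    flip (Coalgebra.comul (R := ℂ) (star ξ))
  star_v : star (v : G) = ((v⁻¹ : Gˣ) : G)
  κ_central : (κ : G) ∈ Subalgebra.center ℂ G
  κ_sq : (κ : G) ^ 2 = (v : G)

/-- The center `𝒞` of `G`, as a `*`-algebra. -/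
def Center : StarSubalgebra ℂ G where
  toSubalgebra := Subalgebra.center ℂ G
  star_mem' := fun ha => Set.star_mem_center ha

variable {G}

namespace RibbonStructure

variable (𝓡 : RibbonStructure G)

/-- The ribbon element as an element of `𝒞`. -/
def vC : (Center G)ˣ where
  val := ⟨(𝓡.v : G), 𝓡.v_central⟩
  inv := ⟨((𝓡.v⁻¹ : Gˣ) : G), by
    refine Subalgebra.mem_center_iff.2 fun b => ?_
    have h := Subalgebra.mem_center_iff.1 𝓡.v_central b
    have h' : Commute b (𝓡.v : G) := h
    exact h'.units_inv_right⟩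
  val_inv := Subtype.ext 𝓡.v.mul_inv
  inv_val := Subtype.ext 𝓡.v.inv_mul

/-- `R₊ = R`. -/
def Rplus : (G ⊗[ℂ] G)ˣ := 𝓡.R

/-- `R₋ = (R')⁻¹`. -/
def Rminus : (G ⊗[ℂ] G)ˣ := (Units.map (flip (G := G) : G ⊗[ℂ] G →* G ⊗[ℂ] G) 𝓡.R)⁻¹

/-- `N = N₊ N₋⁻¹`, where `N_± = R_±`. -/
def N : (G ⊗[ℂ] G)ˣ := 𝓡.Rplus * 𝓡.Rminus⁻¹

/-- `κ ⊗ κ`. -/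
def κκ : (G ⊗[ℂ] G)ˣ :=
  Units.map (Algebra.TensorProduct.includeLeft : G →ₐ[ℂ] G ⊗[ℂ] G).toMonoidHom 𝓡.κ *
    Units.map (Algebra.TensorProduct.includeRight : G →ₐ[ℂ] G ⊗[ℂ] G).toMonoidHom 𝓡.κ

/-- `S = R₊ Δ(κ) (κ ⊗ κ)⁻¹`. -/
def S : (G ⊗[ℂ] G)ˣ :=
  𝓡.Rplus * Units.map (Bialgebra.comulAlgHom ℂ G).toMonoidHom 𝓡.κ * 𝓡.κκ⁻¹

/-- The element `w`, determined by `w⁻¹ = v⁻¹ ∑ 𝒮(r²) r¹` for `R = ∑ r¹ ⊗ r²`. -/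
def wElt : G :=
  Ring.inverse (((𝓡.v⁻¹ : Gˣ) : G) *
    LinearMap.mul' ℂ G (TensorProduct.map (HopfAlgebra.antipode ℂ) LinearMap.id
      (flip (𝓡.R : G ⊗[ℂ] G))))

end RibbonStructure

section Irreps

variable {I : Type*} [Fintype I] {V : I → Type*} [∀ i, NormedAddCommGroup (V i)]
  [∀ i, InnerProductSpace ℂ (V i)] [∀ i, FiniteDimensional ℂ (V i)] [∀ i, CompleteSpace (V i)]

/-- The `τ i` are irreducible `*`-representations on Hilbert spaces, exactly one from each
equivalence class of irreducible representations of `G`. -/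
structure IsIrrepSystem (τ : ∀ i, G →⋆ₐ[ℂ] (V i →L[ℂ] V i)) : Prop where
  nontrivial : ∀ i, Nontrivial (V i)
  irreducible : ∀ i (W : Submodule ℂ (V i)), (∀ ξ : G, ∀ x ∈ W, τ i ξ x ∈ W) → W = ⊥ ∨ W = ⊤
  inequivalent : ∀ i j (e : V i ≃ₗ[ℂ] V j), (∀ ξ x, e (τ i ξ x) = τ j ξ (e x)) → i = j
  complete : ∀ (W : Type u) [AddCommGroup W] [Module G W] [IsSimpleModule G W],
    ∃ (i : I) (e : W ≃+ V i), ∀ (ξ : G) (x : W), e (ξ • x) = τ i ξ (e x)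

/-- The quantum trace `tr_q(X) = tr(X τ(w))`. -/
def qTrace (𝓡 : RibbonStructure G) (τ : ∀ i, G →⋆ₐ[ℂ] (V i →L[ℂ] V i)) (i : I) :
    (V i →L[ℂ] V i) →ₗ[ℂ] ℂ :=
  (LinearMap.trace ℂ (V i)).comp
    ((ContinuousLinearMap.coeLM ℂ).comp (LinearMap.mulRight ℂ (τ i 𝓡.wElt)))

/-- The `S`-matrix `(tr_q ⊗ tr_q)((τ i ⊗ τ j)(R'R))`, with normalization factor `1`; a nonzero
factor does not affect its invertibility. -/
def sMatrix (𝓡 : RibbonStructure G) (τ : ∀ i, G →⋆ₐ[ℂ] (V i →L[ℂ] V i)) : Matrix I I ℂ :=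
  Matrix.of fun i j =>
    LinearMap.mul' ℂ ℂ
      (TensorProduct.map (qTrace 𝓡 τ i) (qTrace 𝓡 τ j)
        (Algebra.TensorProduct.map (τ i).toAlgHom (τ j).toAlgHom
          (flip (𝓡.R : G ⊗[ℂ] G) * (𝓡.R : G ⊗[ℂ] G))))

/-- The model space `ℳ = ⨁ V i`, a Hilbert space direct sum. -/
abbrev ModelSpace (V : I → Type*) [∀ i, NormedAddCommGroup (V i)] : Type _ := PiLp 2 V

/-- The algebra `𝒱 = End(ℳ)`; its star is the Hilbert space adjoint.  As `ℳ` is finite dimensional,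
continuity is no restriction. -/
abbrev ModelEnd (V : I → Type*) [∀ i, NormedAddCommGroup (V i)] [∀ i, InnerProductSpace ℂ (V i)] :
    Type _ := ModelSpace V →L[ℂ] ModelSpace V

/-- The canonical (diagonal) action of `G` on the model space. -/
def modelRep (τ : ∀ i, G →⋆ₐ[ℂ] (V i →L[ℂ] V i)) : G →ₐ[ℂ] ModelEnd V :=
  AlgHom.ofLinearMap
    { toFun := fun ξ => LinearMap.toContinuousLinearMap
        { toFun := fun x => WithLp.toLp 2 fun i => τ i ξ (x i)
          map_add' := fun x y => by ext i; simp
          map_smul' := fun c x => by ext i; simp }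
      map_add' := fun ξ η => by ext x i; simp
      map_smul' := fun c ξ => by ext x i; simp }
    (by ext x i; simp)
    (fun ξ η => by ext x i; simp)

/-- Vertex operators for `G`: invertible `Φ ∈ 𝒢_a ⊗ End(ℳ)`, covariant and unitary in the
generalized sense. -/
structure IsVertexOperator (𝓡 : RibbonStructure G) (τ : ∀ i, G →⋆ₐ[ℂ] (V i →L[ℂ] V i))
    (Φ : (G ⊗[ℂ] ModelEnd V)ˣ) : Prop where
  /-- `ξ Φ = Φ Δ'(ξ)` -/
  covariance : ∀ ξ : G, ((1 : G) ⊗ₜ[ℂ] modelRep τ ξ) * (Φ : G ⊗[ℂ] ModelEnd V) =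
    (Φ : G ⊗[ℂ] ModelEnd V) * mapSnd (modelRep τ) (flip (Coalgebra.comul (R := ℂ) ξ))
  /-- `Φ* = S⁻¹ Φ⁻¹` -/
  star_eq : star (Φ : G ⊗[ℂ] ModelEnd V) =
    mapSnd (modelRep τ) ((𝓡.S⁻¹ : (G ⊗[ℂ] G)ˣ) : G ⊗[ℂ] G) *
      ((Φ⁻¹ : (G ⊗[ℂ] ModelEnd V)ˣ) : G ⊗[ℂ] ModelEnd V)
  /-- `Φ* = κ_a κ N₊⁻¹ Φ⁻¹ κ⁻¹` -/
  star_eq' : star (Φ : G ⊗[ℂ] ModelEnd V) =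
    ((𝓡.κ : G) ⊗ₜ[ℂ] (1 : ModelEnd V)) * ((1 : G) ⊗ₜ[ℂ] modelRep τ (𝓡.κ : G)) *
      mapSnd (modelRep τ) ((𝓡.Rplus⁻¹ : (G ⊗[ℂ] G)ˣ) : G ⊗[ℂ] G) *
      ((Φ⁻¹ : (G ⊗[ℂ] ModelEnd V)ˣ) : G ⊗[ℂ] ModelEnd V) *
      ((1 : G) ⊗ₜ[ℂ] modelRep τ ((𝓡.κ⁻¹ : Gˣ) : G))

end Irreps

/-! ### Structure data -/

section StructureData

variable (𝓡 : RibbonStructure G) (F : (G ⊗[ℂ] (G ⊗[ℂ] Center G))ˣ)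
  (σ : Center G →ₐ[ℂ] G ⊗[ℂ] Center G)

/-- `D = v_a v⁻¹ σ(v)`. -/
def structD : (G ⊗[ℂ] Center G)ˣ :=
  Units.map (Algebra.TensorProduct.includeLeft : G →ₐ[ℂ] G ⊗[ℂ] Center G).toMonoidHom 𝓡.v *
    (Units.map (Algebra.TensorProduct.includeRight : Center G →ₐ[ℂ] G ⊗[ℂ] Center G).toMonoidHom
      𝓡.vC)⁻¹ *
    Units.map σ.toMonoidHom 𝓡.vC

/-- `F' r F⁻¹` for `r ∈ 𝒢_a ⊗ 𝒢_a`. -/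
def twistedR (r : (G ⊗[ℂ] G)ˣ) : (G ⊗[ℂ] (G ⊗[ℂ] Center G))ˣ :=
  Units.map (swap12 (G := G) (X := Center G)).toMonoidHom F *
    Units.map (leg12 (G := G) (X := Center G)).toMonoidHom r * F⁻¹

/-- `ℛ₊ = F' R₊ F⁻¹`. -/
def RRplus : (G ⊗[ℂ] (G ⊗[ℂ] Center G))ˣ := twistedR F 𝓡.Rplus

/-- `ℛ₋ = F' R₋ F⁻¹`. -/
def RRminus : (G ⊗[ℂ] (G ⊗[ℂ] Center G))ˣ := twistedR F 𝓡.Rminus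

/-- `Δ_F(ξ) = F (Δ(ξ) ⊗ e) F⁻¹`. -/
def comulF (ξ : G) : G ⊗[ℂ] (G ⊗[ℂ] Center G) :=
  (F : G ⊗[ℂ] (G ⊗[ℂ] Center G)) * leg12 (Coalgebra.comul (R := ℂ) ξ) *
    ((F⁻¹ : (G ⊗[ℂ] (G ⊗[ℂ] Center G))ˣ) : G ⊗[ℂ] (G ⊗[ℂ] Center G))

/-- `Δ_F` extended to `𝒢_a ⊗ 𝒞`, acting on the first factor: `y ↦ F Δ_a(y) F⁻¹`. -/
def comulFFirst (y : G ⊗[ℂ] Center G) : G ⊗[ℂ] (G ⊗[ℂ] Center G) :=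
  (F : G ⊗[ℂ] (G ⊗[ℂ] Center G)) * comulFirst y *
    ((F⁻¹ : (G ⊗[ℂ] (G ⊗[ℂ] Center G))ˣ) : G ⊗[ℂ] (G ⊗[ℂ] Center G))

/-- The generalized Yang-Baxter equation
`ℛ₁₂ σ²(ℛ₁₃) ℛ₂₃ = σ¹(ℛ₂₃) ℛ₁₃ σ³(ℛ₁₂)` in `𝒢_a ⊗ 𝒢_a ⊗ 𝒢_a ⊗ 𝒞`.  Here `σⁱ` applies `σ` to the
factor `𝒞` and puts the new factor `𝒢_a` into position `i`; for `ℛ = r¹ ⊗ r² ⊗ c` and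
`σ(c) = s ⊗ c'`, the six factors are, in order,
`r¹ ⊗ r² ⊗ e ⊗ c`, `r¹ ⊗ s ⊗ r² ⊗ c'`, `e ⊗ r¹ ⊗ r² ⊗ c`,
`s ⊗ r¹ ⊗ r² ⊗ c'`, `r¹ ⊗ e ⊗ r² ⊗ c`, `r¹ ⊗ r² ⊗ s ⊗ c'`. -/
def DynamicalYangBaxter (ℛ : G ⊗[ℂ] (G ⊗[ℂ] Center G)) : Prop :=
  mapSnd leg1 ℛ * mapSnd swap12 (mapSnd (mapSnd σ) ℛ) * leg2 (X := G ⊗[ℂ] Center G) ℛ =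
    swap12 (X := G ⊗[ℂ] Center G) (mapSnd swap12 (mapSnd (mapSnd σ) ℛ)) *
      leg1 (X := G ⊗[ℂ] Center G) ℛ * mapSnd (mapSnd σ) ℛ

/-- The relations imposed on `F`, `σ`, with `D`, `ℛ_±` defined from them. -/
structure StructureRelations : Prop where
  /-- `(e ⊗ F) (id ⊗ Δ_a)(F) = σ³(F) (Δ_a ⊗ id)(F)` -/
  cocycle : leg2 (X := G ⊗[ℂ] Center G) (F : G ⊗[ℂ] (G ⊗[ℂ] Center G)) *
      mapSnd comulFirst (F : G ⊗[ℂ] (G ⊗[ℂ] Center G)) =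
    mapSnd (mapSnd σ) (F : G ⊗[ℂ] (G ⊗[ℂ] Center G)) *
      comulFirst (X := G ⊗[ℂ] Center G) (F : G ⊗[ℂ] (G ⊗[ℂ] Center G))
  /-- `D¹ ℛ₋ = ℛ₊ σ²(D)` -/
  D_left : leg1 (structD 𝓡 σ : G ⊗[ℂ] Center G) * (RRminus 𝓡 F : G ⊗[ℂ] (G ⊗[ℂ] Center G)) =
    (RRplus 𝓡 F : G ⊗[ℂ] (G ⊗[ℂ] Center G)) * mapSnd σ (structD 𝓡 σ : G ⊗[ℂ] Center G)
  /-- `ℛ₋ D² = σ¹(D) ℛ₊` -/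
  D_right : (RRminus 𝓡 F : G ⊗[ℂ] (G ⊗[ℂ] Center G)) * leg2 (structD 𝓡 σ : G ⊗[ℂ] Center G) =
    swap12 (mapSnd σ (structD 𝓡 σ : G ⊗[ℂ] Center G)) *
      (RRplus 𝓡 F : G ⊗[ℂ] (G ⊗[ℂ] Center G))
  /-- `σ² σ¹(f) = Δ_F(σ(f))` -/
  σ_σ : ∀ f : Center G, mapSnd σ (σ f) = comulFFirst F (σ f)
  yangBaxter_plus : DynamicalYangBaxter σ (RRplus 𝓡 F : G ⊗[ℂ] (G ⊗[ℂ] Center G))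
  yangBaxter_minus : DynamicalYangBaxter σ (RRminus 𝓡 F : G ⊗[ℂ] (G ⊗[ℂ] Center G))
  /-- `F* = S_a F⁻¹` -/
  star_F : star (F : G ⊗[ℂ] (G ⊗[ℂ] Center G)) =
    leg12 (𝓡.S : G ⊗[ℂ] G) * ((F⁻¹ : (G ⊗[ℂ] (G ⊗[ℂ] Center G))ˣ) : G ⊗[ℂ] (G ⊗[ℂ] Center G))
  star_RRplus : star (RRplus 𝓡 F) = (RRplus 𝓡 F)⁻¹
  star_RRminus : star (RRminus 𝓡 F) = (RRminus 𝓡 F)⁻¹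
  star_D : star (structD 𝓡 σ) = (structD 𝓡 σ)⁻¹
  star_σ : ∀ f : Center G, star (σ f) = σ (star f)
  star_comulF : ∀ ξ : G, star (comulF F ξ) = comulF F (star ξ)

/-- The relations `Φ² Φ¹ = F Δ_a(Φ)` and `Φ f = σ(f) Φ` for an invertible `Φ ∈ 𝒢_a ⊗ A`, where
`j : 𝒞 → A` says how `𝒞` sits in the algebra `A`. -/
structure SolvesRelations {A : Type*} [Ring A] [Algebra ℂ A] (j : Center G →ₐ[ℂ] A)
    (Φ : (G ⊗[ℂ] A)ˣ) : Prop where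
  operatorProduct : leg2 (Φ : G ⊗[ℂ] A) * leg1 (Φ : G ⊗[ℂ] A) =
    mapSnd (mapSnd j) (F : G ⊗[ℂ] (G ⊗[ℂ] Center G)) * comulFirst (Φ : G ⊗[ℂ] A)
  exchange : ∀ f : Center G, (Φ : G ⊗[ℂ] A) * ((1 : G) ⊗ₜ[ℂ] j f) =
    mapSnd j (σ f) * (Φ : G ⊗[ℂ] A)

/-- `(A, j, Φ)` is the algebra generated by `𝒞` and by the components of an invertible element `Φ`
subject to the relations `Φ² Φ¹ = F Δ_a(Φ)` and `Φ f = σ(f) Φ`: the relations hold, `𝒞` and the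
components of `Φ` generate `A`, and every other solution of the relations is the image of this one
under a unique algebra homomorphism. -/
structure IsAlgebraOfRelations {A : Type*} [Ring A] [Algebra ℂ A] (j : Center G →ₐ[ℂ] A)
    (Φ : (G ⊗[ℂ] A)ˣ) : Prop where
  solves : SolvesRelations F σ j Φ
  generated : Algebra.adjoin ℂ
    (Set.range j ∪ Set.range fun π : Module.Dual ℂ G => component π (Φ : G ⊗[ℂ] A)) = ⊤
  universal : ∀ (B : Type w) [Ring B] [Algebra ℂ B] (jB : Center G →ₐ[ℂ] B) (ΦB : (G ⊗[ℂ] B)ˣ),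
    SolvesRelations F σ jB ΦB →
      ∃! ψ : A →ₐ[ℂ] B, ψ.comp j = jB ∧ mapSnd ψ (Φ : G ⊗[ℂ] A) = (ΦB : G ⊗[ℂ] B)

end StructureData

end Hopf

end VertexOp

end

/-! Every solution of the first two relations carries the monodromy `M = Φ⁻¹ D Φ`, which satisfies
the functorial relations of `N`. By modularity the components of `N` span `𝒢`, so that
`M = (id ⊗ ι)(N)` for an action `ι` of `𝒢` on the solution, and `Φ` is covariant under `ι`.
Covariance and a normalized integral of `𝒢` force `dim 𝒢 ≤ dim W` for each solution on a space
`W ≠ 0`. On the other hand, the relations bring every product of generators into the normal form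
`∑ f Φ_π`, so that the generators of a solution span an algebra of dimension at most
`dim 𝒞 · dim 𝒢`.

The relations have a solution on the dual of `𝒢`. By the first estimate it is irreducible, hence
generates all operators, and the second estimate gives `(dim 𝒢)² ≤ dim 𝒞 · dim 𝒢`. So `𝒢` is
commutative, the normal form is unique, and this solution is universal.

The remaining claims are statements about characters. The eigenvalues of `S` have modulus one, and
`S = F* F ≥ 0`, so `S = 1` and `F` is unitary. The components of `Φ` along characters permute, up
to phases, an eigenbasis that `Φ` creates from the vacuum vector; declaring this basis orthonormal
makes `Φ` unitary. Finally, applying `Φ N = D Φ` to the vacuum vector determines `j(v)` up to a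
scalar, and the nonvanishing of the Gauss sum `∑ χ(v⁻¹)` shows that this scalar is one. -/

noncomputable section

namespace VertexOp

open Coalgebra HopfAlgebra Bialgebra

/-! ### Calculus of tensor legs -/

section LegCalculus

variable {G X Y Z : Type*} [Ring G] [HopfAlgebra ℂ G] [Ring X] [Algebra ℂ X] [Ring Y] [Algebra ℂ Y]
  [Ring Z] [Algebra ℂ Z]

@[simp] lemma leg1_tmul (g : G) (x : X) : leg1 (g ⊗ₜ[ℂ] x) = g ⊗ₜ[ℂ] ((1 : G) ⊗ₜ[ℂ] x) := rfl

@[simp] lemma leg2_apply (y : G ⊗[ℂ] X) : leg2 y = (1 : G) ⊗ₜ[ℂ] y := rfl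

@[simp] lemma leg12_tmul (g h : G) :
    leg12 (X := X) (g ⊗ₜ[ℂ] h) = g ⊗ₜ[ℂ] (h ⊗ₜ[ℂ] (1 : X)) := rfl

@[simp] lemma swap12_tmul (g h : G) (x : X) :
    swap12 (g ⊗ₜ[ℂ] (h ⊗ₜ[ℂ] x)) = h ⊗ₜ[ℂ] (g ⊗ₜ[ℂ] x) := rfl

@[simp] lemma flip_tmul (g h : G) : flip (g ⊗ₜ[ℂ] h) = h ⊗ₜ[ℂ] g := rfl

@[simp] lemma mapSnd_tmul (f : Y →ₐ[ℂ] Z) (g : G) (y : Y) :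
    mapSnd f (g ⊗ₜ[ℂ] y) = g ⊗ₜ[ℂ] f y := rfl

@[simp] lemma component_tmul (π : Module.Dual ℂ G) (g : G) (x : X) :
    component π (g ⊗ₜ[ℂ] x) = π g • x := rfl

@[simp] lemma flip_flip (x : G ⊗[ℂ] G) : flip (flip x) = x :=
  (TensorProduct.comm ℂ G G).symm_apply_apply x

lemma comulFirst_tmul (g : G) (x : X) :
    comulFirst (g ⊗ₜ[ℂ] x) = leg12 (comul (R := ℂ) g) * ((1 : G) ⊗ₜ[ℂ] ((1 : G) ⊗ₜ[ℂ] x)) := by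
  change TensorProduct.assoc ℂ G G X (comul (R := ℂ) g ⊗ₜ x) = _
  induction comul (R := ℂ) g <;> simp_all [TensorProduct.add_tmul, add_mul]

@[simp] lemma comulFirst_one_tmul (x : X) :
    comulFirst ((1 : G) ⊗ₜ[ℂ] x) = (1 : G) ⊗ₜ[ℂ] ((1 : G) ⊗ₜ[ℂ] x) := by
  rw [comulFirst_tmul, Bialgebra.comul_one, map_one, one_mul]

@[simp] lemma comulFirst_tmul_one (g : G) :
    comulFirst (g ⊗ₜ[ℂ] (1 : X)) = leg12 (comul (R := ℂ) g) := by
  rw [comulFirst_tmul, ← Algebra.TensorProduct.one_def, ← Algebra.TensorProduct.one_def, mul_one]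

lemma mapSnd_comul_comul (h : G) :
    mapSnd (comulAlgHom ℂ G) (comul (R := ℂ) h) = comulFirst (comul (R := ℂ) h) :=
  (coassoc_apply h).symm

lemma mapSnd_mapSnd (f : X →ₐ[ℂ] Y) (g : Y →ₐ[ℂ] Z) (y : G ⊗[ℂ] X) :
    mapSnd g (mapSnd f y) = mapSnd (g.comp f) y := by
  induction y <;> simp_all

@[simp] lemma mapSnd_leg1 (f : X →ₐ[ℂ] Y) (y : G ⊗[ℂ] X) :
    mapSnd (mapSnd f) (leg1 y) = leg1 (mapSnd f y) := by
  induction y <;> simp_all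

lemma mapSnd_leg2 (f : X →ₐ[ℂ] Y) (y : G ⊗[ℂ] X) :
    mapSnd (mapSnd f) (leg2 y) = leg2 (mapSnd f y) := rfl

@[simp] lemma mapSnd_leg12 (f : X →ₐ[ℂ] Y) (y : G ⊗[ℂ] G) :
    mapSnd (mapSnd f) (leg12 y) = leg12 y := by
  induction y <;> simp_all

@[simp] lemma mapSnd_swap12 (f : X →ₐ[ℂ] Y) (y : G ⊗[ℂ] (G ⊗[ℂ] X)) :
    mapSnd (mapSnd f) (swap12 y) = swap12 (mapSnd (mapSnd f) y) := by
  induction y with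
  | tmul a b => induction b <;> simp_all [TensorProduct.tmul_add]
  | _ => simp_all

lemma mapSnd_comulFirst (f : X →ₐ[ℂ] Y) (y : G ⊗[ℂ] X) :
    mapSnd (mapSnd f) (comulFirst y) = comulFirst (mapSnd f y) := by
  induction y <;> simp_all [comulFirst_tmul]

@[simp] lemma swap12_leg1 (y : G ⊗[ℂ] X) : swap12 (leg1 y) = leg2 y := by
  induction y <;> simp_all [TensorProduct.tmul_add]

@[simp] lemma swap12_leg2 (y : G ⊗[ℂ] X) : swap12 (leg2 y) = leg1 y := by
  induction y <;> simp_all [TensorProduct.tmul_add]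

@[simp] lemma swap12_leg12 (y : G ⊗[ℂ] G) : swap12 (leg12 (X := X) y) = leg12 (flip y) := by
  induction y <;> simp_all

lemma mapSnd_flip_leg1 (y : G ⊗[ℂ] G) : mapSnd flip (leg1 y) = leg12 y := by
  induction y <;> simp_all

lemma mapSnd_flip_leg12 (y : G ⊗[ℂ] G) : mapSnd flip (leg12 y) = leg1 y := by
  induction y <;> simp_all

lemma leg12_mul_one_tmul_one_tmul (z : G ⊗[ℂ] G) (x : X) :
    leg12 z * ((1 : G) ⊗ₜ[ℂ] ((1 : G) ⊗ₜ[ℂ] x)) = ((1 : G) ⊗ₜ[ℂ] ((1 : G) ⊗ₜ[ℂ] x)) * leg12 z := by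
  induction z <;> simp_all [add_mul, mul_add]

lemma swap12_comulFirst_mul_leg12 {r : G ⊗[ℂ] G}
    (hr : ∀ ξ, r * comul (R := ℂ) ξ = flip (comul (R := ℂ) ξ) * r) (y : G ⊗[ℂ] X) :
    swap12 (comulFirst y) * leg12 r = leg12 r * comulFirst y := by
  induction y with
  | tmul a b =>
    rw [comulFirst_tmul, map_mul, swap12_leg12, swap12_tmul, mul_assoc,
      ← leg12_mul_one_tmul_one_tmul, ← mul_assoc, ← map_mul, ← hr, map_mul, mul_assoc]
  | _ => simp_all [add_mul, mul_add]

end LegCalculus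

section Components

variable {G X Y : Type*} [Ring G] [HopfAlgebra ℂ G] [Ring X] [Algebra ℂ X] [Ring Y] [Algebra ℂ Y]

/-- The components `π ↦ (π ⊗ id)(y)` of `y ∈ G ⊗ X`, as a linear map on the dual of `G`. -/
def components (y : G ⊗[ℂ] X) : Module.Dual ℂ G →ₗ[ℂ] X where
  toFun π := component π y
  map_add' π φ := by simp [component, TensorProduct.map_add_left]
  map_smul' c π := by simp [component, TensorProduct.map_smul_left]

@[simp] lemma components_apply (y : G ⊗[ℂ] X) (π : Module.Dual ℂ G) :
    components y π = component π y := rfl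

/-- The component `(id ⊗ π)(x) ∈ G` of `x ∈ G ⊗ G`. -/
def rightComponent (π : Module.Dual ℂ G) : G ⊗[ℂ] G →ₗ[ℂ] G :=
  (TensorProduct.rid ℂ G).toLinearMap.comp (TensorProduct.map LinearMap.id π)

@[simp] lemma rightComponent_tmul (π : Module.Dual ℂ G) (g h : G) :
    rightComponent π (g ⊗ₜ[ℂ] h) = π h • g := rfl

/-- The components `π ↦ (id ⊗ π)(x)` of `x ∈ G ⊗ G`, as a linear map on the dual of `G`. -/
def rightComponents (x : G ⊗[ℂ] G) : Module.Dual ℂ G →ₗ[ℂ] G where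
  toFun π := rightComponent π x
  map_add' π φ := by simp [rightComponent, TensorProduct.map_add_right]
  map_smul' c π := by simp [rightComponent, TensorProduct.map_smul_right]

@[simp] lemma rightComponents_apply (x : G ⊗[ℂ] G) (π : Module.Dual ℂ G) :
    rightComponents x π = rightComponent π x := rfl

@[simp] lemma component_counit_comul (h : G) : component counit (comul (R := ℂ) h) = h :=
  (congrArg (TensorProduct.lid ℂ G) (rTensor_counit_comul (R := ℂ) h)).trans (by simp)

@[simp] lemma rightComponent_counit_comul (h : G) :
    rightComponent counit (comul (R := ℂ) h) = h :=
  (congrArg (TensorProduct.rid ℂ G) (lTensor_counit_comul (R := ℂ) h)).trans (by simp)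

lemma apply_component (π φ : Module.Dual ℂ G) (x : G ⊗[ℂ] G) :
    φ (component π x) = π (rightComponent φ x) := by
  induction x <;> simp_all [mul_comm]

lemma component_lTensor (f : X →ₗ[ℂ] Y) (π : Module.Dual ℂ G) (y : G ⊗[ℂ] X) :
    component π (f.lTensor G y) = f (component π y) := by
  induction y <;> simp_all

lemma component_mapSnd (f : X →ₐ[ℂ] Y) (π : Module.Dual ℂ G) (y : G ⊗[ℂ] X) :
    component π (mapSnd f y) = f (component π y) :=
  component_lTensor f.toLinearMap π y

lemma component_tmul_one_mul (π : Module.Dual ℂ G) (g : G) (y : G ⊗[ℂ] X) :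
    component π ((g ⊗ₜ[ℂ] (1 : X)) * y) = component (π.comp (LinearMap.mulLeft ℂ g)) y := by
  induction y <;> simp_all [mul_add]

lemma component_one_tmul_mul (π : Module.Dual ℂ G) (x : X) (y : G ⊗[ℂ] X) :
    component π (((1 : G) ⊗ₜ[ℂ] x) * y) = x * component π y := by
  induction y <;> simp_all [mul_add]

lemma component_mul_one_tmul (π : Module.Dual ℂ G) (y : G ⊗[ℂ] X) (x : X) :
    component π (y * ((1 : G) ⊗ₜ[ℂ] x)) = component π y * x := by
  induction y <;> simp_all [add_mul]

lemma rightComponent_tmul_one_mul (π : Module.Dual ℂ G) (g : G) (x : G ⊗[ℂ] G) :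
    rightComponent π ((g ⊗ₜ[ℂ] (1 : G)) * x) = g * rightComponent π x := by
  induction x <;> simp_all [mul_add]

lemma component_leg1 (π : Module.Dual ℂ G) (y : G ⊗[ℂ] X) :
    component π (leg1 y) = (1 : G) ⊗ₜ[ℂ] component π y := by
  induction y <;> simp_all [TensorProduct.tmul_add]

lemma component_component_leg2_mul_leg1 (π φ : Module.Dual ℂ G) (x y : G ⊗[ℂ] X) :
    component π (component φ (leg2 x * leg1 y)) = component π x * component φ y := by
  rw [leg2_apply, component_one_tmul_mul, component_leg1, component_mul_one_tmul]

lemma eq_sum_tmul_component {ι : Type*} [Fintype ι] (b : Module.Basis ι ℂ G) (y : G ⊗[ℂ] X) :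
    y = ∑ i, b i ⊗ₜ[ℂ] component (b.coord i) y := by
  induction y with
  | zero => simp
  | tmul g x =>
    simp only [component_tmul, TensorProduct.tmul_smul, TensorProduct.smul_tmul',
      ← TensorProduct.sum_tmul, Module.Basis.coord_apply, b.sum_repr]
  | add x y hx hy =>
    nth_rewrite 1 [hx, hy]
    simp only [map_add, TensorProduct.tmul_add, Finset.sum_add_distrib]

lemma ext_component [FiniteDimensional ℂ G] {x y : G ⊗[ℂ] X}
    (h : ∀ π : Module.Dual ℂ G, component π x = component π y) : x = y := by
  rw [eq_sum_tmul_component (Module.finBasis ℂ G) x, eq_sum_tmul_component (Module.finBasis ℂ G) y]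
  simp only [h]

lemma lTensor_comulFirst (f : X →ₗ[ℂ] Y) (y : G ⊗[ℂ] X) :
    (f.lTensor G).lTensor G (comulFirst y) = comulFirst (f.lTensor G y) := by
  induction y with
  | tmul a b =>
    rw [LinearMap.lTensor_tmul, comulFirst_tmul, comulFirst_tmul]
    induction comul (R := ℂ) a <;> simp_all [add_mul]
  | _ => simp_all

lemma lTensor_leg12_mul (f : X →ₗ[ℂ] Y) (z : G ⊗[ℂ] G) (y : G ⊗[ℂ] (G ⊗[ℂ] X)) :
    (f.lTensor G).lTensor G (leg12 z * y) = leg12 z * (f.lTensor G).lTensor G y := by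
  induction y with
  | tmul a b =>
    induction b with
    | tmul b c => induction z <;> simp_all [add_mul]
    | _ => simp_all [TensorProduct.tmul_add, mul_add]
  | _ => simp_all [mul_add]

lemma lTensor_mul_leg12 (f : X →ₗ[ℂ] Y) (y : G ⊗[ℂ] (G ⊗[ℂ] X)) (z : G ⊗[ℂ] G) :
    (f.lTensor G).lTensor G (y * leg12 z) = (f.lTensor G).lTensor G y * leg12 z := by
  induction y with
  | tmul a b =>
    induction b with
    | tmul b c => induction z <;> simp_all [mul_add]
    | _ => simp_all [TensorProduct.tmul_add, add_mul]
  | _ => simp_all [add_mul]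

lemma comul_rightComponent (π : Module.Dual ℂ G) (x : G ⊗[ℂ] G) :
    comul (R := ℂ) (rightComponent π x) = (rightComponent π).lTensor G (comulFirst x) := by
  induction x with
  | tmul a b =>
    rw [comulFirst_tmul, rightComponent_tmul, map_smul]
    induction comul (R := ℂ) a <;> simp_all [add_mul]
  | _ => simp_all

end Components

section EvalFirst

variable {G X Y : Type*} [Ring G] [HopfAlgebra ℂ G] [Ring X] [Algebra ℂ X] [Ring Y] [Algebra ℂ Y]

/-- `χ ⊗ id` as an algebra map, for a character `χ` of `G`. -/
def evalFirst (χ : G →ₐ[ℂ] ℂ) : G ⊗[ℂ] X →ₐ[ℂ] X :=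
  (Algebra.TensorProduct.lid ℂ X).toAlgHom.comp (Algebra.TensorProduct.map χ (AlgHom.id ℂ X))

@[simp] lemma evalFirst_tmul (χ : G →ₐ[ℂ] ℂ) (g : G) (x : X) :
    evalFirst χ (g ⊗ₜ[ℂ] x) = χ g • x := by
  simp [evalFirst]

lemma evalFirst_eq_component (χ : G →ₐ[ℂ] ℂ) (y : G ⊗[ℂ] X) :
    evalFirst χ y = component χ.toLinearMap y := by
  induction y <;> simp_all

lemma evalFirst_mapSnd (χ : G →ₐ[ℂ] ℂ) (f : X →ₐ[ℂ] Y) (y : G ⊗[ℂ] X) :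
    evalFirst χ (mapSnd f y) = f (evalFirst χ y) := by
  induction y <;> simp_all

lemma evalFirst_leg1 (χ : G →ₐ[ℂ] ℂ) (y : G ⊗[ℂ] X) :
    evalFirst χ (leg1 y) = (1 : G) ⊗ₜ[ℂ] evalFirst χ y := by
  induction y <;> simp_all [TensorProduct.tmul_add]

@[simp] lemma evalFirst_leg2 (χ : G →ₐ[ℂ] ℂ) (y : G ⊗[ℂ] X) : evalFirst χ (leg2 y) = y := by
  simp

lemma evalFirst_leg12 (χ : G →ₐ[ℂ] ℂ) (y : G ⊗[ℂ] G) :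
    evalFirst χ (leg12 (X := X) y) = evalFirst χ y ⊗ₜ[ℂ] (1 : X) := by
  induction y <;> simp_all [TensorProduct.add_tmul, TensorProduct.smul_tmul']

lemma mapSnd_evalFirst_leg1 (χ : G →ₐ[ℂ] ℂ) (y : G ⊗[ℂ] X) :
    mapSnd (evalFirst χ) (leg1 y) = y := by
  induction y <;> simp_all

lemma mapSnd_evalFirst_leg12 (χ : G →ₐ[ℂ] ℂ) (y : G ⊗[ℂ] G) :
    mapSnd (evalFirst χ) (leg12 (X := X) y) = rightComponent χ.toLinearMap y ⊗ₜ[ℂ] (1 : X) := by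
  induction y <;> simp_all [TensorProduct.add_tmul, TensorProduct.smul_tmul']

@[simp] lemma evalFirst_counit_comul (h : G) :
    evalFirst (counitAlgHom ℂ G) (comul (R := ℂ) h) = h := by
  rw [evalFirst_eq_component]
  exact component_counit_comul h

lemma evalFirst_counit_comulFirst (y : G ⊗[ℂ] X) :
    evalFirst (counitAlgHom ℂ G) (comulFirst y) = y := by
  induction y with
  | tmul a b => simp [comulFirst_tmul, evalFirst_leg12]
  | _ => simp_all

lemma mapSnd_evalFirst_counit_mapSnd_comul (x : G ⊗[ℂ] G) :
    mapSnd (evalFirst (counitAlgHom ℂ G)) (mapSnd (comulAlgHom ℂ G) x) = x := by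
  induction x <;> simp_all

end EvalFirst

section HopfCalculus

/-- The bilinear map `(a ⊗ b, x) ↦ p(a) x q(b)`. -/
def sandwich {A P Q : Type*} [Ring A] [Algebra ℂ A] [AddCommGroup P] [Module ℂ P]
    [AddCommGroup Q] [Module ℂ Q] (p : P →ₗ[ℂ] A) (q : Q →ₗ[ℂ] A) :
    P ⊗[ℂ] Q →ₗ[ℂ] A →ₗ[ℂ] A :=
  TensorProduct.lift (LinearMap.mk₂ ℂ
    (fun a b => (LinearMap.mulLeft ℂ (p a)).comp (LinearMap.mulRight ℂ (q b)))
    (by intros; ext; simp [add_mul]) (by intros; ext; simp)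
    (by intros; ext; simp [mul_add]) (by intros; ext; simp))

@[simp] lemma sandwich_tmul {A P Q : Type*} [Ring A] [Algebra ℂ A] [AddCommGroup P]
    [Module ℂ P] [AddCommGroup Q] [Module ℂ Q] (p : P →ₗ[ℂ] A) (q : Q →ₗ[ℂ] A) (a : P) (b : Q)
    (x : A) : sandwich p q (a ⊗ₜ[ℂ] b) x = p a * x * q b := by
  simp [sandwich, mul_assoc]

variable {G X Y : Type*} [Ring G] [HopfAlgebra ℂ G] [Ring X] [Algebra ℂ X] [Ring Y] [Algebra ℂ Y]

/-- The linear map `x ⊗ y ↦ x S(y)`. -/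
def mulAntipode : G ⊗[ℂ] G →ₗ[ℂ] G := (LinearMap.mul' ℂ G).comp ((antipode ℂ).lTensor G)

@[simp] lemma mulAntipode_tmul (a b : G) : mulAntipode (a ⊗ₜ[ℂ] b) = a * antipode ℂ b := by
  simp [mulAntipode]

lemma mulAntipode_comul (h : G) : mulAntipode (comul (R := ℂ) h) = counit (R := ℂ) h • (1 : G) :=
  (mul_antipode_lTensor_comul_apply h).trans (Algebra.algebraMap_eq_smul_one _)

/-- The linear map `x ⊗ y ↦ S(x) y`. -/
def antipodeMul : G ⊗[ℂ] G →ₗ[ℂ] G := (LinearMap.mul' ℂ G).comp ((antipode ℂ).rTensor G)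

@[simp] lemma antipodeMul_tmul (a b : G) : antipodeMul (a ⊗ₜ[ℂ] b) = antipode ℂ a * b := by
  simp [antipodeMul]

lemma antipodeMul_comul (h : G) : antipodeMul (comul (R := ℂ) h) = counit (R := ℂ) h • (1 : G) :=
  (mul_antipode_rTensor_comul_apply h).trans (Algebra.algebraMap_eq_smul_one _)

lemma antipodeMul_mul (x y : G ⊗[ℂ] G) :
    antipodeMul (x * y) = sandwich (antipode ℂ) LinearMap.id y (antipodeMul x) := by
  induction x with
  | tmul a b => induction y <;> simp_all [antipode_mul_antidistrib, mul_assoc, mul_add]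
  | _ => simp_all [add_mul]

lemma sandwich_antipode_one (x : G ⊗[ℂ] G) :
    sandwich (antipode ℂ) LinearMap.id x 1 = antipodeMul x := by
  induction x <;> simp_all

lemma comulFirst_flip (x : G ⊗[ℂ] G) :
    comulFirst (flip x) = mapSnd flip (swap12 (mapSnd (comulAlgHom ℂ G) x)) := by
  induction x with
  | tmul a b =>
    rw [flip_tmul, comulFirst_tmul, mapSnd_tmul, comulAlgHom_apply]
    induction comul (R := ℂ) b <;> simp_all [add_mul, TensorProduct.tmul_add]
  | _ => simp_all

/-- The algebra map `id ⊗ Δ'`. -/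
def mapComulFlip : G ⊗[ℂ] G →ₐ[ℂ] G ⊗[ℂ] (G ⊗[ℂ] G) :=
  mapSnd ((flip (G := G)).comp (comulAlgHom ℂ G))

@[simp] lemma mapComulFlip_tmul (a b : G) :
    mapComulFlip (a ⊗ₜ[ℂ] b) = a ⊗ₜ[ℂ] flip (comul (R := ℂ) b) := rfl

lemma mapComulFlip_flip (x : G ⊗[ℂ] G) :
    mapComulFlip (flip x) = swap12 (mapSnd flip (swap12 (comulFirst x))) := by
  induction x with
  | tmul a b =>
    rw [flip_tmul, comulFirst_tmul, mapComulFlip_tmul]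
    induction comul (R := ℂ) a <;> simp_all [add_mul, TensorProduct.tmul_add]
  | _ => simp_all

/-- The bilinear map `(a ⊗ b, y) ↦ (a ⊗ e ⊗ e) y (e ⊗ b ⊗ e)`. -/
def outerSandwich : G ⊗[ℂ] G →ₗ[ℂ] G ⊗[ℂ] (G ⊗[ℂ] X) →ₗ[ℂ] G ⊗[ℂ] (G ⊗[ℂ] X) :=
  sandwich (leg12.comp Algebra.TensorProduct.includeLeft).toLinearMap
    (leg12.comp (Algebra.TensorProduct.includeRight : G →ₐ[ℂ] G ⊗[ℂ] G)).toLinearMap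

@[simp] lemma outerSandwich_tmul (a b : G) (y : G ⊗[ℂ] (G ⊗[ℂ] X)) :
    outerSandwich (a ⊗ₜ[ℂ] b) y = leg12 (a ⊗ₜ[ℂ] (1 : G)) * y * leg12 ((1 : G) ⊗ₜ[ℂ] b) :=
  sandwich_tmul _ _ _ _ _

lemma leg12_tmul_one_mul_leg2 (a : G) (x : G ⊗[ℂ] X) :
    leg12 (a ⊗ₜ[ℂ] (1 : G)) * leg2 x = leg2 x * leg12 (a ⊗ₜ[ℂ] (1 : G)) := by
  simp [← Algebra.TensorProduct.one_def]

lemma leg1_mul_leg12_one_tmul (y : G ⊗[ℂ] X) (b : G) :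
    leg1 y * leg12 ((1 : G) ⊗ₜ[ℂ] b) = leg12 ((1 : G) ⊗ₜ[ℂ] b) * leg1 y := by
  induction y <;> simp_all [mul_add, add_mul]

lemma outerSandwich_leg2_mul_leg12_mul_leg1 (z r : G ⊗[ℂ] G) (x y : G ⊗[ℂ] X) :
    outerSandwich z (leg2 x * leg12 r * leg1 y) = leg2 x * leg12 (sandwich
      (Algebra.TensorProduct.includeLeft : G →ₐ[ℂ] G ⊗[ℂ] G).toLinearMap
      (Algebra.TensorProduct.includeRight : G →ₐ[ℂ] G ⊗[ℂ] G).toLinearMap z r) * leg1 y := by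
  induction z with
  | tmul a b =>
    rw [outerSandwich_tmul, sandwich_tmul, mul_assoc, mul_assoc (leg2 x * leg12 r),
      leg1_mul_leg12_one_tmul, mul_assoc (leg2 x), ← mul_assoc _ (leg2 x), leg12_tmul_one_mul_leg2]
    simp only [AlgHom.toLinearMap_apply, Algebra.TensorProduct.includeLeft_apply,
      Algebra.TensorProduct.includeRight_apply, map_mul, mul_assoc]
  | _ => simp_all [mul_add, add_mul]

lemma lTensor_outerSandwich (f : X →ₗ[ℂ] Y) (z : G ⊗[ℂ] G) (y : G ⊗[ℂ] (G ⊗[ℂ] X)) :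
    (f.lTensor G).lTensor G (outerSandwich z y) =
      outerSandwich z ((f.lTensor G).lTensor G y) := by
  induction z with
  | tmul a b => simp only [outerSandwich_tmul, lTensor_mul_leg12, lTensor_leg12_mul]
  | _ => simp_all

end HopfCalculus

section AdInvariant

variable {G : Type*} [Ring G] [HopfAlgebra ℂ G]

/-- Invariance of a linear form under the adjoint action: `∑ π(S(h₁) x h₂) = ε(h) π(x)`. -/
def IsAdInvariant (π : Module.Dual ℂ G) : Prop :=
  ∀ h x : G, π (sandwich (antipode ℂ) LinearMap.id (comul (R := ℂ) h) x) = counit (R := ℂ) h * π x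

/-- The linear map `a ⊗ b ⊗ c ↦ (e ⊗ S(a)) n (c ⊗ b)`. -/
def antipodeSandwich (n : G ⊗[ℂ] G) : G ⊗[ℂ] (G ⊗[ℂ] G) →ₗ[ℂ] G ⊗[ℂ] G :=
  (sandwich ((Algebra.TensorProduct.includeRight : G →ₐ[ℂ] G ⊗[ℂ] G).toLinearMap.comp
    (antipode ℂ)) (flip (G := G)).toLinearMap).flip n

@[simp] lemma antipodeSandwich_tmul (n : G ⊗[ℂ] G) (a : G) (x : G ⊗[ℂ] G) :
    antipodeSandwich n (a ⊗ₜ[ℂ] x) = ((1 : G) ⊗ₜ[ℂ] antipode ℂ a) * n * flip x := by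
  simp [antipodeSandwich]

lemma antipodeSandwich_one_comulFirst (x : G ⊗[ℂ] G) :
    antipodeSandwich 1 (comulFirst x) = component counit x ⊗ₜ[ℂ] (1 : G) := by
  induction x with
  | tmul a c =>
    have eval (z : G ⊗[ℂ] G) : antipodeSandwich 1 (leg12 z * (1 ⊗ₜ[ℂ] (1 ⊗ₜ[ℂ] c))) =
        c ⊗ₜ[ℂ] antipodeMul z := by
      induction z <;> simp_all [add_mul, TensorProduct.tmul_add]
    rw [comulFirst_tmul, eval, antipodeMul_comul, component_tmul, TensorProduct.smul_tmul]
  | _ => simp_all [TensorProduct.add_tmul]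

lemma IsAdInvariant.rightComponent_antipodeSandwich_comulFirst {π : Module.Dual ℂ G}
    (hπ : IsAdInvariant π) (n x : G ⊗[ℂ] G) :
    rightComponent π (antipodeSandwich n (comulFirst x)) =
      rightComponent π n * component counit x := by
  induction x with
  | tmul a c =>
    have eval (z : G ⊗[ℂ] G) (p q : G) :
        rightComponent π (antipodeSandwich (p ⊗ₜ q) (leg12 z * (1 ⊗ₜ[ℂ] (1 ⊗ₜ[ℂ] c)))) =
          π (sandwich (antipode ℂ) LinearMap.id z q) • (p * c) := by
      induction z <;> simp_all [add_mul, add_smul]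
    induction n with
    | tmul p q =>
      rw [comulFirst_tmul, eval, hπ, rightComponent_tmul, component_tmul, smul_mul_smul_comm,
        mul_comm (counit a)]
    | _ => simp_all [antipodeSandwich, add_mul]
  | _ => simp_all [mul_add]

lemma antipodeSandwich_mapSnd_comul {n : G ⊗[ℂ] G}
    (hn : ∀ h, n * flip (comul (R := ℂ) h) = flip (comul (R := ℂ) h) * n) (x : G ⊗[ℂ] G) :
    antipodeSandwich n (mapSnd (comulAlgHom ℂ G) x) =
      antipodeSandwich 1 (mapSnd (comulAlgHom ℂ G) x) * n := by
  induction x <;> simp_all [add_mul, mul_assoc]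

lemma IsAdInvariant.rightComponent_mul_comm {π : Module.Dual ℂ G} (hπ : IsAdInvariant π)
    {n : G ⊗[ℂ] G} (hn : ∀ h, n * flip (comul (R := ℂ) h) = flip (comul (R := ℂ) h) * n) (h : G) :
    rightComponent π n * h = h * rightComponent π n := by
  calc rightComponent π n * h
      = rightComponent π (antipodeSandwich n (mapSnd (comulAlgHom ℂ G) (comul (R := ℂ) h))) := by
        rw [mapSnd_comul_comul, hπ.rightComponent_antipodeSandwich_comulFirst,
          component_counit_comul]
    _ = rightComponent π ((h ⊗ₜ[ℂ] (1 : G)) * n) := by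
        rw [antipodeSandwich_mapSnd_comul hn, mapSnd_comul_comul, antipodeSandwich_one_comulFirst,
          component_counit_comul]
    _ = h * rightComponent π n := rightComponent_tmul_one_mul π h n

end AdInvariant

/-! ### Consequences of the quasi-triangular structure -/

section QuasiTriangular

variable {G : Type*} [Ring G] [HopfAlgebra ℂ G] [StarRing G] [StarModule ℂ G]

namespace RibbonStructure

variable (𝓡 : RibbonStructure G)

lemma rightComponent_counit_R : rightComponent counit (𝓡.R : G ⊗[ℂ] G) = 1 := by
  have absorb : (𝓡.R : G ⊗[ℂ] G) =
      𝓡.R * (rightComponent counit (𝓡.R : G ⊗[ℂ] G) ⊗ₜ[ℂ] (1 : G)) := by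
    have := congrArg (mapSnd (evalFirst (counitAlgHom ℂ G))) 𝓡.id_comul_R
    rwa [mapSnd_evalFirst_counit_mapSnd_comul, map_mul, mapSnd_evalFirst_leg1,
      mapSnd_evalFirst_leg12] at this
  simpa [Algebra.TensorProduct.one_def] using
    congrArg (rightComponent counit)
      (𝓡.R.isUnit.mul_left_cancel (absorb.symm.trans (mul_one _).symm))

lemma evalFirst_counit_R : evalFirst (counitAlgHom ℂ G) (𝓡.R : G ⊗[ℂ] G) = 1 := by
  have absorb : (𝓡.R : G ⊗[ℂ] G) =
      ((1 : G) ⊗ₜ[ℂ] evalFirst (counitAlgHom ℂ G) (𝓡.R : G ⊗[ℂ] G)) * 𝓡.R := by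
    have := congrArg (evalFirst (counitAlgHom ℂ G)) 𝓡.comul_id_R
    rwa [evalFirst_counit_comulFirst, map_mul, evalFirst_leg1, evalFirst_leg2] at this
  simpa using congrArg (evalFirst (counitAlgHom ℂ G))
    (𝓡.R.isUnit.mul_right_cancel (absorb.symm.trans (one_mul _).symm))

lemma sandwich_antipode_R :
    sandwich (Algebra.TensorProduct.includeLeft : G →ₐ[ℂ] G ⊗[ℂ] G).toLinearMap
      (Algebra.TensorProduct.includeRight : G →ₐ[ℂ] G ⊗[ℂ] G).toLinearMap
      ((antipode ℂ).lTensor G (𝓡.R : G ⊗[ℂ] G)) (𝓡.R : G ⊗[ℂ] G) = 1 := by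
  have eval_comul (x : G ⊗[ℂ] G) : mulAntipode.lTensor G (mapSnd (comulAlgHom ℂ G) x) =
      rightComponent counit x ⊗ₜ[ℂ] (1 : G) := by
    induction x <;> simp_all [mulAntipode_comul, TensorProduct.smul_tmul', TensorProduct.add_tmul]
  have eval_leg (x y : G ⊗[ℂ] G) : mulAntipode.lTensor G (leg1 x * leg12 y) =
      sandwich (Algebra.TensorProduct.includeLeft : G →ₐ[ℂ] G ⊗[ℂ] G).toLinearMap
      (Algebra.TensorProduct.includeRight : G →ₐ[ℂ] G ⊗[ℂ] G).toLinearMap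
      ((antipode ℂ).lTensor G x) y := by
    induction x with
    | tmul a b => induction y <;> simp_all [mul_add, add_mul]
    | _ => simp_all [add_mul]
  rw [← eval_leg, ← 𝓡.id_comul_R, eval_comul, rightComponent_counit_R,
    Algebra.TensorProduct.one_def]

/-- The Drinfeld element `u = ∑ S(r²) r¹`, which implements the square of the antipode. -/
def uElt : G := antipodeMul (flip (𝓡.R : G ⊗[ℂ] G))

lemma sandwich_antipode_uElt (h : G) :
    sandwich (antipode ℂ) LinearMap.id (flip (comul (R := ℂ) h)) 𝓡.uElt =
      counit (R := ℂ) h • 𝓡.uElt := by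
  have intertwine := congrArg (fun x => antipodeMul (flip x)) (𝓡.R_comul h)
  simpa only [map_mul, flip_flip, antipodeMul_mul, antipodeMul_comul, map_smul,
    sandwich_antipode_one, uElt] using intertwine

lemma antipode_antipode_mul_uElt (h : G) :
    antipode ℂ (antipode ℂ h) * 𝓡.uElt = 𝓡.uElt * h := by
  let f : G ⊗[ℂ] (G ⊗[ℂ] G) →ₗ[ℂ] G :=
    (LinearMap.applyₗ 𝓡.uElt).comp ((sandwich (antipode ℂ) LinearMap.id).comp
      ((flip (G := G)).toLinearMap.comp (mulAntipode.lTensor G)))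
  have f_tmul (a : G) (x : G ⊗[ℂ] G) :
      f (a ⊗ₜ x) = antipode ℂ (mulAntipode x) * 𝓡.uElt * a := by simp [f]
  have f_leg12_mul (z : G ⊗[ℂ] G) (c : G) : f (leg12 z * (1 ⊗ₜ[ℂ] (1 ⊗ₜ[ℂ] c))) =
      antipode ℂ (antipode ℂ c) * sandwich (antipode ℂ) LinearMap.id (flip z) 𝓡.uElt := by
    induction z <;> simp_all [antipode_mul_antidistrib, mul_assoc, add_mul, mul_add]
  have f_comulFirst (x : G ⊗[ℂ] G) :
      f (comulFirst x) = antipode ℂ (antipode ℂ (component counit x)) * 𝓡.uElt := by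
    induction x <;> simp_all [comulFirst_tmul, sandwich_antipode_uElt, add_mul]
  have f_mapSnd_comul (x : G ⊗[ℂ] G) :
      f (mapSnd (comulAlgHom ℂ G) x) = 𝓡.uElt * rightComponent counit x := by
    induction x <;> simp_all [mulAntipode_comul, antipode_one, mul_add]
  have coassoc := f_comulFirst (comul (R := ℂ) h)
  rw [← mapSnd_comul_comul, f_mapSnd_comul, component_counit_comul,
    rightComponent_counit_comul] at coassoc
  exact coassoc.symm

lemma sandwich_inv_uElt {u : Gˣ} (hu : (u : G) = 𝓡.uElt) (h : G) :
    sandwich LinearMap.id (antipode ℂ) (flip (comul (R := ℂ) h)) ((u⁻¹ : Gˣ) : G) =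
      counit (R := ℂ) h • ((u⁻¹ : Gˣ) : G) := by
  have conj (x : G ⊗[ℂ] G) :
      (u : G) * sandwich LinearMap.id (antipode ℂ) (flip x) ((u⁻¹ : Gˣ) : G) =
        antipode ℂ (mulAntipode x) := by
    induction x with
    | tmul a b =>
      have hb := 𝓡.antipode_antipode_mul_uElt b
      rw [← hu] at hb
      simp only [flip_tmul, sandwich_tmul, LinearMap.id_coe, id_eq, mulAntipode_tmul,
        antipode_mul_antidistrib, ← mul_assoc]
      rw [← hb, mul_assoc _ (u : G), Units.mul_inv, mul_one]
    | _ => simp_all [mul_add]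
  apply u.isUnit.mul_left_cancel
  rw [conj, mulAntipode_comul, map_smul, antipode_one, mul_smul_comm, Units.mul_inv]

lemma antipode_surjective (hu : IsUnit 𝓡.uElt) : Function.Surjective (antipode ℂ (A := G)) := by
  obtain ⟨u, hu⟩ := hu
  intro g
  refine ⟨antipode ℂ (((u⁻¹ : Gˣ) : G) * g * u), u.isUnit.mul_right_cancel ?_⟩
  rw [hu, antipode_antipode_mul_uElt, ← hu, ← mul_assoc, Units.mul_inv_cancel_left]

lemma N_eq : (𝓡.N : G ⊗[ℂ] G) = 𝓡.R * flip (𝓡.R : G ⊗[ℂ] G) := by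
  simp [N, Rplus, Rminus]

lemma flip_R_comul (ξ : G) : flip (𝓡.R : G ⊗[ℂ] G) * flip (comul (R := ℂ) ξ) =
    comul (R := ℂ) ξ * flip (𝓡.R : G ⊗[ℂ] G) := by
  simpa using congrArg flip (𝓡.R_comul ξ)

lemma N_comul (ξ : G) : (𝓡.N : G ⊗[ℂ] G) * flip (comul (R := ℂ) ξ) =
    flip (comul (R := ℂ) ξ) * 𝓡.N := by
  rw [N_eq, mul_assoc, flip_R_comul, ← mul_assoc, 𝓡.R_comul, mul_assoc]

lemma evalFirst_counit_N : evalFirst (counitAlgHom ℂ G) (𝓡.N : G ⊗[ℂ] G) = 1 := by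
  have evalFirst_flip (x : G ⊗[ℂ] G) :
      evalFirst (counitAlgHom ℂ G) (flip x) = rightComponent counit x := by
    induction x <;> simp_all
  rw [N_eq, map_mul, evalFirst_counit_R, evalFirst_flip, rightComponent_counit_R, one_mul]

lemma comulFirst_N : comulFirst (𝓡.N : G ⊗[ℂ] G) =
    leg1 (𝓡.R : G ⊗[ℂ] G) * leg2 (𝓡.N : G ⊗[ℂ] G) * leg1 (flip (𝓡.R : G ⊗[ℂ] G)) := by
  have comulFirst_flip_R : comulFirst (flip (𝓡.R : G ⊗[ℂ] G)) =
      leg2 (flip (𝓡.R : G ⊗[ℂ] G)) * leg1 (flip (𝓡.R : G ⊗[ℂ] G)) := by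
    rw [comulFirst_flip, 𝓡.id_comul_R, map_mul, map_mul, swap12_leg1, swap12_leg12,
      mapSnd_flip_leg12, leg2_apply, mapSnd_tmul, leg2_apply]
  rw [N_eq, map_mul, 𝓡.comul_id_R, comulFirst_flip_R, map_mul]
  simp only [mul_assoc]

lemma mapComulFlip_R : mapComulFlip (𝓡.R : G ⊗[ℂ] G) =
    leg12 (𝓡.R : G ⊗[ℂ] G) * leg1 (𝓡.R : G ⊗[ℂ] G) := by
  rw [mapComulFlip, ← mapSnd_mapSnd, 𝓡.id_comul_R, map_mul, mapSnd_flip_leg1, mapSnd_flip_leg12]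

lemma mapComulFlip_N : mapComulFlip (𝓡.N : G ⊗[ℂ] G) =
    leg12 (𝓡.R : G ⊗[ℂ] G) * leg1 (𝓡.N : G ⊗[ℂ] G) * leg12 (flip (𝓡.R : G ⊗[ℂ] G)) := by
  have mapComulFlip_flip_R : mapComulFlip (flip (𝓡.R : G ⊗[ℂ] G)) =
      leg1 (flip (𝓡.R : G ⊗[ℂ] G)) * leg12 (flip (𝓡.R : G ⊗[ℂ] G)) := by
    rw [mapComulFlip_flip, 𝓡.comul_id_R, map_mul, map_mul, map_mul, swap12_leg1, swap12_leg2,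
      mapSnd_flip_leg1, swap12_leg12, leg2_apply, mapSnd_tmul, ← leg2_apply, swap12_leg2]
  rw [N_eq, map_mul, mapComulFlip_R, mapComulFlip_flip_R, map_mul]
  simp only [mul_assoc]

lemma leg2_N_mul_mapComulFlip (x : G ⊗[ℂ] G) :
    leg2 (𝓡.N : G ⊗[ℂ] G) * mapComulFlip x = mapComulFlip x * leg2 (𝓡.N : G ⊗[ℂ] G) := by
  induction x <;> simp_all [N_comul, mul_add, add_mul]

lemma leg12_R_mul_comulFirst_N : leg12 (𝓡.R : G ⊗[ℂ] G) * comulFirst (𝓡.N : G ⊗[ℂ] G) =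
    leg2 (𝓡.N : G ⊗[ℂ] G) * leg12 (𝓡.R : G ⊗[ℂ] G) * leg1 (𝓡.N : G ⊗[ℂ] G) := by
  rw [comulFirst_N, N_eq 𝓡, map_mul leg1, ← N_eq 𝓡, ← mul_assoc, ← mul_assoc, ← mul_assoc,
    ← mapComulFlip_R, mul_assoc (leg2 _), ← mapComulFlip_R, leg2_N_mul_mapComulFlip]

end RibbonStructure

end QuasiTriangular

section Integrals

lemma exists_mul_eq_smul {A : Type*} [Ring A] [Algebra ℂ A] [IsSemisimpleRing A]
    (χ : A →ₐ[ℂ] ℂ) : ∃ e : A, χ e = 1 ∧ ∀ a, a * e = χ a • e := by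
  obtain ⟨L, hL⟩ := exists_isCompl (RingHom.ker χ : Submodule A A)
  obtain ⟨k, hk, e, he, hsum⟩ := Submodule.mem_sup.1
    (show (1 : A) ∈ (RingHom.ker χ : Submodule A A) ⊔ L by rw [hL.sup_eq_top]; trivial)
  refine ⟨e, ?_, fun a => ?_⟩
  · simpa [show χ k = 0 from hk] using congrArg χ hsum
  · have : (a - algebraMap ℂ A (χ a)) * e = 0 := by
      refine Submodule.disjoint_def.1 hL.disjoint _ ?_ (L.smul_mem _ he)
      change χ _ = 0
      simp
    rwa [sub_mul, sub_eq_zero, ← Algebra.smul_def] at this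

variable {G : Type*} [Ring G] [HopfAlgebra ℂ G]

/-- Two-sided integrals, normalized by the counit. -/
structure IsIntegral (Λ : G) : Prop where
  left : ∀ h : G, h * Λ = counit (R := ℂ) h • Λ
  right : ∀ h : G, Λ * h = counit (R := ℂ) h • Λ
  counit_eq : counit (R := ℂ) Λ = 1

variable (G) in
lemma exists_isIntegral [IsSemisimpleRing G] : ∃ Λ : G, IsIntegral Λ := by
  obtain ⟨l, counit_l, left⟩ := exists_mul_eq_smul (counitAlgHom ℂ G)
  obtain ⟨r, counit_r, right⟩ := exists_mul_eq_smul
    ((counitAlgHom ℂ G).fromOpposite fun _ _ => mul_comm _ _)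
  have right' (h : G) : r.unop * h = counit (R := ℂ) h • r.unop :=
    congrArg MulOpposite.unop (right (MulOpposite.op h))
  have eq : r.unop = l := by
    have h : r.unop * l = _ := left r.unop
    rwa [right' l, show counit (R := ℂ) l = 1 from counit_l,
      show counitAlgHom ℂ G r.unop = 1 from counit_r, one_smul, one_smul] at h
  exact ⟨l, left, fun h => eq ▸ right' h, counit_l⟩

namespace IsIntegral

variable {Λ : G}

lemma one_tmul_mul_comul (hΛ : IsIntegral Λ) (h : G) :
    ((1 : G) ⊗ₜ[ℂ] h) * comul (R := ℂ) Λ =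
      (antipode ℂ h ⊗ₜ[ℂ] (1 : G)) * comul (R := ℂ) Λ := by
  let f : G ⊗[ℂ] (G ⊗[ℂ] G) →ₗ[ℂ] G ⊗[ℂ] G :=
    (LinearMap.mulRight ℂ (comul (R := ℂ) Λ)).comp ((LinearMap.applyₗ (1 : G ⊗[ℂ] G)).comp
      (sandwich ((Algebra.TensorProduct.includeLeft : G →ₐ[ℂ] G ⊗[ℂ] G).toLinearMap.comp
        (antipode ℂ)) LinearMap.id))
  have f_leg12_mul (z : G ⊗[ℂ] G) (c : G) : f (leg12 z * (1 ⊗ₜ[ℂ] (1 ⊗ₜ[ℂ] c))) =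
      (antipodeMul z ⊗ₜ[ℂ] c) * comul (R := ℂ) Λ := by
    induction z <;> simp_all [f, add_mul, TensorProduct.add_tmul]
  have f_comulFirst (x : G ⊗[ℂ] G) :
      f (comulFirst x) = ((1 : G) ⊗ₜ[ℂ] component counit x) * comul (R := ℂ) Λ := by
    induction x <;> simp_all [comulFirst_tmul, antipodeMul_comul, TensorProduct.smul_tmul',
      TensorProduct.tmul_add, add_mul]
  have f_mapSnd_comul (x : G ⊗[ℂ] G) : f (mapSnd (comulAlgHom ℂ G) x) =
      (antipode ℂ (rightComponent counit x) ⊗ₜ[ℂ] (1 : G)) * comul (R := ℂ) Λ := by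
    induction x <;> simp_all [f, mul_assoc, ← Bialgebra.comul_mul, hΛ.left,
      TensorProduct.add_tmul, add_mul, TensorProduct.smul_tmul', ← smul_mul_assoc]
  rw [← component_counit_comul h, ← f_comulFirst, ← mapSnd_comul_comul, f_mapSnd_comul,
    rightComponent_counit_comul, component_counit_comul]

lemma comul_mul_tmul_one (hΛ : IsIntegral Λ) (h : G) :
    comul (R := ℂ) Λ * (h ⊗ₜ[ℂ] (1 : G)) =
      comul (R := ℂ) Λ * ((1 : G) ⊗ₜ[ℂ] antipode ℂ h) := by
  let f : G ⊗[ℂ] (G ⊗[ℂ] G) →ₗ[ℂ] G ⊗[ℂ] G :=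
    (LinearMap.mulLeft ℂ (comul (R := ℂ) Λ)).comp (mulAntipode.lTensor G)
  have f_leg12_mul (z : G ⊗[ℂ] G) (c : G) : f (leg12 z * (1 ⊗ₜ[ℂ] (1 ⊗ₜ[ℂ] c))) =
      comul (R := ℂ) Λ * z * ((1 : G) ⊗ₜ[ℂ] antipode ℂ c) := by
    induction z <;> simp_all [f, mul_assoc, add_mul, mul_add]
  have f_comulFirst (x : G ⊗[ℂ] G) : f (comulFirst x) =
      comul (R := ℂ) Λ * ((1 : G) ⊗ₜ[ℂ] antipode ℂ (component counit x)) := by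
    induction x <;> simp_all [comulFirst_tmul, ← Bialgebra.comul_mul, hΛ.right,
      TensorProduct.tmul_add, mul_add]
  have f_mapSnd_comul (x : G ⊗[ℂ] G) : f (mapSnd (comulAlgHom ℂ G) x) =
      comul (R := ℂ) Λ * (rightComponent counit x ⊗ₜ[ℂ] (1 : G)) := by
    induction x <;> simp_all [f, mulAntipode_comul, TensorProduct.smul_tmul',
      TensorProduct.add_tmul, mul_add]
  rw [← rightComponent_counit_comul h, ← f_mapSnd_comul, mapSnd_comul_comul, f_comulFirst,
    component_counit_comul, rightComponent_counit_comul]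

lemma mulAntipode_comul_eq_one (hΛ : IsIntegral Λ) : mulAntipode (comul (R := ℂ) Λ) = 1 := by
  rw [mulAntipode_comul, hΛ.counit_eq, one_smul]

lemma antipodeMul_comul_eq_one (hΛ : IsIntegral Λ) : antipodeMul (comul (R := ℂ) Λ) = 1 := by
  rw [antipodeMul_comul, hΛ.counit_eq, one_smul]

lemma eq_top_of_component_mem [FiniteDimensional ℂ G] (hΛ : IsIntegral Λ) (K : Submodule ℂ G)
    (hK : ∀ φ : Module.Dual ℂ G, component φ (comul (R := ℂ) Λ) ∈ K) : K = ⊤ := by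
  have mul_mem (g : G) (φ : Module.Dual ℂ G) : g * component φ (comul (R := ℂ) Λ) ∈ K := by
    rw [← component_one_tmul_mul, hΛ.one_tmul_mul_comul, component_tmul_one_mul]
    exact hK _
  refine eq_top_iff.2 fun g _ => ?_
  rw [← mul_one g, ← hΛ.antipodeMul_comul_eq_one,
    eq_sum_tmul_component (Module.finBasis ℂ G) (comul (R := ℂ) Λ), map_sum, Finset.mul_sum]
  refine K.sum_mem fun i _ => ?_
  rw [antipodeMul_tmul, ← mul_assoc]
  exact mul_mem _ _

lemma rightComponents_surjective [FiniteDimensional ℂ G] (hΛ : IsIntegral Λ)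
    {n x y : G ⊗[ℂ] G} (hn : comulFirst n = leg1 x * leg2 n * leg1 y)
    (hmem : Λ ∈ LinearMap.range (rightComponents n)) :
    Function.Surjective (rightComponents n) := by
  obtain ⟨π, rfl⟩ := hmem
  have eval_tmul (φ : Module.Dual ℂ G) (a b c d : G) (m : G ⊗[ℂ] G) :
      component φ ((rightComponent π).lTensor G (leg1 (a ⊗ₜ b) * leg2 m * leg1 (c ⊗ₜ d))) =
        rightComponents m (φ (a * c) • π.comp ((LinearMap.mulLeft ℂ b).comp
          (LinearMap.mulRight ℂ d))) := by
    induction m <;> simp_all [mul_assoc, smul_smul, mul_comm, mul_add, add_mul,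
      TensorProduct.tmul_add]
  have eval_mem (φ : Module.Dual ℂ G) (x y : G ⊗[ℂ] G) :
      component φ ((rightComponent π).lTensor G (leg1 x * leg2 n * leg1 y)) ∈
        LinearMap.range (rightComponents n) := by
    induction x with
    | zero => simp
    | tmul a b =>
      induction y with
      | zero => simp
      | tmul c d => rw [eval_tmul]; exact ⟨_, rfl⟩
      | add c d hc hd => simpa only [map_add, mul_add] using Submodule.add_mem _ hc hd
    | add a b ha hb => simpa only [map_add, add_mul] using Submodule.add_mem _ ha hb
  refine LinearMap.range_eq_top.1 (hΛ.eq_top_of_component_mem _ fun φ => ?_)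
  rw [rightComponents_apply, comul_rightComponent, hn]
  exact eval_mem φ x y

end IsIntegral

end Integrals

/-! ### Modularity -/

section Modular

variable {G : Type u₁} [Ring G] [HopfAlgebra ℂ G]

variable (G) in
lemma nontrivial_of_hopfAlgebra : Nontrivial G :=
  ⟨1, 0, fun h => by simpa using congrArg (counit (R := ℂ)) h⟩

variable [StarRing G] {I : Type u₂} {V : I → Type u₃} [∀ i, NormedAddCommGroup (V i)]
  [∀ i, InnerProductSpace ℂ (V i)] [∀ i, CompleteSpace (V i)]
  {τ : ∀ i, G →⋆ₐ[ℂ] (V i →L[ℂ] V i)}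

namespace IsIrrepSystem

lemma nonempty (hτ : IsIrrepSystem τ) : Nonempty I := by
  have := nontrivial_of_hopfAlgebra G
  obtain ⟨m, hm⟩ := Ideal.exists_maximal G
  have : IsSimpleModule G (G ⧸ m) := isSimpleModule_iff_isCoatom.2 hm.1
  obtain ⟨i, -⟩ := hτ.complete (G ⧸ m)
  exact ⟨i⟩

lemma faithful [IsSemisimpleRing G] (hτ : IsIrrepSystem τ) {x : G} (hx : ∀ i, τ i x = 0) :
    x = 0 := by
  have one_mem : (1 : G) ∈ ⨆ m : {m : Submodule G G | IsSimpleModule G m}, (m : Submodule G G) := by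
    rw [← sSup_eq_iSup', IsSemisimpleModule.sSup_simples_eq_top G G]
    trivial
  rw [← mul_one x]
  refine Submodule.iSup_induction _ (motive := fun y => x * y = 0) one_mem ?_ (mul_zero x) ?_
  · rintro ⟨m, hm⟩ y hy
    have : IsSimpleModule G m := hm
    obtain ⟨i, e, he⟩ := hτ.complete m
    have smul_eq_zero : x • (⟨y, hy⟩ : m) = 0 := e.injective (by rw [he, hx, map_zero]; rfl)
    exact congrArg Subtype.val smul_eq_zero
  · intro a b ha hb
    rw [mul_add, ha, hb, add_zero]

lemma exists_smul_of_central [∀ i, FiniteDimensional ℂ (V i)] (hτ : IsIrrepSystem τ) {z : G}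
    (hz : ∀ h, z * h = h * z) (i : I) : ∃ c : ℂ, τ i z = c • 1 := by
  have := hτ.nontrivial i
  obtain ⟨c, hc⟩ := Module.End.exists_eigenvalue ((τ i z : V i →L[ℂ] V i) : V i →ₗ[ℂ] V i)
  refine ⟨c, ?_⟩
  have mem_iff (x) : x ∈ Module.End.eigenspace ((τ i z : V i →L[ℂ] V i) : V i →ₗ[ℂ] V i) c ↔
      τ i z x = c • x := Module.End.mem_eigenspace_iff
  have invariant (ξ : G) (x : V i)
      (hx : x ∈ Module.End.eigenspace ((τ i z : V i →L[ℂ] V i) : V i →ₗ[ℂ] V i) c) :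
      τ i ξ x ∈ Module.End.eigenspace ((τ i z : V i →L[ℂ] V i) : V i →ₗ[ℂ] V i) c := by
    rw [mem_iff] at hx ⊢
    rw [← mul_apply_eq_comp, ← map_mul, hz, map_mul, mul_apply_eq_comp, hx, map_smul]
  have eq_top := (hτ.irreducible i _ invariant).resolve_left hc
  ext x
  simpa using (mem_iff x).1 (eq_top ▸ Submodule.mem_top)

end IsIrrepSystem

/-- The character of `τ i`. -/
def character (τ : ∀ i, G →⋆ₐ[ℂ] (V i →L[ℂ] V i)) (i : I) : Module.Dual ℂ G :=
  (LinearMap.trace ℂ (V i)).comp ((ContinuousLinearMap.coeLM ℂ).comp (τ i).toAlgHom.toLinearMap)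

lemma character_mul_comm (i : I) (x y : G) : character τ i (x * y) = character τ i (y * x) := by
  simp only [character, LinearMap.comp_apply, AlgHom.toLinearMap_apply, map_mul]
  exact LinearMap.trace_mul_comm ℂ _ _

variable [StarModule ℂ G]

/-- The quantum character of `τ i`. -/
def qCharacter (𝓡 : RibbonStructure G) (τ : ∀ i, G →⋆ₐ[ℂ] (V i →L[ℂ] V i)) (i : I) :
    Module.Dual ℂ G :=
  (character τ i).comp (LinearMap.mulRight ℂ 𝓡.wElt)

lemma qCharacter_apply (𝓡 : RibbonStructure G) (i : I) (x : G) :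
    qCharacter 𝓡 τ i x = character τ i (x * 𝓡.wElt) := rfl

lemma qTrace_apply (𝓡 : RibbonStructure G) (i : I) (x : G) :
    qTrace 𝓡 τ i (τ i x) = qCharacter 𝓡 τ i x := by
  simp only [qTrace, qCharacter, character, LinearMap.comp_apply, LinearMap.mulRight_apply,
    AlgHom.toLinearMap_apply, map_mul]
  rfl

lemma qCharacter_of_smul_one (𝓡 : RibbonStructure G) {j : I} {z : G} {c : ℂ}
    (hz : τ j z = c • 1) : qCharacter 𝓡 τ j z = c * character τ j 𝓡.wElt := by
  have : τ j (z * 𝓡.wElt) = c • τ j 𝓡.wElt := by rw [map_mul, hz, smul_mul_assoc, one_mul]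
  change LinearMap.trace ℂ (V j) ((τ j (z * 𝓡.wElt) : V j →L[ℂ] V j) : V j →ₗ[ℂ] V j) = _
  simp [this, character]

lemma sMatrix_apply (𝓡 : RibbonStructure G) (i j : I) : sMatrix 𝓡 τ i j =
    qCharacter 𝓡 τ j (rightComponents (𝓡.N : G ⊗[ℂ] G) (qCharacter 𝓡 τ i)) := by
  have eval (x : G ⊗[ℂ] G) : LinearMap.mul' ℂ ℂ
      (TensorProduct.map (qTrace 𝓡 τ i) (qTrace 𝓡 τ j)
        (Algebra.TensorProduct.map (τ i).toAlgHom (τ j).toAlgHom (flip x))) =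
      qCharacter 𝓡 τ j (rightComponent (qCharacter 𝓡 τ i) x) := by
    induction x with
    | tmul a b =>
      simp only [flip_tmul, Algebra.TensorProduct.map_tmul, TensorProduct.map_tmul,
        LinearMap.mul'_apply, rightComponent_tmul, map_smul, smul_eq_mul, ← qTrace_apply]
      rfl
    | _ => simp_all
  rw [rightComponents_apply, ← eval, RibbonStructure.N_eq, map_mul flip, flip_flip]
  rfl

lemma isUnit_uElt [Fintype I] [DecidableEq I] (𝓡 : RibbonStructure G) (hτ : IsIrrepSystem τ)
    (hmodular : IsUnit (sMatrix 𝓡 τ)) : IsUnit 𝓡.uElt := by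
  by_contra hu
  have := hτ.nonempty
  have wElt_eq_zero : 𝓡.wElt = 0 :=
    Ring.inverse_non_unit _ fun h => hu ((Units.isUnit_units_mul 𝓡.v⁻¹ 𝓡.uElt).1 h)
  have sMatrix_eq_zero : sMatrix 𝓡 τ = 0 := by
    ext i j
    simp [sMatrix_apply, qCharacter_apply, wElt_eq_zero]
  exact not_isUnit_zero (sMatrix_eq_zero ▸ hmodular)

lemma isAdInvariant_qCharacter (𝓡 : RibbonStructure G) (hu : IsUnit 𝓡.uElt) (i : I) :
    IsAdInvariant (qCharacter 𝓡 τ i) := by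
  obtain ⟨u, hu⟩ := hu
  have wElt_eq : 𝓡.wElt = ((u⁻¹ : Gˣ) : G) * 𝓡.v := by
    have : 𝓡.wElt = Ring.inverse ((𝓡.v⁻¹ * u : Gˣ) : G) := by rw [Units.val_mul, hu]; rfl
    rw [this, Ring.inverse_unit, mul_inv_rev, inv_inv, Units.val_mul]
  intro h x
  have cyclic (y : G ⊗[ℂ] G) : qCharacter 𝓡 τ i (sandwich (antipode ℂ) LinearMap.id y x) =
      character τ i (x * (sandwich LinearMap.id (antipode ℂ) (flip y) ((u⁻¹ : Gˣ) : G) * 𝓡.v)) := by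
    induction y with
    | tmul a b =>
      simp only [sandwich_tmul, flip_tmul, LinearMap.id_coe, id_eq, qCharacter_apply, wElt_eq]
      rw [mul_assoc, mul_assoc, character_mul_comm]
      simp only [mul_assoc, Subalgebra.mem_center_iff.1 𝓡.v_central (antipode ℂ a)]
    | _ => simp_all [add_mul, mul_add]
  rw [cyclic, 𝓡.sandwich_inv_uElt hu, qCharacter_apply, wElt_eq, smul_mul_assoc, mul_smul_comm,
    map_smul, smul_eq_mul]

lemma rightComponents_N_qCharacter_mul_comm (𝓡 : RibbonStructure G) (hu : IsUnit 𝓡.uElt) (i : I)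
    (h : G) : rightComponents (𝓡.N : G ⊗[ℂ] G) (qCharacter 𝓡 τ i) * h =
      h * rightComponents (𝓡.N : G ⊗[ℂ] G) (qCharacter 𝓡 τ i) :=
  (isAdInvariant_qCharacter 𝓡 hu i).rightComponent_mul_comm 𝓡.N_comul h

variable [∀ i, FiniteDimensional ℂ (V i)]

lemma character_wElt_ne_zero [Fintype I] [DecidableEq I] (𝓡 : RibbonStructure G)
    (hτ : IsIrrepSystem τ) (hmodular : IsUnit (sMatrix 𝓡 τ)) (j : I) :
    character τ j 𝓡.wElt ≠ 0 := by
  intro hj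
  have col_eq_zero : (sMatrix 𝓡 τ).mulVec (Pi.single j 1) = (sMatrix 𝓡 τ).mulVec 0 := by
    ext i
    obtain ⟨c, hc⟩ := hτ.exists_smul_of_central
      (rightComponents_N_qCharacter_mul_comm (τ := τ) 𝓡 (isUnit_uElt 𝓡 hτ hmodular) i) j
    rw [Matrix.mulVec_single_one, Matrix.col_apply, sMatrix_apply, qCharacter_of_smul_one 𝓡 hc, hj,
      mul_zero, Matrix.mulVec_zero, Pi.zero_apply]
  simpa using congrFun (Matrix.mulVec_injective_of_isUnit hmodular col_eq_zero) j

lemma eq_zero_of_qCharacter_eq_zero [Fintype I] [DecidableEq I] [IsSemisimpleRing G]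
    (𝓡 : RibbonStructure G) (hτ : IsIrrepSystem τ) (hmodular : IsUnit (sMatrix 𝓡 τ)) {z : G}
    (hz : ∀ h, z * h = h * z) (hq : ∀ j, qCharacter 𝓡 τ j z = 0) : z = 0 := by
  refine hτ.faithful fun j => ?_
  obtain ⟨d, hd⟩ := hτ.exists_smul_of_central hz j
  have vanish := hq j
  rw [qCharacter_of_smul_one 𝓡 hd] at vanish
  rw [hd, (mul_eq_zero.1 vanish).resolve_right (character_wElt_ne_zero 𝓡 hτ hmodular j), zero_smul]

lemma IsIntegral.mem_range_rightComponents_N [Fintype I] [DecidableEq I] [IsSemisimpleRing G]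
    (𝓡 : RibbonStructure G) (hτ : IsIrrepSystem τ) (hmodular : IsUnit (sMatrix 𝓡 τ))
    {Λ : G} (hΛ : IsIntegral Λ) : Λ ∈ LinearMap.range (rightComponents (𝓡.N : G ⊗[ℂ] G)) := by
  obtain ⟨c, hc⟩ : ∃ c : I → ℂ, Matrix.vecMul c (sMatrix 𝓡 τ) = fun j => qCharacter 𝓡 τ j Λ :=
    ⟨Matrix.vecMul (fun j => qCharacter 𝓡 τ j Λ) (sMatrix 𝓡 τ)⁻¹, by
      rw [Matrix.vecMul_vecMul,
        Matrix.nonsing_inv_mul _ ((Matrix.isUnit_iff_isUnit_det _).1 hmodular),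
        Matrix.vecMul_one]⟩
  refine ⟨∑ i, c i • qCharacter 𝓡 τ i, sub_eq_zero.1 ?_⟩
  rw [map_sum]
  simp only [map_smul]
  refine eq_zero_of_qCharacter_eq_zero 𝓡 hτ hmodular (fun h => ?_) fun j => ?_
  · rw [sub_mul, mul_sub, hΛ.left, hΛ.right, Finset.sum_mul, Finset.mul_sum]
    simp only [smul_mul_assoc, mul_smul_comm,
      rightComponents_N_qCharacter_mul_comm 𝓡 (isUnit_uElt 𝓡 hτ hmodular)]
  · have := congrFun hc j
    simp only [Matrix.vecMul, dotProduct, sMatrix_apply] at this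
    simp only [map_sub, map_sum, map_smul, smul_eq_mul, this, sub_self]

lemma rightComponents_N_surjective [FiniteDimensional ℂ G] [IsSemisimpleRing G] [Fintype I]
    [DecidableEq I] (𝓡 : RibbonStructure G) (hτ : IsIrrepSystem τ)
    (hmodular : IsUnit (sMatrix 𝓡 τ)) :
    Function.Surjective (rightComponents (𝓡.N : G ⊗[ℂ] G)) := by
  obtain ⟨Λ, hΛ⟩ := exists_isIntegral G
  exact hΛ.rightComponents_surjective 𝓡.comulFirst_N
    (hΛ.mem_range_rightComponents_N 𝓡 hτ hmodular)

end Modular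

/-! ### The monodromy of a solution -/

lemma commute_tmul {A X : Type*} [Ring A] [Algebra ℂ A] [Ring X] [Algebra ℂ X] {a : A} {x : X}
    (ha : ∀ b, Commute a b) (hx : ∀ y, Commute x y) (z : A ⊗[ℂ] X) : Commute (a ⊗ₜ[ℂ] x) z := by
  induction z with
  | zero => exact .zero_right _
  | tmul b y => rw [commute_iff_eq, Algebra.TensorProduct.tmul_mul_tmul, (ha b).eq, (hx y).eq,
      Algebra.TensorProduct.tmul_mul_tmul]
  | add y z hy hz => exact hy.add_right hz

section Monodromy

open scoped commutatorElement

variable {G : Type*} [Ring G] [HopfAlgebra ℂ G] [StarRing G] [StarModule ℂ G]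
  {𝓡 : RibbonStructure G} {F : (G ⊗[ℂ] (G ⊗[ℂ] Center G))ˣ}
  {σ : Center G →ₐ[ℂ] G ⊗[ℂ] Center G}
  {B : Type*} [Ring B] [Algebra ℂ B] {j : Center G →ₐ[ℂ] B} {Φ : (G ⊗[ℂ] B)ˣ}

lemma center_commute (f g : Center G) : Commute f g :=
  Subtype.ext ((Subalgebra.mem_center_iff.1 f.2 (g : G)).symm)

lemma RibbonStructure.v_commute (𝓡 : RibbonStructure G) (g : G) : Commute (𝓡.v : G) g :=
  (Subalgebra.mem_center_iff.1 𝓡.v_central g).symm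

lemma structD_val (𝓡 : RibbonStructure G) (σ : Center G →ₐ[ℂ] G ⊗[ℂ] Center G) :
    (structD 𝓡 σ : G ⊗[ℂ] Center G) =
      ((𝓡.v : G) ⊗ₜ[ℂ] ((𝓡.vC⁻¹ : (Center G)ˣ) : Center G)) * σ (𝓡.vC : Center G) := by
  rw [structD, ← map_inv]
  simp

lemma twistedR_val (F : (G ⊗[ℂ] (G ⊗[ℂ] Center G))ˣ) (r : (G ⊗[ℂ] G)ˣ) :
    (twistedR F r : G ⊗[ℂ] (G ⊗[ℂ] Center G)) =
      swap12 (F : G ⊗[ℂ] (G ⊗[ℂ] Center G)) * leg12 (r : G ⊗[ℂ] G) *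
        ((F⁻¹ : (G ⊗[ℂ] (G ⊗[ℂ] Center G))ˣ) : G ⊗[ℂ] (G ⊗[ℂ] Center G)) := rfl

lemma structD_commute (f : Center G) : Commute (structD 𝓡 σ : G ⊗[ℂ] Center G) (σ f) := by
  rw [structD_val]
  exact (commute_tmul 𝓡.v_commute (center_commute _) _).mul_left ((center_commute _ f).map σ)

namespace RibbonStructure

variable (𝓡)

lemma Rminus_mul_flip_R : (𝓡.Rminus : G ⊗[ℂ] G) * flip (𝓡.R : G ⊗[ℂ] G) = 1 :=
  Units.inv_mul (Units.map (flip (G := G) : G ⊗[ℂ] G →* G ⊗[ℂ] G) 𝓡.R)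

lemma Rminus_comul (ξ : G) : (𝓡.Rminus : G ⊗[ℂ] G) * comul (R := ℂ) ξ =
    flip (comul (R := ℂ) ξ) * 𝓡.Rminus := by
  apply (𝓡.R.isUnit.map flip).mul_right_cancel
  rw [mul_assoc, ← flip_R_comul, ← mul_assoc, Rminus_mul_flip_R, one_mul, mul_assoc,
    Rminus_mul_flip_R, mul_one]

lemma flip_R_mul_R_mul_comul_v : flip (𝓡.R : G ⊗[ℂ] G) * 𝓡.R * comul (R := ℂ) (𝓡.v : G) =
    (𝓡.v : G) ⊗ₜ[ℂ] (𝓡.v : G) := by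
  rw [𝓡.ribbon, mul_assoc, ← Bialgebra.comul_mul, Units.inv_mul, Bialgebra.comul_one, mul_one]

end RibbonStructure

/-- The monodromy `Φ⁻¹ D Φ`. On a solution of the relations it satisfies the functorial relations
of `N = R R'`, which is how `G` comes to act. -/
def monodromy (𝓡 : RibbonStructure G) (σ : Center G →ₐ[ℂ] G ⊗[ℂ] Center G)
    (j : Center G →ₐ[ℂ] B) (Φ : (G ⊗[ℂ] B)ˣ) : G ⊗[ℂ] B :=
  ((Φ⁻¹ : (G ⊗[ℂ] B)ˣ) : G ⊗[ℂ] B) * mapSnd j (structD 𝓡 σ : G ⊗[ℂ] Center G) * Φ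

lemma mul_monodromy : (Φ : G ⊗[ℂ] B) * monodromy 𝓡 σ j Φ =
    mapSnd j (structD 𝓡 σ : G ⊗[ℂ] Center G) * Φ := by
  simp [monodromy, ← mul_assoc]

/-- `1 ⊗ j(v)`. -/
def ribbonUnit (𝓡 : RibbonStructure G) (j : Center G →ₐ[ℂ] B) : (G ⊗[ℂ] B)ˣ :=
  Units.map ((Algebra.TensorProduct.includeRight : B →ₐ[ℂ] G ⊗[ℂ] B).comp j).toMonoidHom 𝓡.vC

namespace SolvesRelations

lemma monodromy_eq (h : SolvesRelations F σ j Φ) : monodromy 𝓡 σ j Φ =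
    ((𝓡.v : G) ⊗ₜ[ℂ] (1 : B)) * (⁅Φ⁻¹, (ribbonUnit 𝓡 j)⁻¹⁆ : (G ⊗[ℂ] B)ˣ) := by
  have hv : Commute ((𝓡.v : G) ⊗ₜ[ℂ] (1 : B)) ((Φ⁻¹ : (G ⊗[ℂ] B)ˣ) : G ⊗[ℂ] B) :=
    commute_tmul 𝓡.v_commute (fun _ => .one_left _) _
  have hval : (ribbonUnit 𝓡 j : G ⊗[ℂ] B) = (1 : G) ⊗ₜ[ℂ] j (𝓡.vC : Center G) := rfl
  have hinv : ((ribbonUnit 𝓡 j)⁻¹ : (G ⊗[ℂ] B)ˣ) =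
      (1 : G) ⊗ₜ[ℂ] j ((𝓡.vC⁻¹ : (Center G)ˣ) : Center G) := rfl
  have hvv : (𝓡.v : G) ⊗ₜ[ℂ] j ((𝓡.vC⁻¹ : (Center G)ˣ) : Center G) =
      ((𝓡.v : G) ⊗ₜ[ℂ] (1 : B)) * ((1 : G) ⊗ₜ[ℂ] j ((𝓡.vC⁻¹ : (Center G)ˣ) : Center G)) := by simp
  rw [monodromy, structD_val, map_mul, mapSnd_tmul, mul_assoc, mul_assoc, ← h.exchange, hvv,
    commutatorElement_def, inv_inv, inv_inv, Units.val_mul, Units.val_mul, Units.val_mul, hval,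
    hinv, mul_assoc, mul_assoc, mul_assoc, ← hv.left_comm]

lemma map_monodromy (h : SolvesRelations F σ j Φ) {X : Type*} [Ring X] [Algebra ℂ X]
    (θ : G ⊗[ℂ] B →ₐ[ℂ] X) : θ (monodromy 𝓡 σ j Φ) = θ ((𝓡.v : G) ⊗ₜ[ℂ] (1 : B)) *
      (⁅(Units.map θ.toMonoidHom Φ)⁻¹, (Units.map θ.toMonoidHom (ribbonUnit 𝓡 j))⁻¹⁆ : Xˣ) := by
  rw [h.monodromy_eq, map_mul, ← map_inv, ← map_inv, ← map_commutatorElement]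
  rfl

lemma exchange_leg2 (h : SolvesRelations F σ j Φ) (y : G ⊗[ℂ] Center G) :
    mapSnd (mapSnd j) (mapSnd σ y) * leg2 (Φ : G ⊗[ℂ] B) =
      leg2 (Φ : G ⊗[ℂ] B) * leg1 (mapSnd j y) := by
  induction y <;> simp_all [h.exchange, add_mul, mul_add]

lemma leg1_mul_leg2 (h : SolvesRelations F σ j Φ) {r : (G ⊗[ℂ] G)ˣ}
    (hr : ∀ ξ, (r : G ⊗[ℂ] G) * comul (R := ℂ) ξ = flip (comul (R := ℂ) ξ) * (r : G ⊗[ℂ] G)) :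
    leg1 (Φ : G ⊗[ℂ] B) * leg2 (Φ : G ⊗[ℂ] B) * leg12 (r : G ⊗[ℂ] G) =
      mapSnd (mapSnd j) (twistedR F r : G ⊗[ℂ] (G ⊗[ℂ] Center G)) *
        (leg2 (Φ : G ⊗[ℂ] B) * leg1 (Φ : G ⊗[ℂ] B)) := by
  have swapped := congrArg swap12 h.operatorProduct
  rw [map_mul, map_mul, swap12_leg1, swap12_leg2] at swapped
  rw [swapped, mul_assoc, swap12_comulFirst_mul_leg12 hr, h.operatorProduct, twistedR_val, map_mul,
    map_mul, mapSnd_swap12, mapSnd_leg12, ← mul_assoc (_ * _ * _),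
    mul_assoc (_ * _) _ (mapSnd (mapSnd j) _), ← map_mul, Units.inv_mul, map_one, mul_one,
    mul_assoc]

lemma leg1_monodromy_mul_leg2 (h : SolvesRelations F σ j Φ) (hF : StructureRelations 𝓡 F σ) :
    leg1 (monodromy 𝓡 σ j Φ) * leg2 (Φ : G ⊗[ℂ] B) =
      leg2 (Φ : G ⊗[ℂ] B) * (leg12 (𝓡.R : G ⊗[ℂ] G) * leg1 (monodromy 𝓡 σ j Φ) *
        leg12 (flip (𝓡.R : G ⊗[ℂ] G))) := by
  have hD : leg1 (mapSnd j (structD 𝓡 σ : G ⊗[ℂ] Center G)) *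
        mapSnd (mapSnd j) (twistedR F 𝓡.Rminus : G ⊗[ℂ] (G ⊗[ℂ] Center G)) =
      mapSnd (mapSnd j) (twistedR F 𝓡.R : G ⊗[ℂ] (G ⊗[ℂ] Center G)) *
        mapSnd (mapSnd j) (mapSnd σ (structD 𝓡 σ : G ⊗[ℂ] Center G)) := by
    simpa only [map_mul, mapSnd_leg1, RRminus, RRplus, RibbonStructure.Rplus] using
      congrArg (mapSnd (G := G) (mapSnd j)) hF.D_left
  have hM : leg1 (Φ : G ⊗[ℂ] B) * leg1 (monodromy 𝓡 σ j Φ) =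
      leg1 (mapSnd j (structD 𝓡 σ : G ⊗[ℂ] Center G)) * leg1 (Φ : G ⊗[ℂ] B) := by
    rw [← map_mul, mul_monodromy, map_mul]
  have covariance : leg1 (monodromy 𝓡 σ j Φ) * leg2 (Φ : G ⊗[ℂ] B) *
      leg12 (𝓡.Rminus : G ⊗[ℂ] G) =
        leg2 (Φ : G ⊗[ℂ] B) * (leg12 (𝓡.R : G ⊗[ℂ] G) * leg1 (monodromy 𝓡 σ j Φ)) := by
    apply (Φ.isUnit.map leg1).mul_left_cancel
    rw [← mul_assoc, ← mul_assoc, hM, mul_assoc, mul_assoc, ← mul_assoc _ _ (leg12 _),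
      h.leg1_mul_leg2 𝓡.Rminus_comul, ← mul_assoc, hD, ← mul_assoc, mul_assoc _ _ (leg2 _),
      h.exchange_leg2, mul_assoc, mul_assoc, ← hM, ← mul_assoc (leg2 _), ← mul_assoc,
      ← h.leg1_mul_leg2 𝓡.R_comul]
    simp only [mul_assoc]
  rw [← mul_assoc, ← covariance, mul_assoc, ← map_mul, 𝓡.Rminus_mul_flip_R, map_one, mul_one]

/-- The monodromies of the three legs of `Φ² Φ¹ = F Δ_a(Φ)` are group commutators with `v`, and
`F` commutes with `v`, so this is the identity `⁅ab, c⁆ = a ⁅b, c⁆ a⁻¹ ⁅a, c⁆`. -/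
lemma leg12_mul_comulFirst_monodromy (h : SolvesRelations F σ j Φ) :
    leg12 (flip (𝓡.R : G ⊗[ℂ] G) * (𝓡.R : G ⊗[ℂ] G)) * comulFirst (monodromy 𝓡 σ j Φ) =
      leg1 ((Φ⁻¹ : (G ⊗[ℂ] B)ˣ) : G ⊗[ℂ] B) * leg2 (monodromy 𝓡 σ j Φ) * leg1 (Φ : G ⊗[ℂ] B) *
        leg1 (monodromy 𝓡 σ j Φ) := by
  let p₁ : (G ⊗[ℂ] (G ⊗[ℂ] B))ˣ := Units.map (leg1 (G := G) (X := B)).toMonoidHom Φ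
  let p₂ : (G ⊗[ℂ] (G ⊗[ℂ] B))ˣ := Units.map (leg2 (G := G) (X := B)).toMonoidHom Φ
  let p : (G ⊗[ℂ] (G ⊗[ℂ] B))ˣ := Units.map (comulFirst (G := G) (X := B)).toMonoidHom Φ
  let f : (G ⊗[ℂ] (G ⊗[ℂ] B))ˣ :=
    Units.map (mapSnd (G := G) (mapSnd (G := G) j)).toMonoidHom F
  let c : (G ⊗[ℂ] (G ⊗[ℂ] B))ˣ :=
    Units.map (leg2 (G := G) (X := B)).toMonoidHom (ribbonUnit 𝓡 j)
  have hp : p₂ * p₁ = f * p := Units.ext h.operatorProduct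
  have hf : Commute f c := by
    refine Units.ext (Commute.eq ?_)
    exact ((commute_tmul (fun _ => .one_left _) (commute_tmul (fun _ => .one_left _)
      (center_commute (𝓡.vC : Center G))) _).map (mapSnd (mapSnd j))).symm
  have hc : Units.map (comulFirst (G := G) (X := B)).toMonoidHom (ribbonUnit 𝓡 j) = c :=
    Units.ext (comulFirst_one_tmul _)
  have split : ⁅p⁻¹, c⁻¹⁆ = p₁⁻¹ * ⁅p₂⁻¹, c⁻¹⁆ * p₁ * ⁅p₁⁻¹, c⁻¹⁆ := by
    have hfc : ⁅f, c⁻¹⁆ = 1 := commutatorElement_eq_one_iff_commute.2 hf.inv_right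
    have hp' : p⁻¹ = p₁⁻¹ * (p₂⁻¹ * f) := by
      rw [← mul_assoc, ← mul_inv_rev, hp, mul_inv_rev, inv_mul_cancel_right]
    rw [hp', commutatorElement_mul_left_eq_conj_mul, commutatorElement_mul_left_eq_conj_mul, hfc]
    simp
  have hv₁ (y : G ⊗[ℂ] (G ⊗[ℂ] B)) : Commute (leg1 ((𝓡.v : G) ⊗ₜ[ℂ] (1 : B))) y :=
    commute_tmul 𝓡.v_commute (fun _ => .one_left _) y
  have hv₂ (y : G ⊗[ℂ] (G ⊗[ℂ] B)) : Commute (leg2 ((𝓡.v : G) ⊗ₜ[ℂ] (1 : B))) y :=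
    commute_tmul (fun _ => .one_left _) (commute_tmul 𝓡.v_commute fun _ => .one_left _) y
  have hvv : leg12 ((𝓡.v : G) ⊗ₜ[ℂ] (𝓡.v : G)) =
      leg2 ((𝓡.v : G) ⊗ₜ[ℂ] (1 : B)) * leg1 ((𝓡.v : G) ⊗ₜ[ℂ] (1 : B)) := by simp
  rw [h.map_monodromy leg1, h.map_monodromy leg2, h.map_monodromy comulFirst, comulFirst_tmul_one,
    ← mul_assoc, ← map_mul, 𝓡.flip_R_mul_R_mul_comul_v, hc, split, hvv, Units.val_mul,
    Units.val_mul, Units.val_mul, mul_assoc (leg2 _), ← mul_assoc (leg1 _), (hv₁ _).eq]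
  simp only [mul_assoc]
  exact (hv₂ _).left_comm _

lemma monodromy_comulFirst (h : SolvesRelations F σ j Φ) (hF : StructureRelations 𝓡 F σ) :
    leg12 (𝓡.R : G ⊗[ℂ] G) * comulFirst (monodromy 𝓡 σ j Φ) =
      leg2 (monodromy 𝓡 σ j Φ) * leg12 (𝓡.R : G ⊗[ℂ] G) * leg1 (monodromy 𝓡 σ j Φ) := by
  have covariance := congrArg swap12 (h.leg1_monodromy_mul_leg2 hF)
  simp only [map_mul, swap12_leg1, swap12_leg2, swap12_leg12, flip_flip] at covariance
  apply ((𝓡.R.isUnit.map flip).map (leg12 (G := G) (X := B))).mul_left_cancel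
  rw [← mul_assoc, ← map_mul, h.leg12_mul_comulFirst_monodromy, mul_assoc (leg1 _) (leg2 _),
    covariance, ← mul_assoc (leg1 _) (leg1 _), ← map_mul, Units.inv_mul, map_one, one_mul]
  simp only [mul_assoc]

lemma evalFirst_counit (h : SolvesRelations F σ j Φ) :
    evalFirst (counitAlgHom ℂ G) (Φ : G ⊗[ℂ] B) = j (evalFirst (counitAlgHom ℂ G)
      (evalFirst (counitAlgHom ℂ G) (F : G ⊗[ℂ] (G ⊗[ℂ] Center G)))) := by
  have := congrArg (fun x => evalFirst (counitAlgHom ℂ G) (evalFirst (counitAlgHom ℂ G) x))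
    h.operatorProduct
  simp only [map_mul, evalFirst_leg1, evalFirst_leg2, evalFirst_mapSnd, evalFirst_counit_comulFirst,
    evalFirst_tmul, map_one, one_smul] at this
  exact (Φ.isUnit.map _).mul_right_cancel this

lemma evalFirst_counit_monodromy (h : SolvesRelations F σ j Φ) :
    evalFirst (counitAlgHom ℂ G) (monodromy 𝓡 σ j Φ) = 1 := by
  have hcomm : ⁅(Units.map (evalFirst (counitAlgHom ℂ G)).toMonoidHom Φ)⁻¹,
      (Units.map (evalFirst (counitAlgHom ℂ G)).toMonoidHom (ribbonUnit 𝓡 j))⁻¹⁆ = 1 := by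
    refine commutatorElement_eq_one_iff_commute.2 (Commute.inv_inv (Units.ext ?_))
    have hv : evalFirst (counitAlgHom ℂ G) (ribbonUnit 𝓡 j : G ⊗[ℂ] B) = j (𝓡.vC : Center G) :=
      (evalFirst_tmul _ _ _).trans (by simp)
    change evalFirst (counitAlgHom ℂ G) (Φ : G ⊗[ℂ] B) *
      evalFirst (counitAlgHom ℂ G) (ribbonUnit 𝓡 j : G ⊗[ℂ] B) = evalFirst _ _ * evalFirst _ _
    rw [hv, h.evalFirst_counit, ((center_commute _ _).map j).eq]
  rw [h.map_monodromy, hcomm, evalFirst_tmul, counitAlgHom_apply, 𝓡.counit_v, one_smul,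
    Units.val_one, one_mul]

lemma monodromy_commute (h : SolvesRelations F σ j Φ) (f : Center G) :
    Commute (monodromy 𝓡 σ j Φ) ((1 : G) ⊗ₜ[ℂ] j f) := by
  apply Φ.isUnit.mul_left_cancel
  rw [← mul_assoc, mul_monodromy, mul_assoc, h.exchange, ← mul_assoc, ← map_mul,
    (structD_commute f).eq, map_mul, mul_assoc, ← mul_monodromy, ← mul_assoc, ← h.exchange,
    mul_assoc]

end SolvesRelations

end Monodromy

section HopfAction

variable {G : Type*} [Ring G] [HopfAlgebra ℂ G] {B : Type*} [Ring B] [Algebra ℂ B]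

lemma component_mapComulFlip (π : Module.Dual ℂ G) (y : G ⊗[ℂ] G) :
    component π (mapComulFlip y) = flip (comul (R := ℂ) (component π y)) :=
  component_mapSnd _ π y

lemma components_bijective [FiniteDimensional ℂ G] {x : G ⊗[ℂ] G}
    (hx : Function.Surjective (rightComponents x)) : Function.Bijective (components x) := by
  have hinj : Function.Injective (components x) := by
    refine (injective_iff_map_eq_zero _).2 fun π hπ => LinearMap.ext fun g => ?_
    obtain ⟨φ, rfl⟩ := hx g
    rw [rightComponents_apply, ← apply_component, ← components_apply, hπ, map_zero,
      LinearMap.zero_apply]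
  exact ⟨hinj, (LinearMap.injective_iff_surjective_of_finrank_eq_finrank
    Subspace.dual_finrank_eq).1 hinj⟩

lemma exists_lTensor_eq [FiniteDimensional ℂ G] {x : G ⊗[ℂ] G}
    (hx : Function.Bijective (components x)) (y : G ⊗[ℂ] B) :
    ∃ f : G →ₗ[ℂ] B, f.lTensor G x = y := by
  let e := LinearEquiv.ofBijective (components x) hx
  refine ⟨(components y).comp e.symm.toLinearMap, ext_component fun π => ?_⟩
  rw [component_lTensor, ← components_apply x]
  exact congrArg (components y) (e.symm_apply_apply π)

variable [StarRing G] [StarModule ℂ G] {𝓡 : RibbonStructure G}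

namespace RibbonStructure

lemma outerSandwich_antipode_R (𝓡 : RibbonStructure G) (x y : G ⊗[ℂ] B) :
    outerSandwich ((antipode ℂ).lTensor G (𝓡.R : G ⊗[ℂ] G))
      (leg2 x * leg12 (𝓡.R : G ⊗[ℂ] G) * leg1 y) = leg2 x * leg1 y := by
  rw [outerSandwich_leg2_mul_leg12_mul_leg1, 𝓡.sandwich_antipode_R, map_one, mul_one]

lemma exists_algHom_mapSnd_N [FiniteDimensional ℂ G]
    (hN : Function.Surjective (rightComponents (𝓡.N : G ⊗[ℂ] G))) {m : G ⊗[ℂ] B}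
    (hcounit : evalFirst (counitAlgHom ℂ G) m = 1)
    (hcomul : leg12 (𝓡.R : G ⊗[ℂ] G) * comulFirst m =
      leg2 m * leg12 (𝓡.R : G ⊗[ℂ] G) * leg1 m) :
    ∃ ι : G →ₐ[ℂ] B, mapSnd ι (𝓡.N : G ⊗[ℂ] G) = m := by
  obtain ⟨ι, hι⟩ := exists_lTensor_eq (components_bijective hN) m
  have hιπ (π : Module.Dual ℂ G) : ι (component π (𝓡.N : G ⊗[ℂ] G)) = component π m := by
    rw [← hι, component_lTensor]
  have hone : ι 1 = 1 := by
    rw [← hcounit, ← 𝓡.evalFirst_counit_N, evalFirst_eq_component, evalFirst_eq_component, hιπ]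
  have hprod : (ι.lTensor G).lTensor G (leg2 (𝓡.N : G ⊗[ℂ] G) * leg1 (𝓡.N : G ⊗[ℂ] G)) =
      leg2 m * leg1 m := by
    rw [← 𝓡.outerSandwich_antipode_R, ← 𝓡.outerSandwich_antipode_R, ← hcomul,
      ← leg12_R_mul_comulFirst_N, lTensor_outerSandwich, lTensor_leg12_mul, lTensor_comulFirst, hι]
  have hmul (x y : G) : ι (x * y) = ι x * ι y := by
    obtain ⟨π, rfl⟩ := (components_bijective hN).surjective x
    obtain ⟨φ, rfl⟩ := (components_bijective hN).surjective y
    rw [components_apply, components_apply, hιπ, hιπ, ← component_component_leg2_mul_leg1,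
      ← component_component_leg2_mul_leg1, ← hprod, component_lTensor, component_lTensor]
  exact ⟨AlgHom.ofLinearMap ι hone hmul, hι⟩

end RibbonStructure

/-- The algebra map `ι` makes `𝒢` act on the algebra of a solution so that `Φ` is covariant and the
monodromy `Φ⁻¹ D Φ` is the image of `N`. -/
structure IsMonodromyAction (𝓡 : RibbonStructure G) (σ : Center G →ₐ[ℂ] G ⊗[ℂ] Center G)
    (j : Center G →ₐ[ℂ] B) (Φ : (G ⊗[ℂ] B)ˣ) (ι : G →ₐ[ℂ] B) : Prop where
  monodromy : (Φ : G ⊗[ℂ] B) * mapSnd ι (𝓡.N : G ⊗[ℂ] G) =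
    mapSnd j (structD 𝓡 σ : G ⊗[ℂ] Center G) * Φ
  covariance : ∀ ξ : G, ((1 : G) ⊗ₜ[ℂ] ι ξ) * (Φ : G ⊗[ℂ] B) =
    Φ * mapSnd ι (flip (comul (R := ℂ) ξ))
  commute : ∀ (f : Center G) (ξ : G), Commute (ι ξ) (j f)

lemma IsMonodromyAction.map {B' : Type*} [Ring B'] [Algebra ℂ B']
    {σ : Center G →ₐ[ℂ] G ⊗[ℂ] Center G} {j : Center G →ₐ[ℂ] B} {Φ : (G ⊗[ℂ] B)ˣ} {ι : G →ₐ[ℂ] B}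
    (h : IsMonodromyAction 𝓡 σ j Φ ι) (f : B →ₐ[ℂ] B') :
    IsMonodromyAction 𝓡 σ (f.comp j) (Units.map (mapSnd (G := G) f).toMonoidHom Φ)
      (f.comp ι) where
  monodromy := by
    have := congrArg (mapSnd (G := G) f) h.monodromy
    rwa [map_mul, map_mul, mapSnd_mapSnd, mapSnd_mapSnd] at this
  covariance ξ := by
    have := congrArg (mapSnd (G := G) f) (h.covariance ξ)
    rwa [map_mul, map_mul, mapSnd_mapSnd, mapSnd_tmul] at this
  commute c ξ := (h.commute c ξ).map f

theorem SolvesRelations.exists_isMonodromyAction [FiniteDimensional ℂ G]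
    {F : (G ⊗[ℂ] (G ⊗[ℂ] Center G))ˣ} {σ : Center G →ₐ[ℂ] G ⊗[ℂ] Center G}
    {j : Center G →ₐ[ℂ] B} {Φ : (G ⊗[ℂ] B)ˣ} (h : SolvesRelations F σ j Φ)
    (hF : StructureRelations 𝓡 F σ)
    (hN : Function.Surjective (rightComponents (𝓡.N : G ⊗[ℂ] G))) :
    ∃ ι : G →ₐ[ℂ] B, IsMonodromyAction 𝓡 σ j Φ ι := by
  obtain ⟨ι, hι⟩ := 𝓡.exists_algHom_mapSnd_N hN h.evalFirst_counit_monodromy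
    (h.monodromy_comulFirst hF)
  have hsurj := (components_bijective hN).surjective
  refine ⟨ι, by rw [hι, mul_monodromy], fun ξ => ?_, fun f ξ => ?_⟩
  · obtain ⟨π, rfl⟩ := hsurj ξ
    have covariance := congrArg (component π) (h.leg1_monodromy_mul_leg2 hF)
    rw [← hι, ← mapSnd_leg1, ← mapSnd_leg12 ι, ← mapSnd_leg12 ι, ← map_mul, ← map_mul,
      ← 𝓡.mapComulFlip_N, mapSnd_leg1, leg2_apply, component_mul_one_tmul, component_leg1,
      component_one_tmul_mul, component_mapSnd, component_mapSnd,
      component_mapComulFlip] at covariance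
    exact covariance
  · obtain ⟨π, rfl⟩ := hsurj ξ
    rw [components_apply, ← component_mapSnd, hι, commute_iff_eq, ← component_mul_one_tmul,
      (h.monodromy_commute f).eq, component_one_tmul_mul]

end HopfAction

/-! ### Normal form and universality -/

section MapSnd

variable {G X Y Z : Type*} [Ring G] [HopfAlgebra ℂ G] [Ring X] [Algebra ℂ X] [Ring Y] [Algebra ℂ Y]
  [Ring Z] [Algebra ℂ Z]

lemma mapSnd_comp_mapSnd (f : Y →ₐ[ℂ] Z) (g : X →ₐ[ℂ] Y) :
    (mapSnd (G := G) f).comp (mapSnd (G := G) g) = mapSnd (f.comp g) :=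
  AlgHom.ext fun x => mapSnd_mapSnd g f x

lemma mapSnd_injective {f : X →ₐ[ℂ] Y} (hf : Function.Injective f) :
    Function.Injective (mapSnd (G := G) f) :=
  Module.Flat.lTensor_preserves_injective_linearMap (M := G) f.toLinearMap hf

end MapSnd

section Convolution

variable {G X : Type*} [Ring G] [HopfAlgebra ℂ G] [Ring X] [Algebra ℂ X]

/-- The convolution product of linear forms on `G`, `(π, φ) ↦ (π ⊗ φ)Δ`. -/
def conv : Module.Dual ℂ G →ₗ[ℂ] Module.End ℂ (Module.Dual ℂ G) :=
  LinearMap.mk₂ ℂ (fun π φ => (LinearMap.mul' ℂ ℂ).comp ((TensorProduct.map π φ).comp comul))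
    (by intros; ext; simp [TensorProduct.map_add_left])
    (by intros; ext; simp [TensorProduct.map_smul_left])
    (by intros; ext; simp [TensorProduct.map_add_right])
    (by intros; ext; simp [TensorProduct.map_smul_right])

lemma conv_apply (π φ : Module.Dual ℂ G) (h : G) :
    conv π φ h = φ (component π (comul (R := ℂ) h)) := by
  change LinearMap.mul' ℂ ℂ (TensorProduct.map π φ (comul (R := ℂ) h)) = _
  induction comul (R := ℂ) h <;> simp_all

lemma component_component_mul_comulFirst (π φ : Module.Dual ℂ G) (a b : G) (x : X)
    (y : G ⊗[ℂ] X) :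
    component π (component φ ((a ⊗ₜ[ℂ] (b ⊗ₜ[ℂ] x)) * comulFirst y)) =
      x * component (conv (φ.comp (LinearMap.mulLeft ℂ a)) (π.comp (LinearMap.mulLeft ℂ b))) y := by
  induction y with
  | tmul g z =>
    rw [comulFirst_tmul, component_tmul, conv_apply]
    induction comul (R := ℂ) g <;> simp_all [smul_smul, mul_comm, mul_add, add_mul, add_smul]
  | _ => simp_all [mul_add]

lemma component_component_comulFirst (π φ : Module.Dual ℂ G) (y : G ⊗[ℂ] X) :
    component π (component φ (comulFirst y)) = component (conv φ π) y := by
  have := component_component_mul_comulFirst π φ 1 1 1 y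
  rwa [← Algebra.TensorProduct.one_def, ← Algebra.TensorProduct.one_def, one_mul, one_mul,
    LinearMap.mulLeft_one, LinearMap.comp_id, LinearMap.comp_id] at this

end Convolution

section Generation

variable {A B : Type*} [Ring A] [Algebra ℂ A] [Ring B] [Algebra ℂ B] {s : Set A}

lemma toSubmodule_adjoin_le {V : Submodule ℂ A} (one_mem : 1 ∈ V)
    (mul_mem : ∀ x ∈ s, ∀ y ∈ V, x * y ∈ V) :
    Subalgebra.toSubmodule (Algebra.adjoin ℂ s) ≤ V := by
  rw [Algebra.adjoin_eq_span, Submodule.span_le]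
  intro x hx
  induction hx using Submonoid.closure_induction_left with
  | one => exact one_mem
  | mul_left x hx y _ hy => exact mul_mem x hx y hy

lemma map_mul_of_adjoin_eq_top (hs : Algebra.adjoin ℂ s = ⊤) {ψ : A →ₗ[ℂ] B} (map_one : ψ 1 = 1)
    (map_mul : ∀ x ∈ s, ∀ y, ψ (x * y) = ψ x * ψ y) (x y : A) : ψ (x * y) = ψ x * ψ y := by
  have hx : x ∈ Algebra.adjoin ℂ s := hs ▸ Algebra.mem_top
  induction hx using Algebra.adjoin_induction generalizing y with
  | mem x hx => exact map_mul x hx y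
  | algebraMap c => simp [Algebra.algebraMap_eq_smul_one, map_one]
  | add x z _ _ hx hz => simp [add_mul, hx, hz]
  | mul x z _ _ hx hz => rw [mul_assoc, hx, hz, hx, mul_assoc]

end Generation

section NormalForm

variable {G : Type*} [Ring G] [HopfAlgebra ℂ G] [StarRing G] [StarModule ℂ G]
  {F : (G ⊗[ℂ] (G ⊗[ℂ] Center G))ˣ} {σ : Center G →ₐ[ℂ] G ⊗[ℂ] Center G}
  {B : Type*} [Ring B] [Algebra ℂ B] {j : Center G →ₐ[ℂ] B} {Φ : (G ⊗[ℂ] B)ˣ}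
  {B' : Type*} [Ring B'] [Algebra ℂ B'] {j' : Center G →ₐ[ℂ] B'} {Φ' : (G ⊗[ℂ] B')ˣ}

/-- The generators of the algebra of relations: the elements of `𝒞` and the components of `Φ`. -/
def generators (j : Center G →ₐ[ℂ] B) (Φ : (G ⊗[ℂ] B)ˣ) : Set B :=
  Set.range j ∪ Set.range fun π : Module.Dual ℂ G => component π (Φ : G ⊗[ℂ] B)

lemma map_mem_generators (f : Center G) : j f ∈ generators j Φ := Or.inl ⟨f, rfl⟩

lemma component_mem_generators (π : Module.Dual ℂ G) :
    component π (Φ : G ⊗[ℂ] B) ∈ generators j Φ := Or.inr ⟨π, rfl⟩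

lemma generators_map (f : B →ₐ[ℂ] B') :
    generators (f.comp j) (Units.map (mapSnd (G := G) f).toMonoidHom Φ) =
      f '' generators j Φ := by
  rw [generators, generators, Set.image_union, ← Set.range_comp, ← Set.range_comp]
  congr 2
  exact funext fun π => component_mapSnd _ _ _

lemma adjoin_generators_map_eq_top (hgen : Algebra.adjoin ℂ (generators j Φ) = ⊤)
    {f : B →ₐ[ℂ] B'} (hf : Function.Surjective f) :
    Algebra.adjoin ℂ (generators (f.comp j) (Units.map (mapSnd (G := G) f).toMonoidHom Φ)) = ⊤ := by
  rw [generators_map, ← AlgHom.map_adjoin, hgen, Algebra.map_top, AlgHom.range_eq_top]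
  exact hf

/-- The linear map `f ⊗ π ↦ f Φ_π`, where `Φ_π` is the `π`-component of `Φ`. -/
def normalForm (j : Center G →ₐ[ℂ] B) (Φ : (G ⊗[ℂ] B)ˣ) :
    Center G ⊗[ℂ] Module.Dual ℂ G →ₗ[ℂ] B :=
  (LinearMap.mul' ℂ B).comp (TensorProduct.map j.toLinearMap (components (Φ : G ⊗[ℂ] B)))

@[simp] lemma normalForm_tmul (f : Center G) (π : Module.Dual ℂ G) :
    normalForm j Φ (f ⊗ₜ[ℂ] π) = j f * component π (Φ : G ⊗[ℂ] B) := by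
  simp [normalForm]

/-- The linear map `a ⊗ b ⊗ f ↦ f ⊗ (φ ⊗ π)((a ⊗ b)Δ(·))`, which brings the iterated component of
`(a ⊗ b ⊗ f) Δ_a(Φ)` into normal form. -/
def reorder (π φ : Module.Dual ℂ G) :
    G ⊗[ℂ] (G ⊗[ℂ] Center G) →ₗ[ℂ] Center G ⊗[ℂ] Module.Dual ℂ G :=
  (TensorProduct.comm ℂ _ _).toLinearMap ∘ₗ (TensorProduct.lift conv).rTensor (Center G) ∘ₗ
    (TensorProduct.assoc ℂ _ _ _).symm.toLinearMap ∘ₗ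
    TensorProduct.map ((LinearMap.mul ℂ G).compr₂ φ)
      (TensorProduct.map ((LinearMap.mul ℂ G).compr₂ π) LinearMap.id)

lemma reorder_tmul (π φ : Module.Dual ℂ G) (a b : G) (f : Center G) :
    reorder π φ (a ⊗ₜ[ℂ] (b ⊗ₜ[ℂ] f)) =
      f ⊗ₜ[ℂ] conv (φ.comp (LinearMap.mulLeft ℂ a)) (π.comp (LinearMap.mulLeft ℂ b)) := rfl

lemma normalForm_reorder (π φ : Module.Dual ℂ G) (x : G ⊗[ℂ] (G ⊗[ℂ] Center G)) :
    normalForm j Φ (reorder π φ x) =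
      component π (component φ (mapSnd (mapSnd j) x * comulFirst (Φ : G ⊗[ℂ] B))) := by
  induction x with
  | tmul a b =>
    induction b with
    | tmul b c =>
      rw [reorder_tmul, normalForm_tmul, mapSnd_tmul, mapSnd_tmul,
        component_component_mul_comulFirst]
    | _ => simp_all [TensorProduct.tmul_add, add_mul]
  | _ => simp_all [add_mul]

namespace SolvesRelations

lemma component_mul_normalForm_tmul (h : SolvesRelations F σ j Φ) (π φ : Module.Dual ℂ G)
    (f : Center G) :
    component π (Φ : G ⊗[ℂ] B) * normalForm j Φ (f ⊗ₜ[ℂ] φ) =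
      normalForm j Φ (reorder π φ (leg2 (σ f) * (F : G ⊗[ℂ] (G ⊗[ℂ] Center G)))) := by
  rw [normalForm_reorder, map_mul (mapSnd (mapSnd j)), mul_assoc, ← h.operatorProduct, mapSnd_leg2,
    ← mul_assoc, ← map_mul leg2, ← h.exchange, component_component_leg2_mul_leg1,
    component_mul_one_tmul, mul_assoc, normalForm_tmul]

/-- The rules that bring `x · f Φ_π`, with `x` a generator, into normal form are the same for all
solutions. -/
lemma exists_generator_mul_normalForm (h : SolvesRelations F σ j Φ)
    (h' : SolvesRelations F σ j' Φ') (y : Center G ⊗[ℂ] Module.Dual ℂ G) :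
    (∀ f, ∃ z, j f * normalForm j Φ y = normalForm j Φ z ∧
      j' f * normalForm j' Φ' y = normalForm j' Φ' z) ∧
    ∀ π : Module.Dual ℂ G, ∃ z,
      component π (Φ : G ⊗[ℂ] B) * normalForm j Φ y = normalForm j Φ z ∧
      component π (Φ' : G ⊗[ℂ] B') * normalForm j' Φ' y = normalForm j' Φ' z := by
  refine ⟨fun f => ?_, fun π => ?_⟩ <;> induction y with
  | zero => exact ⟨0, by simp⟩
  | add y y' hy hy' =>
    obtain ⟨z, hz⟩ := hy
    obtain ⟨z', hz'⟩ := hy'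
    exact ⟨z + z', by simp_all [mul_add]⟩
  | tmul g φ => ?_
  · exact ⟨(f * g) ⊗ₜ φ, by simp [mul_assoc]⟩
  · exact ⟨_, h.component_mul_normalForm_tmul π φ g, h'.component_mul_normalForm_tmul π φ g⟩

lemma normalForm_counit (h : SolvesRelations F σ j Φ) :
    normalForm j Φ (evalFirst (counitAlgHom ℂ G) (evalFirst (counitAlgHom ℂ G)
      ((F⁻¹ : (G ⊗[ℂ] (G ⊗[ℂ] Center G))ˣ) : G ⊗[ℂ] (G ⊗[ℂ] Center G))) ⊗ₜ[ℂ] counit) = 1 := by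
  have counit_Φ := h.evalFirst_counit
  rw [evalFirst_eq_component] at counit_Φ
  change component counit (Φ : G ⊗[ℂ] B) = _ at counit_Φ
  rw [normalForm_tmul, counit_Φ, ← map_mul, ← map_mul, ← map_mul,
    Units.inv_mul, map_one, map_one, map_one]

lemma adjoin_le_range_normalForm (h : SolvesRelations F σ j Φ) :
    Subalgebra.toSubmodule (Algebra.adjoin ℂ (generators j Φ)) ≤
      LinearMap.range (normalForm j Φ) := by
  refine toSubmodule_adjoin_le ⟨_, h.normalForm_counit⟩ ?_
  rintro _ hx _ ⟨y, rfl⟩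
  obtain ⟨hj, hΦ⟩ := h.exists_generator_mul_normalForm h y
  rcases hx with ⟨f, rfl⟩ | ⟨π, rfl⟩
  · obtain ⟨z, hz, -⟩ := hj f
    exact ⟨z, hz.symm⟩
  · obtain ⟨z, hz, -⟩ := hΦ π
    exact ⟨z, hz.symm⟩

lemma map (h : SolvesRelations F σ j Φ) (f : B →ₐ[ℂ] B') :
    SolvesRelations F σ (f.comp j) (Units.map (mapSnd (G := G) f).toMonoidHom Φ) where
  operatorProduct := by
    have := congrArg (mapSnd (G := G) (mapSnd (G := G) f)) h.operatorProduct
    rwa [map_mul, map_mul, mapSnd_leg1, mapSnd_leg2, mapSnd_comulFirst, mapSnd_mapSnd,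
      mapSnd_comp_mapSnd] at this
  exchange c := by
    have := congrArg (mapSnd (G := G) f) (h.exchange c)
    rwa [map_mul, map_mul, mapSnd_mapSnd] at this

lemma of_injective {f : B →ₐ[ℂ] B'} (hf : Function.Injective f)
    (h : SolvesRelations F σ (f.comp j) (Units.map (mapSnd (G := G) f).toMonoidHom Φ)) :
    SolvesRelations F σ j Φ where
  operatorProduct := by
    apply mapSnd_injective (G := G) (mapSnd_injective (G := G) hf)
    rw [map_mul, map_mul, mapSnd_leg1, mapSnd_leg2, mapSnd_comulFirst, mapSnd_mapSnd,
      mapSnd_comp_mapSnd]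
    exact h.operatorProduct
  exchange c := by
    apply mapSnd_injective (G := G) hf
    rw [map_mul, map_mul, mapSnd_mapSnd]
    exact h.exchange c

variable [FiniteDimensional ℂ G]

instance finiteDimensional_center : FiniteDimensional ℂ (Center G) :=
  inferInstanceAs (FiniteDimensional ℂ (Subalgebra.toSubmodule (Center G).toSubalgebra))

lemma finiteDimensional_adjoin (h : SolvesRelations F σ j Φ) :
    FiniteDimensional ℂ (Algebra.adjoin ℂ (generators j Φ)) :=
  Submodule.finiteDimensional_of_le h.adjoin_le_range_normalForm

lemma finrank_adjoin_le (h : SolvesRelations F σ j Φ) :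
    Module.finrank ℂ (Algebra.adjoin ℂ (generators j Φ)) ≤
      Module.finrank ℂ (Center G) * Module.finrank ℂ G := by
  calc Module.finrank ℂ (Algebra.adjoin ℂ (generators j Φ))
      ≤ Module.finrank ℂ (LinearMap.range (normalForm j Φ)) :=
        Submodule.finrank_mono h.adjoin_le_range_normalForm
    _ ≤ Module.finrank ℂ (Center G ⊗[ℂ] Module.Dual ℂ G) := LinearMap.finrank_range_le _
    _ = Module.finrank ℂ (Center G) * Module.finrank ℂ G := by
        rw [Module.finrank_tensorProduct, Subspace.dual_finrank_eq]

lemma exists_restrict (h : SolvesRelations F σ j Φ) :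
    ∃ (jA : Center G →ₐ[ℂ] Algebra.adjoin ℂ (generators j Φ))
      (ΦA : (G ⊗[ℂ] Algebra.adjoin ℂ (generators j Φ))ˣ), SolvesRelations F σ jA ΦA := by
  let A := Algebra.adjoin ℂ (generators j Φ)
  have : FiniteDimensional ℂ A := h.finiteDimensional_adjoin
  have : IsArtinianRing (G ⊗[ℂ] A) := IsArtinianRing.of_finite ℂ _
  have val_injective : Function.Injective A.val := Subtype.val_injective
  let b := Module.finBasis ℂ G
  let x : G ⊗[ℂ] A := ∑ i, b i ⊗ₜ[ℂ]
    (⟨component (b.coord i) (Φ : G ⊗[ℂ] B), Algebra.subset_adjoin (component_mem_generators _)⟩ : A)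
  have map_x : mapSnd A.val x = (Φ : G ⊗[ℂ] B) := by
    rw [eq_sum_tmul_component b (Φ : G ⊗[ℂ] B), map_sum]
    rfl
  have isUnit_x : IsUnit x := by
    rw [IsArtinianRing.isUnit_iff_isRightRegular]
    intro y z hyz
    have := congrArg (mapSnd A.val) hyz
    simp only [map_mul, map_x] at this
    exact mapSnd_injective val_injective (Φ.isUnit.mul_right_cancel this)
  refine ⟨j.codRestrict A fun f => Algebra.subset_adjoin (map_mem_generators f), isUnit_x.unit,
    of_injective val_injective ?_⟩
  rwa [show Units.map (mapSnd (G := G) A.val).toMonoidHom isUnit_x.unit = Φ from Units.ext map_x]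

variable [FiniteDimensional ℂ B]

lemma normalForm_bijective (h : SolvesRelations F σ j Φ)
    (hgen : Algebra.adjoin ℂ (generators j Φ) = ⊤)
    (hdim : Module.finrank ℂ (Center G) * Module.finrank ℂ G ≤ Module.finrank ℂ B) :
    Function.Bijective (normalForm j Φ) := by
  have surjective : Function.Surjective (normalForm j Φ) := by
    have hle := h.adjoin_le_range_normalForm
    rwa [hgen, Algebra.top_toSubmodule, top_le_iff, LinearMap.range_eq_top] at hle
  have finrank_eq : Module.finrank ℂ (Center G ⊗[ℂ] Module.Dual ℂ G) = Module.finrank ℂ B := by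
    refine le_antisymm ?_ (LinearMap.finrank_le_finrank_of_surjective surjective)
    rwa [Module.finrank_tensorProduct, Subspace.dual_finrank_eq]
  exact ⟨(LinearMap.injective_iff_surjective_of_finrank_eq_finrank finrank_eq).2 surjective,
    surjective⟩

lemma injective (h : SolvesRelations F σ j Φ)
    (hgen : Algebra.adjoin ℂ (generators j Φ) = ⊤)
    (hdim : Module.finrank ℂ (Center G) * Module.finrank ℂ G ≤ Module.finrank ℂ B) :
    Function.Injective j := by
  refine (injective_iff_map_eq_zero _).2 fun f hf => ?_
  have tmul_eq_zero : f ⊗ₜ[ℂ] (counit : Module.Dual ℂ G) = 0 :=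
    (h.normalForm_bijective hgen hdim).injective (by rw [normalForm_tmul, hf, zero_mul, map_zero])
  simpa using congrArg ((TensorProduct.rid ℂ (Center G)).toLinearMap.comp
    ((Module.Dual.eval ℂ G 1).lTensor (Center G))) tmul_eq_zero

lemma exists_algHom (h : SolvesRelations F σ j Φ)
    (hgen : Algebra.adjoin ℂ (generators j Φ) = ⊤)
    (hdim : Module.finrank ℂ (Center G) * Module.finrank ℂ G ≤ Module.finrank ℂ B)
    (h' : SolvesRelations F σ j' Φ') :
    ∃ ψ : B →ₐ[ℂ] B', ψ.comp j = j' ∧ mapSnd ψ (Φ : G ⊗[ℂ] B) = (Φ' : G ⊗[ℂ] B') := by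
  let e := LinearEquiv.ofBijective (normalForm j Φ) (h.normalForm_bijective hgen hdim)
  let ψ : B →ₗ[ℂ] B' := normalForm j' Φ' ∘ₗ e.symm.toLinearMap
  have hψ (y) : ψ (normalForm j Φ y) = normalForm j' Φ' y :=
    congrArg (normalForm j' Φ') (e.symm_apply_apply y)
  have ψ_one : ψ 1 = 1 := by rw [← h.normalForm_counit, hψ, h'.normalForm_counit]
  have surjective (x : B) : ∃ y, normalForm j Φ y = x := e.surjective x
  have ψ_j_mul (f x) : ψ (j f * x) = j' f * ψ x := by
    obtain ⟨y, rfl⟩ := surjective x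
    obtain ⟨z, hz, hz'⟩ := (h.exists_generator_mul_normalForm h' y).1 f
    rw [hz, hψ, hψ, hz']
  have ψ_component_mul (π : Module.Dual ℂ G) (x) :
      ψ (component π (Φ : G ⊗[ℂ] B) * x) = component π (Φ' : G ⊗[ℂ] B') * ψ x := by
    obtain ⟨y, rfl⟩ := surjective x
    obtain ⟨z, hz, hz'⟩ := (h.exists_generator_mul_normalForm h' y).2 π
    rw [hz, hψ, hψ, hz']
  have ψ_j (f) : ψ (j f) = j' f := by simpa only [mul_one, ψ_one] using ψ_j_mul f 1
  have ψ_component (π : Module.Dual ℂ G) :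
      ψ (component π (Φ : G ⊗[ℂ] B)) = component π (Φ' : G ⊗[ℂ] B') := by
    simpa only [mul_one, ψ_one] using ψ_component_mul π 1
  have ψ_mul : ∀ x ∈ generators j Φ, ∀ y, ψ (x * y) = ψ x * ψ y := by
    rintro _ (⟨f, rfl⟩ | ⟨π, rfl⟩) y
    · rw [ψ_j_mul, ψ_j]
    · rw [ψ_component_mul, ψ_component]
  refine ⟨AlgHom.ofLinearMap ψ ψ_one (map_mul_of_adjoin_eq_top hgen ψ_one ψ_mul),
    AlgHom.ext ψ_j, ext_component fun π => ?_⟩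
  rw [component_mapSnd]
  exact ψ_component π

theorem isAlgebraOfRelations (h : SolvesRelations F σ j Φ)
    (hgen : Algebra.adjoin ℂ (generators j Φ) = ⊤)
    (hdim : Module.finrank ℂ (Center G) * Module.finrank ℂ G ≤ Module.finrank ℂ B) :
    IsAlgebraOfRelations.{_, u₄} F σ j Φ where
  solves := h
  generated := hgen
  universal B' _ _ j' Φ' h' := by
    obtain ⟨ψ, ψ_j, ψ_Φ⟩ := h.exists_algHom hgen hdim h'
    refine ⟨ψ, ⟨ψ_j, ψ_Φ⟩, ?_⟩
    rintro φ ⟨φ_j, φ_Φ⟩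
    refine AlgHom.ext_of_adjoin_eq_top hgen ?_
    rintro _ (⟨f, rfl⟩ | ⟨π, rfl⟩)
    · exact DFunLike.congr_fun (φ_j.trans ψ_j.symm) f
    · change φ (component π _) = ψ (component π _)
      rw [← component_mapSnd, φ_Φ, ← ψ_Φ, component_mapSnd]

end SolvesRelations

end NormalForm

/-! ### Irreducibility -/

section DimensionBound

variable {G : Type*} [Ring G] [HopfAlgebra ℂ G] {W : Type*} [AddCommGroup W] [Module ℂ W]

/-- The action of `G ⊗ End(W)` on `G ⊗ W`, with `G` acting on itself by left multiplication. -/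
def tensorAct : G ⊗[ℂ] Module.End ℂ W →ₐ[ℂ] Module.End ℂ (G ⊗[ℂ] W) :=
  (Module.endTensorEndAlgHom (R := ℂ) (A := ℂ)).comp
    (Algebra.TensorProduct.map (Algebra.lmul ℂ G) (AlgHom.id ℂ (Module.End ℂ W)))

@[simp] lemma tensorAct_tmul (g h : G) (T : Module.End ℂ W) (w : W) :
    tensorAct (g ⊗ₜ[ℂ] T) (h ⊗ₜ[ℂ] w) = (g * h) ⊗ₜ[ℂ] T w := by
  simp [tensorAct, Module.endTensorEndAlgHom_apply]

variable {ι : G →ₐ[ℂ] Module.End ℂ W} {Λ : G}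

lemma IsIntegral.range_tensorAct_comul_le (hΛ : IsIntegral Λ)
    (hS : Function.Surjective (antipode ℂ (A := G))) :
    LinearMap.range (tensorAct (mapSnd ι (flip (comul (R := ℂ) Λ)))) ≤
      LinearMap.range ((tensorAct (mapSnd ι (flip (comul (R := ℂ) Λ)))).comp
        (TensorProduct.mk ℂ G W 1)) := by
  rintro _ ⟨z, rfl⟩
  induction z with
  | zero => simp
  | tmul g w =>
    obtain ⟨h, rfl⟩ := hS g
    refine ⟨ι h w, ?_⟩
    have := congrArg (fun x => tensorAct (mapSnd ι (flip x)) (1 ⊗ₜ[ℂ] w))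
      (hΛ.comul_mul_tmul_one h)
    simpa using this
  | add a b ha hb =>
    rw [map_add]
    exact Submodule.add_mem _ ha hb

variable {Φ : (G ⊗[ℂ] Module.End ℂ W)ˣ}

lemma IsIntegral.map_ne_zero [Nontrivial W] (hΛ : IsIntegral Λ)
    (hcov : ∀ ξ : G, ((1 : G) ⊗ₜ[ℂ] ι ξ) * (Φ : G ⊗[ℂ] Module.End ℂ W) =
      (Φ : G ⊗[ℂ] Module.End ℂ W) * mapSnd ι (flip (comul (R := ℂ) ξ))) : ι Λ ≠ 0 := by
  intro ι_Λ
  have map_comul_eq_zero : mapSnd ι (flip (comul (R := ℂ) Λ)) = 0 := by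
    apply Φ.isUnit.mul_left_cancel
    rw [← hcov, ι_Λ, TensorProduct.tmul_zero, zero_mul, mul_zero]
  let t : G ⊗[ℂ] Module.End ℂ W →ₗ[ℂ] Module.End ℂ W :=
    TensorProduct.lift ((LinearMap.mul ℂ (Module.End ℂ W)).flip.comp
      (ι.toLinearMap.comp (antipode ℂ)))
  have t_map (x : G ⊗[ℂ] G) : t (mapSnd ι (flip x)) = ι (mulAntipode x) := by
    induction x <;> simp_all [t]
  have := t_map (comul (R := ℂ) Λ)
  rw [map_comul_eq_zero, map_zero, hΛ.mulAntipode_comul_eq_one, map_one] at this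
  exact zero_ne_one this

theorem finrank_le_of_covariant [FiniteDimensional ℂ G] [FiniteDimensional ℂ W] [Nontrivial W]
    (hS : Function.Surjective (antipode ℂ (A := G))) (hΛ : IsIntegral Λ)
    (hcov : ∀ ξ : G, ((1 : G) ⊗ₜ[ℂ] ι ξ) * (Φ : G ⊗[ℂ] Module.End ℂ W) =
      (Φ : G ⊗[ℂ] Module.End ℂ W) * mapSnd ι (flip (comul (R := ℂ) ξ))) :
    Module.finrank ℂ G ≤ Module.finrank ℂ W := by
  obtain ⟨w, hw⟩ := DFunLike.ne_iff.1 (hΛ.map_ne_zero hcov)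
  set K := LinearMap.range (tensorAct (mapSnd ι (flip (comul (R := ℂ) Λ))))
  let q : G →ₗ[ℂ] G ⊗[ℂ] W := (TensorProduct.mk ℂ G W).flip (ι Λ w)
  have q_injective : Function.Injective q := by
    obtain ⟨f, hf⟩ := Module.Projective.exists_dual_eq_one ℂ hw
    have : Function.LeftInverse (TensorProduct.rid ℂ G ∘ f.lTensor G) q := fun g => by
      simp [q, hf]
    exact this.injective
  have range_q_le : LinearMap.range q ≤ K.map (tensorAct (Φ : G ⊗[ℂ] Module.End ℂ W)) := by
    rintro _ ⟨g, rfl⟩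
    let x := tensorAct ((Φ⁻¹ : (G ⊗[ℂ] Module.End ℂ W)ˣ) : G ⊗[ℂ] Module.End ℂ W) (g ⊗ₜ[ℂ] w)
    refine ⟨_, ⟨x, rfl⟩, ?_⟩
    rw [← Module.End.mul_apply, ← Module.End.mul_apply, ← map_mul, ← map_mul, ← hcov,
      mul_assoc, Units.mul_inv, mul_one, tensorAct_tmul, one_mul]
    rfl
  calc Module.finrank ℂ G = Module.finrank ℂ (LinearMap.range q) :=
        (LinearMap.finrank_range_of_inj q_injective).symm
    _ ≤ Module.finrank ℂ (K.map (tensorAct (Φ : G ⊗[ℂ] Module.End ℂ W))) :=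
        Submodule.finrank_mono range_q_le
    _ ≤ Module.finrank ℂ K := Submodule.finrank_map_le _ _
    _ ≤ Module.finrank ℂ W :=
        (Submodule.finrank_mono (hΛ.range_tensorAct_comul_le hS)).trans
          (LinearMap.finrank_range_le _)

end DimensionBound

section Regular

variable {G : Type*} [Ring G] [HopfAlgebra ℂ G]

lemma conv_mul (π φ : Module.Dual ℂ G) : conv π * conv φ = conv (conv π φ) := by
  ext χ h
  rw [Module.End.mul_apply, conv_apply, conv_apply, conv_apply, ← component_component_comulFirst,
    ← mapSnd_comul_comul, component_mapSnd, comulAlgHom_apply]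

lemma conv_counit : conv (counit : Module.Dual ℂ G) = 1 := by
  ext φ h
  rw [conv_apply, component_counit_comul, Module.End.one_apply]

/-- Right translation on linear forms, `(g φ)(h) = φ(h g)`. -/
def translate : G →ₐ[ℂ] Module.End ℂ (Module.Dual ℂ G) :=
  AlgHom.ofLinearMap
    (LinearMap.mk₂ ℂ (fun g φ => φ.comp (LinearMap.mulRight ℂ g))
      (by intros; ext; simp [mul_add]) (by intros; ext; simp)
      (by intros; ext; simp) (by intros; ext; simp))
    (by ext; simp) (by intros; ext; simp [mul_assoc])

lemma component_mul_tmul {X : Type*} [Ring X] [Algebra ℂ X] (π : Module.Dual ℂ G) (y : G ⊗[ℂ] X)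
    (a : G) (x : X) : component π (y * (a ⊗ₜ[ℂ] x)) =
      component (π.comp (LinearMap.mulRight ℂ a)) y * x := by
  induction y <;> simp_all [add_mul]

lemma antipode_rTensor_mul_of_leg1_mul_leg2 {X : Type*} [Ring X] [Algebra ℂ X] {x : G ⊗[ℂ] X}
    (hx : leg1 x * leg2 x = comulFirst x) :
    (antipode ℂ).rTensor X x * x = (1 : G) ⊗ₜ[ℂ] component counit x := by
  let t : G ⊗[ℂ] (G ⊗[ℂ] X) →ₗ[ℂ] G ⊗[ℂ] X :=
    (antipodeMul.rTensor X).comp (TensorProduct.assoc ℂ G G X).symm.toLinearMap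
  have t_leg1_mul_leg2 (x y) : t (leg1 x * leg2 y) = (antipode ℂ).rTensor X x * y := by
    induction x with
    | tmul a b => induction y <;> simp_all [t, mul_add, TensorProduct.tmul_add]
    | _ => simp_all [add_mul]
  have t_comulFirst (x) : t (comulFirst x) = (1 : G) ⊗ₜ[ℂ] component counit x := by
    induction x with
    | tmul a T =>
      have t_leg12_mul (z : G ⊗[ℂ] G) :
          t (leg12 z * ((1 : G) ⊗ₜ[ℂ] ((1 : G) ⊗ₜ[ℂ] T))) = antipodeMul z ⊗ₜ[ℂ] T := by
        induction z <;> simp_all [t, add_mul, TensorProduct.add_tmul]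
      rw [comulFirst_tmul, t_leg12_mul, antipodeMul_comul, component_tmul, TensorProduct.smul_tmul]
    | _ => simp_all [TensorProduct.tmul_add]
  rw [← t_leg1_mul_leg2, hx, t_comulFirst]

lemma isUnit_of_leg1_mul_leg2 [FiniteDimensional ℂ G] {X : Type*} [Ring X] [Algebra ℂ X]
    [FiniteDimensional ℂ X] {x : G ⊗[ℂ] X} (hx : leg1 x * leg2 x = comulFirst x)
    (counit_x : component counit x = 1) : IsUnit x := by
  have : IsArtinianRing (G ⊗[ℂ] X) := IsArtinianRing.of_finite ℂ _
  refine .of_mul_eq_one_right ((antipode ℂ).rTensor X x) ?_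
  rw [antipode_rTensor_mul_of_leg1_mul_leg2 hx, counit_x, Algebra.TensorProduct.one_def]

section Center

variable [StarRing G] [StarModule ℂ G]

variable (G) in
/-- The algebra homomorphism `g ⊗ c ↦ ε(c) g`. -/
def evalCenter : G ⊗[ℂ] Center G →ₐ[ℂ] G :=
  (Algebra.TensorProduct.rid ℂ ℂ G).toAlgHom.comp (Algebra.TensorProduct.map (AlgHom.id ℂ G)
    ((Bialgebra.counitAlgHom ℂ G).comp (Center G).toSubalgebra.val))

@[simp] lemma evalCenter_tmul (g : G) (c : Center G) :
    evalCenter G (g ⊗ₜ[ℂ] c) = counit (R := ℂ) (c : G) • g := by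
  simp [evalCenter]

lemma mapSnd_evalCenter_comulFirst (y : G ⊗[ℂ] Center G) :
    mapSnd (evalCenter G) (comulFirst y) = comul (R := ℂ) (evalCenter G y) := by
  induction y with
  | tmul a b =>
    rw [comulFirst_tmul, evalCenter_tmul, map_smul]
    induction comul (R := ℂ) a <;> simp_all [add_mul]
  | _ => simp_all

end Center

variable [FiniteDimensional ℂ G]

variable (G) in
/-- The canonical element `∑ bᵢ ⊗ bⁱ` of `G ⊗ G'`, with the dual `G'` acting on itself by
convolution. -/
def canonicalElt : G ⊗[ℂ] Module.End ℂ (Module.Dual ℂ G) :=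
  ∑ i, Module.finBasis ℂ G i ⊗ₜ[ℂ] conv ((Module.finBasis ℂ G).coord i)

lemma component_canonicalElt (π : Module.Dual ℂ G) : component π (canonicalElt G) = conv π := by
  rw [canonicalElt, map_sum]
  simp only [component_tmul, ← map_smul, ← map_sum]
  congr 1
  exact (Module.finBasis ℂ G).ext fun k => by simp

lemma leg1_mul_leg2_canonicalElt :
    leg1 (canonicalElt G) * leg2 (canonicalElt G) = comulFirst (canonicalElt G) := by
  refine ext_component fun φ => ext_component fun π => ?_
  rw [component_component_comulFirst, leg2_apply, component_mul_one_tmul, component_leg1,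
    component_one_tmul_mul]
  simp only [component_canonicalElt, conv_mul]

lemma one_tmul_translate_mul_canonicalElt (g : G) :
    ((1 : G) ⊗ₜ[ℂ] translate g) * canonicalElt G =
      canonicalElt G * mapSnd translate (comul (R := ℂ) g) := by
  refine ext_component fun π => LinearMap.ext fun φ => LinearMap.ext fun h => ?_
  have component_canonicalElt_mul (x : G ⊗[ℂ] G) :
      component π (canonicalElt G * mapSnd translate x) φ h =
        φ (component π (comul (R := ℂ) h * x)) := by
    induction x with
    | tmul a b =>
      rw [mapSnd_tmul, component_mul_tmul, component_canonicalElt, component_mul_tmul,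
        Module.End.mul_apply, conv_apply]
      rfl
    | _ => simp_all [mul_add]
  rw [component_canonicalElt_mul, ← Bialgebra.comul_mul, component_one_tmul_mul,
    component_canonicalElt]
  exact conv_apply π φ (h * g)

lemma isUnit_canonicalElt : IsUnit (canonicalElt G) :=
  isUnit_of_leg1_mul_leg2 leg1_mul_leg2_canonicalElt <| by
    rw [component_canonicalElt, conv_counit]

variable (G) in
/-- The canonical element as a unit. -/
def canonicalUnit : (G ⊗[ℂ] Module.End ℂ (Module.Dual ℂ G))ˣ :=
  isUnit_canonicalElt.unit

variable [StarRing G] [StarModule ℂ G]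

variable (G) in
/-- The action of `G ⊗ 𝒞` on the dual of `G` by right translation of its first factor. -/
def regularAct : G ⊗[ℂ] Center G →ₐ[ℂ] Module.End ℂ (Module.Dual ℂ G) :=
  translate.comp (evalCenter G)

lemma semiconjBy_canonicalUnit (y : G ⊗[ℂ] Center G) :
    SemiconjBy (canonicalUnit G : G ⊗[ℂ] Module.End ℂ (Module.Dual ℂ G))
      (mapSnd (regularAct G) (comulFirst y)) ((1 : G) ⊗ₜ[ℂ] regularAct G y) := by
  have := (one_tmul_translate_mul_canonicalElt (evalCenter G y)).symm
  rwa [← mapSnd_evalCenter_comulFirst, mapSnd_mapSnd] at this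

lemma semiconjBy_leg2_canonicalUnit (y : G ⊗[ℂ] (G ⊗[ℂ] Center G)) :
    SemiconjBy (leg2 (canonicalUnit G : G ⊗[ℂ] Module.End ℂ (Module.Dual ℂ G)))
      (mapSnd (mapSnd (regularAct G)) (mapSnd comulFirst y))
      (leg1 (mapSnd (regularAct G) y)) := by
  induction y with
  | tmul a b => simp [SemiconjBy, (semiconjBy_canonicalUnit b).eq]
  | zero => simp
  | add y y' hy hy' => simpa only [map_add] using hy.add_right hy'

variable {𝓡 : RibbonStructure G} {F : (G ⊗[ℂ] (G ⊗[ℂ] Center G))ˣ}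
  {σ : Center G →ₐ[ℂ] G ⊗[ℂ] Center G}

/-- The value `F_p Θ⁻¹` of `Φ` in the solution on the dual of `G`, where `Θ` is the canonical
element and `F_p` is the image of `F` under the action of `𝒢_a ⊗ 𝒞`. -/
def regularSolution (F : (G ⊗[ℂ] (G ⊗[ℂ] Center G))ˣ) :
    (G ⊗[ℂ] Module.End ℂ (Module.Dual ℂ G))ˣ :=
  Units.map (mapSnd (G := G) (regularAct G)).toMonoidHom F * (canonicalUnit G)⁻¹

lemma StructureRelations.regularSolution_operatorProduct (hF : StructureRelations 𝓡 F σ) :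
    leg2 (regularSolution F : G ⊗[ℂ] Module.End ℂ (Module.Dual ℂ G)) *
        leg1 (regularSolution F : G ⊗[ℂ] Module.End ℂ (Module.Dual ℂ G)) =
      mapSnd (mapSnd ((regularAct G).comp σ)) (F : G ⊗[ℂ] (G ⊗[ℂ] Center G)) *
        comulFirst (regularSolution F : G ⊗[ℂ] Module.End ℂ (Module.Dual ℂ G)) := by
  let l₁ := Units.map (leg1 (G := G) (X := Module.End ℂ (Module.Dual ℂ G))).toMonoidHom
  let l₂ := Units.map (leg2 (G := G) (X := Module.End ℂ (Module.Dual ℂ G))).toMonoidHom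
  let l₁₂ := Units.map (comulFirst (G := G) (X := Module.End ℂ (Module.Dual ℂ G))).toMonoidHom
  let Θ := canonicalUnit G
  let Fp := Units.map (mapSnd (G := G) (regularAct G)).toMonoidHom F
  let Fσ := Units.map (mapSnd (G := G) (mapSnd (G := G) ((regularAct G).comp σ))).toMonoidHom F
  let FΔ := Units.map ((mapSnd (G := G) (mapSnd (G := G) (regularAct G))).comp
    (mapSnd (G := G) comulFirst)).toMonoidHom F
  have shift : l₂ Θ * FΔ = l₁ Fp * l₂ Θ := Units.ext (semiconjBy_leg2_canonicalUnit _)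
  have coproduct : l₁ Θ * l₂ Θ = l₁₂ Θ := Units.ext leg1_mul_leg2_canonicalElt
  have cocycle : l₂ Fp * FΔ = Fσ * l₁₂ Fp := by
    have := congrArg (mapSnd (G := G) (mapSnd (G := G) (regularAct G))) hF.cocycle
    rw [map_mul, map_mul, mapSnd_leg2, mapSnd_comulFirst, mapSnd_mapSnd (mapSnd σ),
      mapSnd_comp_mapSnd] at this
    exact Units.ext this
  suffices l₂ (Fp * Θ⁻¹) * l₁ (Fp * Θ⁻¹) = Fσ * l₁₂ (Fp * Θ⁻¹) from congrArg Units.val this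
  calc l₂ (Fp * Θ⁻¹) * l₁ (Fp * Θ⁻¹)
      = l₂ Fp * (l₂ Θ)⁻¹ * (l₁ Fp * l₂ Θ) * (l₂ Θ)⁻¹ * (l₁ Θ)⁻¹ := by simp [mul_assoc]
    _ = l₂ Fp * FΔ * (l₁ Θ * l₂ Θ)⁻¹ := by simp [← shift, mul_assoc]
    _ = Fσ * l₁₂ (Fp * Θ⁻¹) := by simp [cocycle, coproduct, mul_assoc]

lemma StructureRelations.regularSolution_exchange (hF : StructureRelations 𝓡 F σ) (f : Center G) :
    SemiconjBy (regularSolution F : G ⊗[ℂ] Module.End ℂ (Module.Dual ℂ G))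
      ((1 : G) ⊗ₜ[ℂ] regularAct G (σ f)) (mapSnd ((regularAct G).comp σ) (σ f)) := by
  refine SemiconjBy.mul_left ?_ (semiconjBy_canonicalUnit (σ f)).units_inv_symm_left
  have : SemiconjBy (F : G ⊗[ℂ] (G ⊗[ℂ] Center G)) (comulFirst (σ f)) (mapSnd σ (σ f)) := by
    rw [SemiconjBy, hF.σ_σ, comulFFirst, Units.inv_mul_cancel_right]
  have := this.map (mapSnd (G := G) (regularAct G))
  rwa [mapSnd_mapSnd] at this

lemma StructureRelations.regularSolution_solves (hF : StructureRelations 𝓡 F σ) :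
    SolvesRelations F σ ((regularAct G).comp σ) (regularSolution F) where
  operatorProduct := hF.regularSolution_operatorProduct
  exchange f := (hF.regularSolution_exchange f).eq

end Regular

section Irreducibility

lemma subalgebra_eq_top_of_irreducible {W : Type*} [AddCommGroup W] [Module ℂ W]
    [FiniteDimensional ℂ W] [Nontrivial W] (A : Subalgebra ℂ (Module.End ℂ W))
    (hA : ∀ U : Submodule ℂ W, (∀ a ∈ A, ∀ x ∈ U, a x ∈ U) → U = ⊥ ∨ U = ⊤) : A = ⊤ := by
  have simple : IsSimpleModule A W := by
    rw [isSimpleModule_iff]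
    refine { eq_bot_or_eq_top := fun U => ?_ }
    simpa only [Submodule.restrictScalars_eq_bot_iff, Submodule.restrictScalars_eq_top_iff] using
      hA (U.restrictScalars ℂ) fun a ha x hx => U.smul_mem ⟨a, ha⟩ hx
  rw [eq_top_iff]
  intro T _
  -- By Schur's lemma `T` commutes with every `A`-linear map, so the density theorem applies to it.
  let T' : Module.End (Module.End A W) W :=
    { toFun := T
      map_add' := T.map_add
      map_smul' := fun φ x => by
        obtain ⟨c, rfl⟩ :=
          (IsSimpleModule.algebraMap_end_bijective_of_isAlgClosed (A := A) (V := W) ℂ).2 φ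
        exact T.map_smul c x }
  classical
  let b := Module.finBasis ℂ W
  obtain ⟨r, hr⟩ := jacobson_density (R := A) T' (Finset.univ.image b)
  have : T = r := b.ext fun i => hr (b i) (by simp)
  exact this ▸ r.2

/-- The action of a subalgebra of `End(W)` on an invariant subspace. -/
def restrictAct {W : Type*} [AddCommGroup W] [Module ℂ W] (A : Subalgebra ℂ (Module.End ℂ W))
    (U : Submodule ℂ W) (hU : ∀ a ∈ A, ∀ x ∈ U, a x ∈ U) : A →ₐ[ℂ] Module.End ℂ U where
  toFun a := (a : Module.End ℂ W).restrict (hU a a.2)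
  map_one' := rfl
  map_mul' _ _ := rfl
  map_zero' := rfl
  map_add' _ _ := rfl
  commutes' _ := rfl

variable {G : Type*} [Ring G] [HopfAlgebra ℂ G] [StarRing G] [StarModule ℂ G]
  [FiniteDimensional ℂ G] {𝓡 : RibbonStructure G} {F : (G ⊗[ℂ] (G ⊗[ℂ] Center G))ˣ}
  {σ : Center G →ₐ[ℂ] G ⊗[ℂ] Center G}

theorem SolvesRelations.adjoin_eq_top {W : Type*} [AddCommGroup W] [Module ℂ W]
    [FiniteDimensional ℂ W] [Nontrivial W] {j : Center G →ₐ[ℂ] Module.End ℂ W}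
    {Φ : (G ⊗[ℂ] Module.End ℂ W)ˣ} (h : SolvesRelations F σ j Φ)
    (hF : StructureRelations 𝓡 F σ)
    (hN : Function.Surjective (rightComponents (𝓡.N : G ⊗[ℂ] G)))
    (hS : Function.Surjective (antipode ℂ (A := G))) {Λ : G} (hΛ : IsIntegral Λ)
    (hW : Module.finrank ℂ W ≤ Module.finrank ℂ G) :
    Algebra.adjoin ℂ (generators j Φ) = ⊤ := by
  refine subalgebra_eq_top_of_irreducible _ fun U hU => or_iff_not_imp_left.2 fun hbot => ?_
  have : Nontrivial U := Submodule.nontrivial_iff_ne_bot.2 hbot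
  obtain ⟨jA, ΦA, hA⟩ := h.exists_restrict
  obtain ⟨ι, hι⟩ := (hA.map (restrictAct _ U hU)).exists_isMonodromyAction hF hN
  refine Submodule.eq_top_of_finrank_eq (le_antisymm (Submodule.finrank_le U) ?_)
  exact hW.trans (finrank_le_of_covariant hS hΛ hι.covariance)

theorem StructureRelations.mul_comm (hF : StructureRelations 𝓡 F σ)
    (hN : Function.Surjective (rightComponents (𝓡.N : G ⊗[ℂ] G)))
    (hS : Function.Surjective (antipode ℂ (A := G))) {Λ : G} (hΛ : IsIntegral Λ) (x y : G) :
    x * y = y * x := by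
  have := nontrivial_of_hopfAlgebra G
  have finrank_dual : Module.finrank ℂ (Module.Dual ℂ G) = Module.finrank ℂ G :=
    Subspace.dual_finrank_eq
  have adjoin_eq_top := hF.regularSolution_solves.adjoin_eq_top hF hN hS hΛ finrank_dual.le
  have finrank_mul_le := hF.regularSolution_solves.finrank_adjoin_le
  rw [adjoin_eq_top, subalgebra_top_finrank_eq_submodule_top_finrank, finrank_top,
    Module.finrank_linearMap, finrank_dual] at finrank_mul_le
  have center_eq_top : Subalgebra.toSubmodule (Center G).toSubalgebra = ⊤ :=
    Submodule.eq_top_of_finrank_eq (le_antisymm (Submodule.finrank_le _)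
      (Nat.le_of_mul_le_mul_right finrank_mul_le Module.finrank_pos))
  have hx : x ∈ Subalgebra.toSubmodule (Center G).toSubalgebra := center_eq_top ▸ trivial
  exact ((Subalgebra.mem_center_iff (R := ℂ)).1 hx y).symm

end Irreducibility

/-! ### Characters -/

section CharacterProducts

variable {G : Type*} [Ring G] [HopfAlgebra ℂ G] {X : Type*} [Ring X] [Algebra ℂ X]

/-- The product of two characters in the convolution algebra dual to `G`. -/
def charMul (χ ψ : G →ₐ[ℂ] ℂ) : G →ₐ[ℂ] ℂ :=
  ψ.comp ((evalFirst χ).comp (comulAlgHom ℂ G))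

lemma charMul_apply (χ ψ : G →ₐ[ℂ] ℂ) (g : G) :
    charMul χ ψ g = ψ (evalFirst χ (comul (R := ℂ) g)) := rfl

lemma evalFirst_evalFirst_comulFirst (χ ψ : G →ₐ[ℂ] ℂ) (y : G ⊗[ℂ] X) :
    evalFirst ψ (evalFirst χ (comulFirst y)) = evalFirst (charMul χ ψ) y := by
  induction y with
  | tmul a b =>
    rw [comulFirst_tmul, map_mul, map_mul, evalFirst_leg12, evalFirst_tmul, evalFirst_tmul]
    simp [charMul_apply]
  | _ => simp_all

lemma evalFirst_star [StarRing G] [StarModule ℂ G] [StarRing X] [StarModule ℂ X]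
    {χ : G →ₐ[ℂ] ℂ} (hχ : ∀ g, χ (star g) = star (χ g)) (y : G ⊗[ℂ] X) :
    evalFirst χ (star y) = star (evalFirst χ y) := by
  induction y <;> simp_all [TensorProduct.star_tmul]

lemma apply_evalFirst_flip (χ ψ : G →ₐ[ℂ] ℂ) (y : G ⊗[ℂ] G) :
    ψ (evalFirst χ (flip y)) = χ (evalFirst ψ y) := by
  induction y <;> simp_all [mul_comm]

lemma apply_rightComponent (φ : G →ₐ[ℂ] ℂ) (π : Module.Dual ℂ G) (y : G ⊗[ℂ] G) :
    φ (rightComponent π y) = π (evalFirst φ y) := by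
  induction y <;> simp_all [mul_comm]

end CharacterProducts

/-- The `χ i` are all the characters of `G`; they separate the points of `G` and respect `*`. -/
structure IsCharacterSystem {G : Type*} [Ring G] [HopfAlgebra ℂ G] [StarRing G] {I : Type*}
    (χ : I → G →ₐ[ℂ] ℂ) : Prop where
  bijective : Function.Bijective χ
  separating : ∀ x : G, (∀ i, χ i x = 0) → x = 0
  apply_star : ∀ i g, χ i (star g) = star (χ i g)

namespace IsCharacterSystem

variable {G : Type*} [Ring G] [HopfAlgebra ℂ G] [StarRing G] {I : Type*} {χ : I → G →ₐ[ℂ] ℂ}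

lemma ext_apply (hχ : IsCharacterSystem χ) {x y : G} (h : ∀ i, χ i x = χ i y) : x = y :=
  sub_eq_zero.1 (hχ.separating _ fun i => by rw [map_sub, h, sub_self])

lemma exists_eq (hχ : IsCharacterSystem χ) (φ : G →ₐ[ℂ] ℂ) : ∃ i, χ i = φ := hχ.bijective.2 φ

lemma nonempty (hχ : IsCharacterSystem χ) : Nonempty I :=
  ⟨(hχ.exists_eq (counitAlgHom ℂ G)).choose⟩

lemma mul_commute (hχ : IsCharacterSystem χ) (x y : G) : x * y = y * x :=
  hχ.ext_apply fun i => by rw [map_mul, map_mul, mul_comm]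

variable [FiniteDimensional ℂ G]

lemma card_eq [Fintype I] (hχ : IsCharacterSystem χ) : Fintype.card I = Module.finrank ℂ G := by
  refine le_antisymm ?_ ?_
  · rw [← Nat.card_eq_fintype_card, Nat.card_congr (Equiv.ofBijective χ hχ.bijective)]
    exact card_algHom_le_finrank ℂ G ℂ
  · rw [← Module.finrank_fintype_fun_eq_card ℂ]
    exact LinearMap.finrank_le_finrank_of_injective
      (f := LinearMap.pi fun i => (χ i).toLinearMap)
      fun x y hxy => hχ.ext_apply fun i => congrFun hxy i

lemma exists_apply_eq [Finite I] (hχ : IsCharacterSystem χ) (c : I → ℂ) :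
    ∃ g : G, ∀ i, χ i g = c i := by
  cases nonempty_fintype I
  let values : G →ₗ[ℂ] (I → ℂ) := LinearMap.pi fun i => (χ i).toLinearMap
  have values_injective : Function.Injective values :=
    fun x y hxy => hχ.ext_apply fun i => congrFun hxy i
  have values_surjective := (LinearMap.injective_iff_surjective_of_finrank_eq_finrank
    (by rw [Module.finrank_fintype_fun_eq_card, hχ.card_eq])).1 values_injective
  obtain ⟨g, hg⟩ := values_surjective c
  exact ⟨g, congrFun hg⟩

lemma exists_eq_sum_smul [Fintype I] (hχ : IsCharacterSystem χ) (π : Module.Dual ℂ G) :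
    ∃ c : I → ℂ, π = ∑ i, c i • (χ i).toLinearMap := by
  classical
  choose e he using fun k : I => hχ.exists_apply_eq (fun i => if i = k then 1 else 0)
  refine ⟨fun k => π (e k), LinearMap.ext fun g => ?_⟩
  have hg : g = ∑ k, χ k g • e k := hχ.ext_apply fun i => by simp [map_sum, he]
  conv_lhs => rw [hg]
  simp [mul_comm]

lemma ext_evalFirst [Finite I] {X : Type*} [Ring X] [Algebra ℂ X] (hχ : IsCharacterSystem χ)
    {y z : G ⊗[ℂ] X} (h : ∀ i, evalFirst (χ i) y = evalFirst (χ i) z) : y = z := by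
  cases nonempty_fintype I
  have component_sum (c : I → ℂ) (w : G ⊗[ℂ] X) :
      component (∑ i, c i • (χ i).toLinearMap) w = ∑ i, c i • evalFirst (χ i) w := by
    induction w <;> simp_all [Finset.sum_smul, smul_smul, Finset.sum_add_distrib]
  refine ext_component fun π => ?_
  obtain ⟨c, rfl⟩ := hχ.exists_eq_sum_smul π
  simp only [component_sum, h]

end IsCharacterSystem

lemma exists_algHom_forall_eq_smul_one {A B : Type*} [Ring A] [Algebra ℂ A] [Ring B]
    [Algebra ℂ B] [Nontrivial B] (f : A →ₐ[ℂ] B) (hf : ∀ a, ∃ c : ℂ, f a = c • 1) :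
    ∃ χ : A →ₐ[ℂ] ℂ, ∀ a, f a = χ a • 1 := by
  have mem_bot (a : A) : f a ∈ (⊥ : Subalgebra ℂ B) := by
    obtain ⟨c, hc⟩ := hf a
    exact Algebra.mem_bot.2 ⟨c, by rw [hc, Algebra.algebraMap_eq_smul_one]⟩
  refine ⟨(Algebra.botEquiv ℂ B : (⊥ : Subalgebra ℂ B) →ₐ[ℂ] ℂ).comp (f.codRestrict ⊥ mem_bot),
    fun a => ?_⟩
  obtain ⟨c, hc⟩ := hf a
  have codRestrict_eq :
      f.codRestrict ⊥ mem_bot a = algebraMap ℂ (⊥ : Subalgebra ℂ B) c :=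
    Subtype.ext (hc.trans (Algebra.algebraMap_eq_smul_one c).symm)
  simp [codRestrict_eq, hc]

namespace IsIrrepSystem

variable {G : Type u₁} [Ring G] [HopfAlgebra ℂ G] [StarRing G]
  {I : Type u₂} {V : I → Type u₃}
  [∀ i, NormedAddCommGroup (V i)] [∀ i, InnerProductSpace ℂ (V i)]
  [∀ i, FiniteDimensional ℂ (V i)] [∀ i, CompleteSpace (V i)]
  {τ : ∀ i, G →⋆ₐ[ℂ] (V i →L[ℂ] V i)}

lemma finrank_eq_one (hτ : IsIrrepSystem τ) (hcomm : ∀ x y : G, x * y = y * x) (i : I) :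
    Module.finrank ℂ (V i) = 1 := by
  have := hτ.nontrivial i
  obtain ⟨x, hx⟩ := exists_ne (0 : V i)
  rw [finrank_eq_one_iff_of_nonzero x hx]
  refine (hτ.irreducible i (Submodule.span ℂ {x}) fun ξ y hy => ?_).resolve_left
    fun h => hx (Submodule.span_singleton_eq_bot.1 h)
  obtain ⟨c, hc⟩ := hτ.exists_smul_of_central (hcomm ξ) i
  rw [hc]
  exact Submodule.smul_mem _ _ hy

lemma exists_characters [Finite I] [FiniteDimensional ℂ G] [IsSemisimpleRing G]
    (hτ : IsIrrepSystem τ) (hcomm : ∀ x y : G, x * y = y * x) :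
    ∃ χ : I → G →ₐ[ℂ] ℂ, IsCharacterSystem χ ∧ ∀ i g, τ i g = χ i g • 1 := by
  cases nonempty_fintype I
  have := hτ.nontrivial
  choose χ hχ using fun i => exists_algHom_forall_eq_smul_one (τ i : G →ₐ[ℂ] (V i →L[ℂ] V i))
    fun g => hτ.exists_smul_of_central (hcomm g) i
  change ∀ i g, τ i g = χ i g • 1 at hχ
  have separating (x : G) (hx : ∀ i, χ i x = 0) : x = 0 :=
    hτ.faithful fun i => by rw [hχ, hx, zero_smul]
  have injective : Function.Injective χ := fun i k hik =>
    hτ.inequivalent i k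
      (LinearEquiv.ofFinrankEq _ _ ((hτ.finrank_eq_one hcomm i).trans
        (hτ.finrank_eq_one hcomm k).symm))
      fun ξ x => by simp [hχ, hik]
  have finrank_le : Module.finrank ℂ G ≤ Nat.card I := by
    rw [Nat.card_eq_fintype_card, ← Module.finrank_fintype_fun_eq_card ℂ]
    refine LinearMap.finrank_le_finrank_of_injective
      (f := LinearMap.pi fun i => (χ i).toLinearMap) ((injective_iff_map_eq_zero _).2 ?_)
    exact fun x hx => separating x (congrFun hx)
  refine ⟨χ, ⟨injective.bijective_of_nat_card_le
    ((card_algHom_le_finrank ℂ G ℂ).trans finrank_le), separating, fun i g => ?_⟩, hχ⟩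
  refine smul_left_injective ℂ (one_ne_zero (α := V i →L[ℂ] V i)) ?_
  change χ i (star g) • (1 : V i →L[ℂ] V i) = star (χ i g) • 1
  rw [← hχ, map_star, hχ, star_smul, star_one]

end IsIrrepSystem

/-! ### Unitarity on characters -/

lemma RibbonStructure.κκ_val {G : Type*} [Ring G] [HopfAlgebra ℂ G] [StarRing G] [StarModule ℂ G]
    (𝓡 : RibbonStructure G) : (𝓡.κκ : G ⊗[ℂ] G) = (𝓡.κ : G) ⊗ₜ[ℂ] (𝓡.κ : G) := by
  simp [RibbonStructure.κκ]

lemma norm_eq_one_of_star_mul_self {z : ℂ} (h : star z * z = 1) : ‖z‖ = 1 := by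
  have norm_mul_self : ‖z‖ * ‖z‖ = 1 := by
    simpa only [norm_mul, norm_star, norm_one] using congrArg norm h
  nlinarith [norm_nonneg z]

namespace IsCharacterSystem

variable {G : Type*} [Ring G] [HopfAlgebra ℂ G] [StarRing G] [StarModule ℂ G]
  {F : (G ⊗[ℂ] (G ⊗[ℂ] Center G))ˣ} {σ : Center G →ₐ[ℂ] G ⊗[ℂ] Center G}
  {I : Type*} {χ : I → G →ₐ[ℂ] ℂ}

lemma norm_κ (hχ : IsCharacterSystem χ) (𝓡 : RibbonStructure G) (a : I) :
    ‖χ a (𝓡.κ : G)‖ = 1 := by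
  have norm_v : ‖χ a (𝓡.v : G)‖ = 1 := by
    apply norm_eq_one_of_star_mul_self
    rw [← hχ.apply_star, 𝓡.star_v, ← map_mul, Units.inv_mul, map_one]
  rw [← 𝓡.κ_sq, map_pow, norm_pow] at norm_v
  exact (pow_eq_one_iff_of_nonneg (norm_nonneg _) two_ne_zero).1 norm_v

lemma norm_R_mul_norm_R (hχ : IsCharacterSystem χ) (𝓡 : RibbonStructure G) (a b : I) :
    ‖χ b (evalFirst (χ a) (𝓡.R : G ⊗[ℂ] G))‖ *
      ‖χ a (evalFirst (χ b) (𝓡.R : G ⊗[ℂ] G))‖ = 1 := by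
  have star_mul : star (χ b (evalFirst (χ a) (𝓡.R : G ⊗[ℂ] G))) *
      χ a (evalFirst (χ b) (𝓡.R : G ⊗[ℂ] G)) = 1 := by
    rw [← hχ.apply_star, ← evalFirst_star (hχ.apply_star a), 𝓡.star_R,
      apply_evalFirst_flip, ← map_mul, ← map_mul, Units.inv_mul, map_one, map_one]
  rw [← norm_star, ← norm_mul, star_mul, norm_one]

lemma apply_evalFirst_charMul_R (𝓡 : RibbonStructure G) (φ ψ θ : G →ₐ[ℂ] ℂ) :
    θ (evalFirst (charMul φ ψ) (𝓡.R : G ⊗[ℂ] G)) =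
      θ (evalFirst φ (𝓡.R : G ⊗[ℂ] G)) * θ (evalFirst ψ (𝓡.R : G ⊗[ℂ] G)) := by
  rw [← evalFirst_evalFirst_comulFirst, 𝓡.comul_id_R, map_mul, map_mul, evalFirst_leg1,
    leg2_apply]
  simp

variable [Finite I]

-- A maximal value `r` of `‖χ b (χ a ⊗ id)(R)‖` is positive and has `r² ≤ r`, since `R` is
-- multiplicative in its first leg.
lemma norm_R_le_one (hχ : IsCharacterSystem χ) (𝓡 : RibbonStructure G) (a b : I) :
    ‖χ b (evalFirst (χ a) (𝓡.R : G ⊗[ℂ] G))‖ ≤ 1 := by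
  have := hχ.nonempty
  obtain ⟨⟨c, d⟩, hmax⟩ := Finite.exists_max
    fun p : I × I => ‖χ p.2 (evalFirst (χ p.1) (𝓡.R : G ⊗[ℂ] G))‖
  refine (hmax (a, b)).trans ?_
  obtain ⟨e, he⟩ := hχ.exists_eq (charMul (χ c) (χ c))
  have sq_le := hmax (e, d)
  simp only [he, apply_evalFirst_charMul_R, norm_mul] at sq_le
  have max_pos : 0 < ‖χ d (evalFirst (χ c) (𝓡.R : G ⊗[ℂ] G))‖ :=
    (norm_nonneg _).lt_of_ne' (left_ne_zero_of_mul_eq_one (hχ.norm_R_mul_norm_R 𝓡 c d))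
  exact le_of_mul_le_mul_left (by rwa [mul_one]) max_pos

lemma norm_R (hχ : IsCharacterSystem χ) (𝓡 : RibbonStructure G) (a b : I) :
    ‖χ b (evalFirst (χ a) (𝓡.R : G ⊗[ℂ] G))‖ = 1 := by
  refine le_antisymm (hχ.norm_R_le_one 𝓡 a b) ?_
  rw [← hχ.norm_R_mul_norm_R 𝓡 a b]
  exact mul_le_of_le_one_right (norm_nonneg _) (hχ.norm_R_le_one 𝓡 b a)

lemma norm_S (hχ : IsCharacterSystem χ) (𝓡 : RibbonStructure G) (a b : I) :
    ‖χ b (evalFirst (χ a) (𝓡.S : G ⊗[ℂ] G))‖ = 1 := by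
  have S_mul_κκ : (𝓡.S : G ⊗[ℂ] G) * ((𝓡.κ : G) ⊗ₜ[ℂ] (𝓡.κ : G)) =
      (𝓡.R : G ⊗[ℂ] G) * comul (R := ℂ) (𝓡.κ : G) := by
    have := congrArg Units.val (inv_mul_cancel_right
      (𝓡.R * Units.map (comulAlgHom ℂ G).toMonoidHom 𝓡.κ) 𝓡.κκ)
    rw [Units.val_mul, 𝓡.κκ_val] at this
    exact this
  have norm_apply := congrArg (fun y => ‖χ b (evalFirst (χ a) y)‖) S_mul_κκ
  obtain ⟨c, hc⟩ := hχ.exists_eq (charMul (χ a) (χ b))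
  simpa [hχ.norm_R 𝓡, hχ.norm_κ 𝓡, ← charMul_apply, ← hc] using norm_apply

omit [Finite I] in
lemma star_mul_evalFirst_F (hχ : IsCharacterSystem χ) {𝓡 : RibbonStructure G}
    (hF : StructureRelations 𝓡 F σ) (a b : I) :
    star (evalFirst (χ b) (evalFirst (χ a) (F : G ⊗[ℂ] (G ⊗[ℂ] Center G)))) *
      evalFirst (χ b) (evalFirst (χ a) (F : G ⊗[ℂ] (G ⊗[ℂ] Center G))) =
      χ b (evalFirst (χ a) (𝓡.S : G ⊗[ℂ] G)) • 1 := by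
  rw [← evalFirst_star (hχ.apply_star b), ← evalFirst_star (hχ.apply_star a), hF.star_F,
    map_mul, map_mul, mul_assoc, ← map_mul, ← map_mul, ← map_mul, Units.inv_mul, map_one, mul_one,
    evalFirst_leg12, evalFirst_tmul]

variable {𝓡 : RibbonStructure G}

-- The value has modulus one and, being of the form `star z * z`, is nonnegative.
lemma apply_S (hχ : IsCharacterSystem χ) (hF : StructureRelations 𝓡 F σ) (a b : I) :
    χ b (evalFirst (χ a) (𝓡.S : G ⊗[ℂ] G)) = 1 := by
  set f := evalFirst (χ b) (evalFirst (χ a) (F : G ⊗[ℂ] (G ⊗[ℂ] Center G))) with hf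
  have S_eq_star_mul : χ b (evalFirst (χ a) (𝓡.S : G ⊗[ℂ] G)) =
      star (χ a (f : G)) * χ a (f : G) := by
    have := congrArg (fun y : Center G => χ a (y : G)) (hχ.star_mul_evalFirst_F hF a b)
    rw [← hf] at this
    simpa [hχ.apply_star] using this.symm
  have norm_f : ‖χ a (f : G)‖ * ‖χ a (f : G)‖ = 1 := by
    rw [← hχ.norm_S 𝓡 a b, S_eq_star_mul, norm_mul, norm_star]
  rw [S_eq_star_mul, Complex.star_def, Complex.conj_mul', sq, ← Complex.ofReal_mul, norm_f,
    Complex.ofReal_one]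

lemma S_eq_one [FiniteDimensional ℂ G] (hχ : IsCharacterSystem χ)
    (hF : StructureRelations 𝓡 F σ) : 𝓡.S = 1 := by
  refine Units.ext (hχ.ext_evalFirst fun a => hχ.ext_apply fun b => ?_)
  rw [hχ.apply_S hF, Units.val_one, map_one, map_one]

lemma star_mul_evalFirst_F_eq_one (hχ : IsCharacterSystem χ) (hF : StructureRelations 𝓡 F σ)
    (a b : I) :
    star (evalFirst (χ b) (evalFirst (χ a) (F : G ⊗[ℂ] (G ⊗[ℂ] Center G)))) *
      evalFirst (χ b) (evalFirst (χ a) (F : G ⊗[ℂ] (G ⊗[ℂ] Center G))) = 1 := by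
  rw [hχ.star_mul_evalFirst_F hF, hχ.apply_S hF, one_smul]

end IsCharacterSystem

/-! ### The Gauss sum of the ribbon element -/

namespace IsCharacterSystem

variable {G : Type*} [Ring G] [HopfAlgebra ℂ G] [StarRing G]
  {I : Type*} {χ : I → G →ₐ[ℂ] ℂ}

lemma sum_evalFirst_comul [Fintype I] (hχ : IsCharacterSystem χ)
    (hinj : ∀ b, Function.Injective fun a => charMul (χ a) (χ b)) (x : G) :
    ∑ a, evalFirst (χ a) (comul (R := ℂ) x) = (∑ a, χ a x) • 1 := by
  refine hχ.ext_apply fun b => ?_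
  choose m hm using fun a => hχ.exists_eq (charMul (χ a) (χ b))
  have m_injective : Function.Injective m := fun a a' h => hinj b (by simp only [← hm, h])
  rw [map_sum, map_smul, map_one, smul_eq_mul, mul_one,
    ← (Finite.injective_iff_bijective.1 m_injective).sum_comp (fun a => χ a x)]
  exact Finset.sum_congr rfl fun a _ => by rw [hm, charMul_apply]

lemma N_eq_tmul_mul_comul [StarModule ℂ G] {𝓡 : RibbonStructure G}
    (hχ : IsCharacterSystem χ) : (𝓡.N : G ⊗[ℂ] G) =
    ((𝓡.v : G) ⊗ₜ[ℂ] (𝓡.v : G)) * comul (R := ℂ) ((𝓡.v⁻¹ : Gˣ) : G) := by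
  have mul_commute_tensor (y z : G ⊗[ℂ] G) : y * z = z * y := by
    induction y with
    | tmul a b => exact commute_tmul (hχ.mul_commute a) (hχ.mul_commute b) z
    | _ => simp_all [add_mul, mul_add]
  rw [← 𝓡.ribbon, 𝓡.N_eq, mul_commute_tensor]

-- If the sum vanished, so would `∑ χ(v⁻¹) χ(rightComponent π N)` for every `π`; nondegeneracy of
-- `N` provides a `π` for which this sum is the number of characters.
lemma sum_apply_inv_v_ne_zero [StarModule ℂ G] [Fintype I] {𝓡 : RibbonStructure G}
    (hχ : IsCharacterSystem χ)
    (hN : Function.Surjective (rightComponents (𝓡.N : G ⊗[ℂ] G)))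
    (hinj : ∀ b, Function.Injective fun a => charMul (χ a) (χ b)) :
    ∑ a, χ a ((𝓡.v⁻¹ : Gˣ) : G) ≠ 0 := by
  intro hsum
  have smul_evalFirst_N (a : I) : χ a ((𝓡.v⁻¹ : Gˣ) : G) • evalFirst (χ a) (𝓡.N : G ⊗[ℂ] G) =
      (𝓡.v : G) * evalFirst (χ a) (comul (R := ℂ) ((𝓡.v⁻¹ : Gˣ) : G)) := by
    rw [hχ.N_eq_tmul_mul_comul, map_mul, evalFirst_tmul, smul_mul_assoc, smul_smul, ← map_mul,
      Units.inv_mul, map_one, one_smul]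
  have sum_N_eq_zero :
      ∑ a, χ a ((𝓡.v⁻¹ : Gˣ) : G) • evalFirst (χ a) (𝓡.N : G ⊗[ℂ] G) = 0 := by
    rw [Finset.sum_congr rfl fun a _ => smul_evalFirst_N a, ← Finset.mul_sum,
      hχ.sum_evalFirst_comul hinj, hsum, zero_smul, mul_zero]
  obtain ⟨π, hπ⟩ := hN (𝓡.v : G)
  rw [rightComponents_apply] at hπ
  have card_eq_zero := congrArg π sum_N_eq_zero
  simp only [map_sum, map_smul, ← apply_rightComponent, hπ, smul_eq_mul, ← map_mul,
    Units.inv_mul, map_one, map_zero] at card_eq_zero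
  have := hχ.nonempty
  simp at card_eq_zero

end IsCharacterSystem

lemma RibbonStructure.mapSnd_inv_S_mul_inv {G : Type*} [Ring G] [HopfAlgebra ℂ G] [StarRing G]
    [StarModule ℂ G] (𝓡 : RibbonStructure G) {B : Type*} [Ring B] [Algebra ℂ B]
    (ι : G →ₐ[ℂ] B) (Φ : (G ⊗[ℂ] B)ˣ)
    (hcov : ∀ ξ : G, ((1 : G) ⊗ₜ[ℂ] ι ξ) * (Φ : G ⊗[ℂ] B) =
      Φ * mapSnd ι (flip (comul (R := ℂ) ξ))) :
    mapSnd ι ((𝓡.S⁻¹ : (G ⊗[ℂ] G)ˣ) : G ⊗[ℂ] G) * ((Φ⁻¹ : (G ⊗[ℂ] B)ˣ) : G ⊗[ℂ] B) =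
      ((𝓡.κ : G) ⊗ₜ[ℂ] (1 : B)) * ((1 : G) ⊗ₜ[ℂ] ι (𝓡.κ : G)) *
      mapSnd ι ((𝓡.Rplus⁻¹ : (G ⊗[ℂ] G)ˣ) : G ⊗[ℂ] G) *
      ((Φ⁻¹ : (G ⊗[ℂ] B)ˣ) : G ⊗[ℂ] B) * ((1 : G) ⊗ₜ[ℂ] ι ((𝓡.κ⁻¹ : Gˣ) : G)) := by
  let right : G →* G ⊗[ℂ] B := (Algebra.TensorProduct.includeRight.comp ι).toMonoidHom
  let act := Units.map (mapSnd (G := G) ι).toMonoidHom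
  let Δ := Units.map (comulAlgHom ℂ G).toMonoidHom
  let Δ' := Units.map (flip.comp (comulAlgHom ℂ G)).toMonoidHom
  have R_mul_comul : 𝓡.R * Δ 𝓡.κ = Δ' 𝓡.κ * 𝓡.R := Units.ext (𝓡.R_comul _)
  have inv_S : 𝓡.S⁻¹ = 𝓡.κκ * 𝓡.R⁻¹ * Δ' 𝓡.κ⁻¹ := by
    have S_def : 𝓡.S = 𝓡.R * Δ 𝓡.κ * 𝓡.κκ⁻¹ := rfl
    rw [S_def, R_mul_comul, map_inv]
    group
  have cov_inv : Φ⁻¹ * Units.map right 𝓡.κ⁻¹ = act (Δ' 𝓡.κ⁻¹) * Φ⁻¹ := by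
    have cov : Units.map right 𝓡.κ⁻¹ * Φ = Φ * act (Δ' 𝓡.κ⁻¹) := Units.ext (hcov _)
    rw [eq_mul_inv_iff_mul_eq, mul_assoc, cov, inv_mul_cancel_left]
  have unit_eq : act 𝓡.S⁻¹ * Φ⁻¹ =
      act 𝓡.κκ * act 𝓡.R⁻¹ * Φ⁻¹ * Units.map right 𝓡.κ⁻¹ := by
    rw [inv_S, map_mul, map_mul, mul_assoc _ Φ⁻¹, cov_inv, mul_assoc (_ * _)]
  have act_κκ : (act 𝓡.κκ : G ⊗[ℂ] B) =
      ((𝓡.κ : G) ⊗ₜ[ℂ] (1 : B)) * ((1 : G) ⊗ₜ[ℂ] ι (𝓡.κ : G)) := by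
    change mapSnd ι (𝓡.κκ : G ⊗[ℂ] G) = _
    rw [𝓡.κκ_val, mapSnd_tmul, Algebra.TensorProduct.tmul_mul_tmul, mul_one, one_mul]
  have val_eq := congrArg Units.val unit_eq
  rw [Units.val_mul, Units.val_mul, Units.val_mul, Units.val_mul, act_κκ] at val_eq
  exact val_eq

/-! ### Hilbert space realization -/

section Eigenvectors

variable {G : Type*} [Ring G] [HopfAlgebra ℂ G]

lemma evalFirst_covariant {B : Type*} [Ring B] [Algebra ℂ B] {ι : G →ₐ[ℂ] B} {Φ : G ⊗[ℂ] B}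
    (hcov : ∀ ξ : G, ((1 : G) ⊗ₜ[ℂ] ι ξ) * Φ = Φ * mapSnd ι (flip (comul (R := ℂ) ξ)))
    (φ : G →ₐ[ℂ] ℂ) (ξ : G) :
    ι ξ * evalFirst φ Φ = evalFirst φ Φ * ι (evalFirst φ (flip (comul (R := ℂ) ξ))) := by
  simpa [evalFirst_mapSnd] using congrArg (evalFirst φ) (hcov ξ)

lemma counit_evalFirst_flip_comul (φ : G →ₐ[ℂ] ℂ) (ξ : G) :
    counit (R := ℂ) (evalFirst φ (flip (comul (R := ℂ) ξ))) = φ ξ :=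
  (apply_evalFirst_flip φ (counitAlgHom ℂ G) _).trans (congrArg φ (evalFirst_counit_comul ξ))

variable {W : Type*} [AddCommGroup W] [Module ℂ W] {ι : G →ₐ[ℂ] Module.End ℂ W}

lemma apply_evalFirst_vacuum {Φ : G ⊗[ℂ] Module.End ℂ W}
    (hcov : ∀ ξ : G, ((1 : G) ⊗ₜ[ℂ] ι ξ) * Φ = Φ * mapSnd ι (flip (comul (R := ℂ) ξ)))
    {w : W} (hw : ∀ g, ι g w = counit (R := ℂ) g • w) (φ : G →ₐ[ℂ] ℂ) (g : G) :
    ι g (evalFirst φ Φ w) = φ g • evalFirst φ Φ w := by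
  rw [← Module.End.mul_apply, evalFirst_covariant hcov, Module.End.mul_apply, hw, map_smul,
    counit_evalFirst_flip_comul]

lemma IsCharacterSystem.linearIndependent [StarRing G] [FiniteDimensional ℂ G] {I : Type*}
    [Finite I] {χ : I → G →ₐ[ℂ] ℂ} (hχ : IsCharacterSystem χ) {u : I → W} (hu₀ : ∀ a, u a ≠ 0)
    (hu : ∀ a g, ι g (u a) = χ a g • u a) : LinearIndependent ℂ u := by
  obtain ⟨n, ⟨e⟩⟩ := Finite.exists_equiv_fin I
  obtain ⟨g, hg⟩ := hχ.exists_apply_eq fun a => ((e a : ℕ) : ℂ)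
  have values_injective : Function.Injective fun a => χ a g := fun a c hac =>
    e.injective (Fin.ext (Nat.cast_injective (R := ℂ) (by simpa only [hg] using hac)))
  exact Module.End.eigenvectors_linearIndependent' (ι g) _ values_injective u
    fun a => ⟨Module.End.mem_eigenspace_iff.2 (hu a g), hu₀ a⟩

variable [Nontrivial W] {Φ : (G ⊗[ℂ] Module.End ℂ W)ˣ}

lemma IsIntegral.exists_vacuum [FiniteDimensional ℂ G] {Λ : G} (hΛ : IsIntegral Λ)
    (hcov : ∀ ξ : G, ((1 : G) ⊗ₜ[ℂ] ι ξ) * (Φ : G ⊗[ℂ] Module.End ℂ W) =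
      (Φ : G ⊗[ℂ] Module.End ℂ W) * mapSnd ι (flip (comul (R := ℂ) ξ))) :
    ∃ w : W, w ≠ 0 ∧ ∀ g, ι g w = counit (R := ℂ) g • w := by
  obtain ⟨w, hw⟩ := DFunLike.ne_iff.1 (hΛ.map_ne_zero hcov)
  refine ⟨ι Λ w, hw, fun g => ?_⟩
  rw [← Module.End.mul_apply, ← map_mul, hΛ.left, map_smul, LinearMap.smul_apply]

lemma exists_eigenbasis [FiniteDimensional ℂ W] [StarRing G] [FiniteDimensional ℂ G]
    {I : Type*} [Finite I] {χ : I → G →ₐ[ℂ] ℂ} (hχ : IsCharacterSystem χ)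
    (hW : Module.finrank ℂ W = Module.finrank ℂ G) {Λ : G} (hΛ : IsIntegral Λ)
    (hcov : ∀ ξ : G, ((1 : G) ⊗ₜ[ℂ] ι ξ) * (Φ : G ⊗[ℂ] Module.End ℂ W) =
      (Φ : G ⊗[ℂ] Module.End ℂ W) * mapSnd ι (flip (comul (R := ℂ) ξ))) :
    ∃ (u : Module.Basis I ℂ W) (w : W), (∀ g, ι g w = counit (R := ℂ) g • w) ∧
      (∀ a, evalFirst (χ a) (Φ : G ⊗[ℂ] Module.End ℂ W) w = u a) ∧
      ∀ a g, ι g (u a) = χ a g • u a := by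
  cases nonempty_fintype I
  have := hχ.nonempty
  obtain ⟨w, hw₀, hw⟩ := hΛ.exists_vacuum hcov
  let u (a : I) : W := evalFirst (χ a) (Φ : G ⊗[ℂ] Module.End ℂ W) w
  have hu (a g) : ι g (u a) = χ a g • u a := apply_evalFirst_vacuum hcov hw _ _
  have hu₀ (a) : u a ≠ 0 := fun h => hw₀ <|
    ((Module.End.isUnit_iff _).1 (Φ.isUnit.map (evalFirst (χ a)))).injective
      (h.trans (map_zero _).symm)
  exact ⟨basisOfLinearIndependentOfCardEqFinrank (hχ.linearIndependent hu₀ hu)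
    (by rw [hχ.card_eq, hW]), w, hw, fun a => by simp [u], fun a g => by simp [hu]⟩

end Eigenvectors

namespace IsCharacterSystem

variable {G : Type*} [Ring G] [HopfAlgebra ℂ G] [StarRing G] {I : Type*} {χ : I → G →ₐ[ℂ] ℂ}

lemma exists_apply_algHom (hχ : IsCharacterSystem χ) (θ : G →ₐ[ℂ] G) (a : I) :
    ∃ c, ∀ g, χ a (θ g) = χ c g := by
  obtain ⟨c, hc⟩ := hχ.exists_eq ((χ a).comp θ)
  exact ⟨c, fun g => (DFunLike.congr_fun hc g).symm⟩

lemma map_star (hχ : IsCharacterSystem χ) (θ : G →ₐ[ℂ] G) (g : G) :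
    θ (star g) = star (θ g) := by
  refine hχ.ext_apply fun a => ?_
  obtain ⟨c, hc⟩ := hχ.exists_apply_algHom θ a
  rw [hχ.apply_star, hc, hc, hχ.apply_star]

lemma sum_apply_algHom [Fintype I] (hχ : IsCharacterSystem χ) {θ : G →ₐ[ℂ] G}
    (hθ : Function.Surjective θ) (g : G) : ∑ a, χ a (θ g) = ∑ a, χ a g := by
  choose p hp using hχ.exists_apply_algHom θ
  have p_injective : Function.Injective p := fun a c hac =>
    hχ.bijective.injective <| AlgHom.ext <| hθ.forall.2 fun x => by rw [hp, hp, hac]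
  rw [← (Finite.injective_iff_bijective.1 p_injective).sum_comp fun a => χ a g]
  exact Finset.sum_congr rfl fun a _ => hp a g

end IsCharacterSystem

lemma RibbonStructure.counit_evalFirst_N {G : Type*} [Ring G] [HopfAlgebra ℂ G] [StarRing G]
    [StarModule ℂ G] (𝓡 : RibbonStructure G) (φ : G →ₐ[ℂ] ℂ) :
    counit (R := ℂ) (evalFirst φ (𝓡.N : G ⊗[ℂ] G)) = 1 := by
  have N_eq_tmul_mul_flip_comul : (𝓡.N : G ⊗[ℂ] G) =
      ((𝓡.v : G) ⊗ₜ[ℂ] (𝓡.v : G)) * flip (comul (R := ℂ) ((𝓡.v⁻¹ : Gˣ) : G)) := by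
    simpa [𝓡.N_eq] using congrArg flip 𝓡.ribbon
  rw [N_eq_tmul_mul_flip_comul, map_mul, evalFirst_tmul, counit_mul, counit_evalFirst_flip_comul,
    map_smul, 𝓡.counit_v, smul_eq_mul, mul_one, ← map_mul, Units.mul_inv, map_one]

section Hilbert

variable {G : Type*} [Ring G] [HopfAlgebra ℂ G] [StarRing G] [StarModule ℂ G]
  {𝓡 : RibbonStructure G} {F : (G ⊗[ℂ] (G ⊗[ℂ] Center G))ˣ}
  {σ : Center G →ₐ[ℂ] G ⊗[ℂ] Center G} {I : Type*} [Fintype I] {χ : I → G →ₐ[ℂ] ℂ}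
  {H : Type*} [NormedAddCommGroup H] [InnerProductSpace ℂ H]

open scoped InnerProductSpace

lemma clm_ext_orthonormalBasis (b : OrthonormalBasis I ℂ H) {S T : H →L[ℂ] H}
    (h : ∀ a c, ⟪b c, S (b a)⟫_ℂ = ⟪b c, T (b a)⟫_ℂ) : S = T := by
  refine ContinuousLinearMap.coe_injective (b.toBasis.ext fun a => ?_)
  refine InnerProductSpace.ext_inner_left_basis b.toBasis fun c => ?_
  simpa using h a c

/-- A solution of the relations on a Hilbert space, with its action of `G`, whose vertex operator
creates an orthonormal eigenbasis out of a vacuum vector `w`. -/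
structure IsVacuumSolution (𝓡 : RibbonStructure G) (F : (G ⊗[ℂ] (G ⊗[ℂ] Center G))ˣ)
    (σ : Center G →ₐ[ℂ] G ⊗[ℂ] Center G) (χ : I → G →ₐ[ℂ] ℂ) (b : OrthonormalBasis I ℂ H)
    (ι : G →ₐ[ℂ] H →L[ℂ] H) (j : Center G →ₐ[ℂ] H →L[ℂ] H) (Φ : (G ⊗[ℂ] (H →L[ℂ] H))ˣ)
    (w : H) : Prop where
  characters : IsCharacterSystem χ
  solves : SolvesRelations F σ j Φ
  injective : Function.Injective j
  action : IsMonodromyAction 𝓡 σ j Φ ι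
  apply_basis : ∀ a g, ι g (b a) = χ a g • b a
  apply_vacuum : ∀ g, ι g w = counit (R := ℂ) g • w
  create : ∀ a, evalFirst (χ a) (Φ : G ⊗[ℂ] (H →L[ℂ] H)) w = b a

namespace IsVacuumSolution

variable {b : OrthonormalBasis I ℂ H} {ι : G →ₐ[ℂ] H →L[ℂ] H} {j : Center G →ₐ[ℂ] H →L[ℂ] H}
  {Φ : (G ⊗[ℂ] (H →L[ℂ] H))ˣ} {w : H}

lemma action_injective (h : IsVacuumSolution 𝓡 F σ χ b ι j Φ w) : Function.Injective ι := by
  intro x y hxy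
  refine h.characters.ext_apply fun a => smul_left_injective ℂ (b.toBasis.ne_zero a) ?_
  simp only [OrthonormalBasis.coe_toBasis, ← h.apply_basis, hxy]

lemma star_action [CompleteSpace H] (h : IsVacuumSolution 𝓡 F σ χ b ι j Φ w) (g : G) :
    star (ι g) = ι (star g) := by
  classical
  refine clm_ext_orthonormalBasis b fun a c => ?_
  rw [ContinuousLinearMap.star_eq_adjoint, ContinuousLinearMap.adjoint_inner_right,
    h.apply_basis, h.apply_basis, inner_smul_left, inner_smul_right, h.characters.apply_star,
    b.inner_eq_ite]
  split_ifs with hac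
  · rw [hac, Complex.star_def]
  · simp

variable [FiniteDimensional ℂ G]

lemma exists_eq_action (h : IsVacuumSolution 𝓡 F σ χ b ι j Φ w) {T : H →L[ℂ] H}
    (hT : ∀ g, Commute (ι g) T) : ∃ g, ι g = T := by
  classical
  choose e he using fun k : I => h.characters.exists_apply_eq fun i => if i = k then 1 else 0
  have action_e (k : I) (x : H) : ι (e k) x = b.repr x k • b k := by
    conv_lhs => rw [← b.sum_repr x]
    simp [h.apply_basis, he]
  have T_basis (k : I) : T (b k) = b.repr (T (b k)) k • b k := by
    have := DFunLike.congr_fun (hT (e k)).eq (b k)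
    rw [mul_apply_eq_comp, mul_apply_eq_comp, action_e, h.apply_basis, he, if_pos rfl,
      one_smul] at this
    exact this.symm
  obtain ⟨g, hg⟩ := h.characters.exists_apply_eq fun k => b.repr (T (b k)) k
  refine ⟨g, ContinuousLinearMap.coe_injective (b.toBasis.ext fun k => ?_)⟩
  rw [OrthonormalBasis.coe_toBasis, ContinuousLinearMap.coe_coe, ContinuousLinearMap.coe_coe,
    h.apply_basis, hg, ← T_basis]

lemma exists_factor (h : IsVacuumSolution 𝓡 F σ χ b ι j Φ w) :
    ∃ θ : G →ₐ[ℂ] G, Function.Bijective θ ∧ ∀ f : Center G, j f = ι (θ f) := by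
  let θ₀ : Center G →ₐ[ℂ] G := (AlgEquiv.ofInjective ι h.action_injective).symm.toAlgHom.comp
    (j.codRestrict ι.range fun f => h.exists_eq_action fun g => h.action.commute f g)
  have hθ₀ (f) : ι (θ₀ f) = j f :=
    congrArg Subtype.val ((AlgEquiv.ofInjective ι h.action_injective).apply_symm_apply _)
  let toCenter : G →ₐ[ℂ] Center G := (AlgHom.id ℂ G).codRestrict (Center G).toSubalgebra fun g =>
    Subalgebra.mem_center_iff.2 fun x => h.characters.mul_commute x g
  have injective : Function.Injective (θ₀.comp toCenter) := by
    intro x y hxy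
    have : j (toCenter x) = j (toCenter y) := by
      rw [← hθ₀, ← hθ₀]
      exact congrArg ι hxy
    exact congrArg Subtype.val (h.injective this)
  exact ⟨θ₀.comp toCenter, ⟨injective, LinearMap.injective_iff_surjective
    (f := (θ₀.comp toCenter).toLinearMap).1 injective⟩, fun f => (hθ₀ f).symm⟩

lemma star_embedding [CompleteSpace H] (h : IsVacuumSolution 𝓡 F σ χ b ι j Φ w) (f : Center G) :
    star (j f) = j (star f) := by
  obtain ⟨θ, -, hj⟩ := h.exists_factor
  rw [hj, hj, h.star_action, ← h.characters.map_star]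
  rfl

lemma range_embedding (h : IsVacuumSolution 𝓡 F σ χ b ι j Φ w) :
    Set.range j = ι '' (Center G : Set G) := by
  obtain ⟨θ, hθ, hj⟩ := h.exists_factor
  have mem_center (g : G) : g ∈ Center G :=
    Subalgebra.mem_center_iff.2 fun x => h.characters.mul_commute x g
  ext T
  constructor
  · rintro ⟨f, rfl⟩
    exact ⟨θ f, mem_center _, (hj f).symm⟩
  · rintro ⟨g, -, rfl⟩
    obtain ⟨x, rfl⟩ := hθ.surjective g
    exact ⟨⟨x, mem_center x⟩, hj _⟩

-- `Φ_c Φ_a w = F_{ac} Φ_{ac} w`, where the eigenvalues of `F_{ac}` have modulus one.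
lemma exists_phase (h : IsVacuumSolution 𝓡 F σ χ b ι j Φ w) (hF : StructureRelations 𝓡 F σ)
    (a c : I) : ∃ (d : I) (z : ℂ), star z * z = 1 ∧ χ d = charMul (χ a) (χ c) ∧
      evalFirst (χ c) (Φ : G ⊗[ℂ] (H →L[ℂ] H)) (b a) = z • b d := by
  obtain ⟨d, hd⟩ := h.characters.exists_eq (charMul (χ a) (χ c))
  obtain ⟨θ, -, hj⟩ := h.exists_factor
  let f := evalFirst (χ c) (evalFirst (χ a) (F : G ⊗[ℂ] (G ⊗[ℂ] Center G)))
  have product : evalFirst (χ c) (Φ : G ⊗[ℂ] (H →L[ℂ] H)) *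
      evalFirst (χ a) (Φ : G ⊗[ℂ] (H →L[ℂ] H)) =
      ι (θ f) * evalFirst (χ d) (Φ : G ⊗[ℂ] (H →L[ℂ] H)) := by
    have := congrArg (fun y => evalFirst (χ c) (evalFirst (χ a) y)) h.solves.operatorProduct
    simpa only [map_mul, evalFirst_leg1, leg2_apply, evalFirst_tmul, map_one, one_smul,
      evalFirst_mapSnd, evalFirst_evalFirst_comulFirst, ← hd, hj] using this
  refine ⟨d, χ d (θ f), ?_, hd, ?_⟩
  · have star_f_mul : star (f : G) * f = 1 :=
      congrArg Subtype.val (h.characters.star_mul_evalFirst_F_eq_one hF a c)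
    rw [← h.characters.apply_star, ← h.characters.map_star, ← map_mul, ← map_mul, star_f_mul,
      map_one, map_one]
  · rw [← h.apply_basis, ← h.create, ← h.create, ← mul_apply_eq_comp, product, mul_apply_eq_comp]

variable [CompleteSpace H]

lemma charMul_injective (h : IsVacuumSolution 𝓡 F σ χ b ι j Φ w) (hF : StructureRelations 𝓡 F σ)
    (c : I) : Function.Injective fun a => charMul (χ a) (χ c) := by
  classical
  intro a a' haa'
  obtain ⟨d, z, -, hd, hΦ⟩ := h.exists_phase hF a c
  obtain ⟨d', z', hz', hd', hΦ'⟩ := h.exists_phase hF a' c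
  obtain rfl : d = d' := h.characters.bijective.injective (by rw [hd, hd']; exact haa')
  have evalFirst_injective :
      Function.Injective ⇑(evalFirst (χ c) (Φ : G ⊗[ℂ] (H →L[ℂ] H)) : H →L[ℂ] H) :=
    (ContinuousLinearMap.isUnit_iff_bijective.1 (Φ.isUnit.map (evalFirst (χ c)))).injective
  have smul_eq : z' • b a = z • b a' := evalFirst_injective <| by
    rw [map_smul, map_smul, hΦ, hΦ', smul_smul, smul_smul, mul_comm]
  by_contra hne
  have z'_eq_zero : z' = 0 := by
    simpa [inner_smul_right, b.inner_eq_ite, hne] using congrArg (fun x => ⟪b a, x⟫_ℂ) smul_eq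
  simp [z'_eq_zero] at hz'

lemma star_eq_inv (h : IsVacuumSolution 𝓡 F σ χ b ι j Φ w) (hF : StructureRelations 𝓡 F σ) :
    star (Φ : G ⊗[ℂ] (H →L[ℂ] H)) =
      ((Φ⁻¹ : (G ⊗[ℂ] (H →L[ℂ] H))ˣ) : G ⊗[ℂ] (H →L[ℂ] H)) := by
  classical
  refine Units.eq_inv_of_mul_eq_one_right (h.characters.ext_evalFirst fun c => ?_)
  rw [map_mul, map_one, evalFirst_star (h.characters.apply_star c)]
  refine clm_ext_orthonormalBasis b fun a a' => ?_
  rw [mul_apply_eq_comp, ContinuousLinearMap.star_eq_adjoint,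
    ContinuousLinearMap.adjoint_inner_right, one_apply_eq_self]
  obtain rfl | hne := eq_or_ne a' a
  · obtain ⟨d, z, hz, -, hΦ⟩ := h.exists_phase hF a' c
    rw [hΦ, inner_smul_left, inner_smul_right, b.inner_eq_ite, b.inner_eq_ite]
    simpa using hz
  · obtain ⟨d, z, -, hd, hΦ⟩ := h.exists_phase hF a c
    obtain ⟨d', z', -, hd', hΦ'⟩ := h.exists_phase hF a' c
    have d'_ne : d' ≠ d := by
      rintro rfl
      exact hne (h.charMul_injective hF c (hd'.symm.trans hd))
    simp [hΦ, hΦ', inner_smul_left, inner_smul_right, b.inner_eq_ite, hne, d'_ne]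

omit [FiniteDimensional ℂ G] [CompleteSpace H] in
-- The relation `Φ N = D Φ`, evaluated in the character `χ a` and applied to the vacuum.
lemma apply_v_mul_apply_inv_v (h : IsVacuumSolution 𝓡 F σ χ b ι j Φ w) {θ : G →ₐ[ℂ] G}
    (hj : ∀ f : Center G, j f = ι (θ f)) (a : I) :
    χ a (𝓡.v : G) * χ a (θ ((𝓡.v⁻¹ : Gˣ) : G)) * counit (R := ℂ) (θ (𝓡.v : G)) = 1 := by
  have exchange : evalFirst (χ a) (Φ : G ⊗[ℂ] (H →L[ℂ] H)) * j (𝓡.vC : Center G) =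
      j (evalFirst (χ a) (σ (𝓡.vC : Center G))) * evalFirst (χ a) (Φ : G ⊗[ℂ] (H →L[ℂ] H)) := by
    simpa [evalFirst_mapSnd] using congrArg (evalFirst (χ a)) (h.solves.exchange 𝓡.vC)
  have monodromy := congrArg (evalFirst (χ a)) h.action.monodromy
  rw [map_mul, map_mul, evalFirst_mapSnd, evalFirst_mapSnd, structD_val, map_mul, evalFirst_tmul,
    map_mul, mul_assoc, ← exchange, map_smul, smul_mul_assoc, hj, hj] at monodromy
  have vacuum := DFunLike.congr_fun monodromy w
  simp only [mul_apply_eq_comp, h.apply_vacuum, map_smul, h.create,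
    𝓡.counit_evalFirst_N, smul_apply, h.apply_basis, one_smul,
    smul_smul] at vacuum
  refine smul_left_injective ℂ (b.toBasis.ne_zero a) ?_
  simp only [OrthonormalBasis.coe_toBasis, one_smul]
  refine Eq.trans (congrArg (· • b a) ?_) vacuum.symm
  change _ = χ a (𝓡.v : G) *
    (counit (R := ℂ) (θ (𝓡.v : G)) * χ a (θ ((𝓡.v⁻¹ : Gˣ) : G)))
  ring

lemma embedding_vC (h : IsVacuumSolution 𝓡 F σ χ b ι j Φ w) (hF : StructureRelations 𝓡 F σ)
    (hN : Function.Surjective (rightComponents (𝓡.N : G ⊗[ℂ] G))) :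
    j (𝓡.vC : Center G) = ι (𝓡.v : G) := by
  obtain ⟨θ, hθ, hj⟩ := h.exists_factor
  have apply_inv_v (a : I) : χ a ((𝓡.v⁻¹ : Gˣ) : G) =
      χ a (θ ((𝓡.v⁻¹ : Gˣ) : G)) * counit (R := ℂ) (θ (𝓡.v : G)) := by
    rw [← mul_one (χ a _), ← h.apply_v_mul_apply_inv_v hj a, mul_assoc, ← mul_assoc, ← map_mul,
      Units.inv_mul, map_one, one_mul]
  have counit_eq_one : counit (R := ℂ) (θ (𝓡.v : G)) = 1 := by
    have sum_eq : (∑ a, χ a ((𝓡.v⁻¹ : Gˣ) : G)) * counit (R := ℂ) (θ (𝓡.v : G)) =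
        ∑ a, χ a ((𝓡.v⁻¹ : Gˣ) : G) := by
      conv_lhs => rw [← h.characters.sum_apply_algHom hθ.surjective, Finset.sum_mul]
      exact Finset.sum_congr rfl fun a _ => (apply_inv_v a).symm
    exact (mul_eq_left₀
      (h.characters.sum_apply_inv_v_ne_zero hN (h.charMul_injective hF))).1 sum_eq
  have θ_inv_v : θ ((𝓡.v⁻¹ : Gˣ) : G) = ((𝓡.v⁻¹ : Gˣ) : G) :=
    h.characters.ext_apply fun a => by rw [apply_inv_v a, counit_eq_one, mul_one]
  have θ_v : Units.map (θ : G →* G) 𝓡.v = 𝓡.v :=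
    inv_injective (Units.ext ((Units.coe_map_inv _ _).trans θ_inv_v))
  rw [hj]
  exact congrArg (fun u : Gˣ => ι u) θ_v

end IsVacuumSolution

section Transport

variable {W : Type*} [AddCommGroup W] [Module ℂ W] [FiniteDimensional ℂ H]

/-- The isomorphism of operator algebras induced by a linear isomorphism onto a Hilbert space. -/
def operatorEquiv (T : W ≃ₗ[ℂ] H) : Module.End ℂ W ≃ₐ[ℂ] (H →L[ℂ] H) :=
  (T.conjAlgEquiv ℂ).trans (Module.End.toContinuousLinearMap H)

lemma operatorEquiv_apply (T : W ≃ₗ[ℂ] H) (A : Module.End ℂ W) (x : W) :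
    operatorEquiv T A (T x) = T (A x) :=
  congrArg (fun y => T (A y)) (T.symm_apply_apply x)

lemma IsVacuumSolution.of_eigenbasis (hχ : IsCharacterSystem χ) {ι : G →ₐ[ℂ] Module.End ℂ W}
    {j : Center G →ₐ[ℂ] Module.End ℂ W} {Φ : (G ⊗[ℂ] Module.End ℂ W)ˣ}
    (h : SolvesRelations F σ j Φ) (hj : Function.Injective j) (hι : IsMonodromyAction 𝓡 σ j Φ ι)
    {u : Module.Basis I ℂ W} (hu : ∀ a g, ι g (u a) = χ a g • u a) {w : W}
    (hw : ∀ g, ι g w = counit (R := ℂ) g • w)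
    (hcreate : ∀ a, evalFirst (χ a) (Φ : G ⊗[ℂ] Module.End ℂ W) w = u a)
    {b : OrthonormalBasis I ℂ H} {ρ : G →ₐ[ℂ] H →L[ℂ] H}
    (hb : ∀ a g, ρ g (b a) = χ a g • b a) {T : W ≃ₗ[ℂ] H} (hT : ∀ a, T (u a) = b a) :
    IsVacuumSolution 𝓡 F σ χ b ρ ((operatorEquiv T : _ →ₐ[ℂ] H →L[ℂ] H).comp j)
      (Units.map (mapSnd (G := G) (operatorEquiv T : _ →ₐ[ℂ] H →L[ℂ] H)).toMonoidHom Φ)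
      (T w) := by
  have comp_action : (operatorEquiv T : _ →ₐ[ℂ] H →L[ℂ] H).comp ι = ρ := by
    ext1 g
    refine ContinuousLinearMap.coe_injective (b.toBasis.ext fun a => ?_)
    change operatorEquiv T (ι g) (b.toBasis a) = ρ g (b.toBasis a)
    rw [OrthonormalBasis.coe_toBasis, hb, ← hT, operatorEquiv_apply, hu, map_smul]
  refine ⟨hχ, h.map _, (operatorEquiv T).injective.comp hj, ?_, hb, fun g => ?_, fun a => ?_⟩
  · rw [← comp_action]
    exact hι.map _
  · rw [← comp_action, ← map_smul, ← hw, ← operatorEquiv_apply]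
    rfl
  · rw [← hT, ← hcreate, ← operatorEquiv_apply]
    exact congrArg (fun A : H →L[ℂ] H => A (T w)) (evalFirst_mapSnd _ _ _)

end Transport

end Hilbert

section Model

variable {G : Type u₁} [Ring G] [HopfAlgebra ℂ G] [StarRing G] {I : Type u₂} [Fintype I]
  {V : I → Type u₃} [∀ i, NormedAddCommGroup (V i)] [∀ i, InnerProductSpace ℂ (V i)]
  [∀ i, FiniteDimensional ℂ (V i)] [∀ i, CompleteSpace (V i)]
  {τ : ∀ i, G →⋆ₐ[ℂ] (V i →L[ℂ] V i)}

lemma exists_model_basis {χ : I → G →ₐ[ℂ] ℂ} (hdim : ∀ i, Module.finrank ℂ (V i) = 1)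
    (hχ : ∀ i g, τ i g = χ i g • 1) :
    ∃ b : OrthonormalBasis I ℂ (ModelSpace V), ∀ a g, modelRep τ g (b a) = χ a g • b a := by
  classical
  let B (i : I) : OrthonormalBasis (Fin 1) ℂ (V i) :=
    (stdOrthonormalBasis ℂ (V i)).reindex (finCongr (hdim i))
  let b : OrthonormalBasis I ℂ (ModelSpace V) :=
    (Pi.orthonormalBasis B).reindex (Equiv.sigmaUnique I fun _ => Fin 1)
  have b_apply (a : I) : b a = PiLp.single 2 a (B a default) := by
    rw [OrthonormalBasis.reindex_apply, Pi.orthonormalBasis_apply]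
    rfl
  refine ⟨b, fun a g => ?_⟩
  ext i
  rw [b_apply]
  change τ i g (PiLp.single 2 a (B a default) i) = χ a g • PiLp.single 2 a (B a default) i
  rw [hχ]
  obtain rfl | hne := eq_or_ne i a
  · simp
  · simp [hne]

theorem exists_isVacuumSolution [StarModule ℂ G] [FiniteDimensional ℂ G] [IsSemisimpleRing G]
    [DecidableEq I] {𝓡 : RibbonStructure G} {F : (G ⊗[ℂ] (G ⊗[ℂ] Center G))ˣ}
    {σ : Center G →ₐ[ℂ] G ⊗[ℂ] Center G} (hτ : IsIrrepSystem τ)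
    (hmodular : IsUnit (sMatrix 𝓡 τ)) (hF : StructureRelations 𝓡 F σ) :
    ∃ (χ : I → G →ₐ[ℂ] ℂ) (b : OrthonormalBasis I ℂ (ModelSpace V))
      (j : Center G →ₐ[ℂ] ModelEnd V) (Φ : (G ⊗[ℂ] ModelEnd V)ˣ) (w : ModelSpace V),
      IsVacuumSolution 𝓡 F σ χ b (modelRep τ) j Φ w ∧ IsAlgebraOfRelations.{_, u₄} F σ j Φ := by
  have hN := rightComponents_N_surjective 𝓡 hτ hmodular
  have hS := 𝓡.antipode_surjective (isUnit_uElt 𝓡 hτ hmodular)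
  obtain ⟨Λ, hΛ⟩ := exists_isIntegral G
  have hcomm := hF.mul_comm hN hS hΛ
  obtain ⟨χ, hχ, hτχ⟩ := hτ.exists_characters hcomm
  obtain ⟨b, hb⟩ := exists_model_basis (hτ.finrank_eq_one hcomm) hτχ
  have := nontrivial_of_hopfAlgebra G
  have finrank_dual : Module.finrank ℂ (Module.Dual ℂ G) = Module.finrank ℂ G :=
    Subspace.dual_finrank_eq
  have hsol := hF.regularSolution_solves
  have hgen := hsol.adjoin_eq_top hF hN hS hΛ finrank_dual.le
  have hdim : Module.finrank ℂ (Center G) * Module.finrank ℂ G ≤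
      Module.finrank ℂ (Module.End ℂ (Module.Dual ℂ G)) := by
    rw [Module.finrank_linearMap, finrank_dual]
    exact Nat.mul_le_mul_right _ (Submodule.finrank_le
      (Subalgebra.toSubmodule (Center G).toSubalgebra))
  obtain ⟨ι, hι⟩ := hsol.exists_isMonodromyAction hF hN
  obtain ⟨u, w, hw, hcreate, hu⟩ := exists_eigenbasis hχ finrank_dual hΛ hι.covariance
  let T : Module.Dual ℂ G ≃ₗ[ℂ] ModelSpace V := u.equiv b.toBasis (Equiv.refl I)
  have hT (a : I) : T (u a) = b a := by simp [T]
  have : FiniteDimensional ℂ (ModelEnd V) := Module.Finite.equiv (operatorEquiv T).toLinearEquiv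
  exact ⟨χ, b, _, _, _,
    .of_eigenbasis hχ hsol (hsol.injective hgen hdim) hι hu hw hcreate hb hT,
    (hsol.map _).isAlgebraOfRelations
      (adjoin_generators_map_eq_top hgen (operatorEquiv T).surjective)
      (hdim.trans_eq (operatorEquiv T).toLinearEquiv.finrank_eq)⟩

end Model

end VertexOp

end

theorem proposition2
    {G : Type u₁} [Ring G] [HopfAlgebra ℂ G] [StarRing G] [StarModule ℂ G]
    [FiniteDimensional ℂ G] [IsSemisimpleRing G]
    (𝓡 : VertexOp.RibbonStructure G)
    {I : Type u₂} [Fintype I] [DecidableEq I] {V : I → Type u₃}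
    [∀ i, NormedAddCommGroup (V i)] [∀ i, InnerProductSpace ℂ (V i)]
    [∀ i, FiniteDimensional ℂ (V i)] [∀ i, CompleteSpace (V i)]
    (τ : ∀ i, G →⋆ₐ[ℂ] (V i →L[ℂ] V i)) (hτ : VertexOp.IsIrrepSystem τ)
    (hmodular : IsUnit (VertexOp.sMatrix 𝓡 τ))
    (F : (G ⊗[ℂ] (G ⊗[ℂ] VertexOp.Center G))ˣ)
    (σ : VertexOp.Center G →ₐ[ℂ] G ⊗[ℂ] VertexOp.Center G)
    (hFσ : VertexOp.StructureRelations 𝓡 F σ) :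
    ∃ (j : VertexOp.Center G →⋆ₐ[ℂ] VertexOp.ModelEnd V)
      (Φ : (G ⊗[ℂ] VertexOp.ModelEnd V)ˣ),
      Function.Injective j ∧
      Set.range j = VertexOp.modelRep τ '' (VertexOp.Center G : Set G) ∧
      j (𝓡.vC : VertexOp.Center G) = VertexOp.modelRep τ (𝓡.v : G) ∧
      VertexOp.IsVertexOperator 𝓡 τ Φ ∧
      VertexOp.IsAlgebraOfRelations.{u₁, u₄} F σ j.toAlgHom Φ ∧
      (Φ : G ⊗[ℂ] VertexOp.ModelEnd V) *
          VertexOp.mapSnd (VertexOp.modelRep τ) (𝓡.N : G ⊗[ℂ] G) =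
        VertexOp.mapSnd j.toAlgHom (VertexOp.structD 𝓡 σ : G ⊗[ℂ] VertexOp.Center G) *
          (Φ : G ⊗[ℂ] VertexOp.ModelEnd V) := by
  obtain ⟨χ, b, j₀, Φ, w, h, hrel⟩ :=
    VertexOp.exists_isVacuumSolution.{u₁, u₂, u₃, u₄} hτ hmodular hFσ
  let j : VertexOp.Center G →⋆ₐ[ℂ] VertexOp.ModelEnd V :=
    { j₀ with map_star' := fun f => (h.star_embedding f).symm }
  have hstar : star (Φ : G ⊗[ℂ] VertexOp.ModelEnd V) =
      VertexOp.mapSnd (VertexOp.modelRep τ) ((𝓡.S⁻¹ : (G ⊗[ℂ] G)ˣ) : G ⊗[ℂ] G) *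
        ((Φ⁻¹ : (G ⊗[ℂ] VertexOp.ModelEnd V)ˣ) : G ⊗[ℂ] VertexOp.ModelEnd V) := by
    rw [h.characters.S_eq_one hFσ, inv_one, Units.val_one, map_one, one_mul, h.star_eq_inv hFσ]
  have hN := VertexOp.rightComponents_N_surjective 𝓡 hτ hmodular
  have hcov := h.action.covariance
  exact ⟨j, Φ, h.injective, h.range_embedding, h.embedding_vC hFσ hN,
    ⟨hcov, hstar, hstar.trans (𝓡.mapSnd_inv_S_mul_inv _ Φ hcov)⟩, hrel, h.action.monodromy⟩
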